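/- Let $N\ge 1$ and $q\in\mathbb{C}^\times$ with $q^{2N}\neq 1$. On $\mathcal{H}=(\mathbb{C}^2)^{\otimes N}$ let $\check R_{k,k+1}(u)$ be the operator acting on the $k$th and $(k{+}1)$st tensor factors by the matrix (in the basis $\uparrow\uparrow,\uparrow\downarrow,\downarrow\uparrow,\downarrow\downarrow$) $$\check R(u)=\begin{pmatrix}1&0&0&0\\0&u\,g(u)&f(u)&0\\0&f(u)&g(u)&0\\0&0&0&1\end{pmatrix},\qquad f(u)=\frac{u-1}{q\,u-q^{-1}},\quad g(u)=\frac{q-q^{-1}}{q\,u-q^{-1}},$$ and let $e_{k,k+1}=-(q-q^{-1})\,\check R_{k,k+1}'(1)$. Put $[N]=\frac{q^N-q^{-N}}{q-q^{-1}}$, $V(x,y)=\frac{xy}{(qx-q^{-1}y)(qy-q^{-1}x)}$, and for $i<j$ $$S^{\mathrm R}_{[i,j]}=\check R_{i,i+1}(\tfrac{z_{i+1}}{z_i})\cdots\check R_{j-2,j-1}(\tfrac{z_{j-1}}{z_i})\;e_{j-1,j}\;\check R_{j-2,j-1}(\tfrac{z_i}{z_{j-1}})\cdots\check R_{i,i+1}(\tfrac{z_i}{z_{i+1}}),$$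 $$S^{\mathrm L}_{[i,j]}=\check R_{j-1,j}(\tfrac{z_j}{z_{j-1}})\cdots\check R_{i+1,i+2}(\tfrac{z_j}{z_{i+1}})\;e_{i,i+1}\;\check R_{i+1,i+2}(\tfrac{z_{i+1}}{z_j})\cdots\check R_{j-1,j}(\tfrac{z_{j-1}}{z_j}).$$ Let $\mathrm{ev}$ be the evaluation $z_j\mapsto e^{2\pi \mathrm i j/N}$, and define the operators on $\mathcal H$ $$H^{\mathrm L}=\mathrm{ev}\,\frac{[N]}{N}\sum_{i<j}V(z_i,z_j)\,S^{\mathrm L}_{[i,j]},\qquad H^{\mathrm R}=\mathrm{ev}\,\frac{[N]}{N}\sum_{i<j}V(z_i,z_j)\,S^{\mathrm R}_{[i,j]}.$$ On $\mathbb{C}[z_1,\dots,z_N]$ let $T_k=-q^{-1}(q^2z_k-z_{k+1})\frac{1-s_k}{z_k-z_{k+1}}+q$, where $s_k$ exchanges $z_k$ and $z_{k+1}$, let $(\pi F)(z_1,\dots,z_N)=F(p\,z_N,z_1,\dots,z_{N-1})$ for a parameter $p\in\mathbb{C}^\times$, and let $Y_i=T_i\cdots T_{N-1}\,\pi\,T_1^{-1}\cdots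 T_{i-1}^{-1}$. Let $\widetilde D_r=e_r(Y_1,\dots,Y_N)$ (elementary symmetric polynomial), acting on the polynomial factor of $\mathcal H\otimes\mathbb{C}[z_1,\dots,z_N]$, and let $\widetilde D_{-1}=\widetilde D_N^{-1}\widetilde D_{N-1}$. The physical space $\widetilde{\mathcal H}$ consists of all $\Psi\in\mathcal H\otimes\mathbb{C}[z_1,\dots,z_N]$ with $(q-e_{k,k+1})\Psi=T_k\Psi$ for $1\le k\le N-1$. Say that an operator $A$ on $\mathcal H$ is obtained by freezing a family $\widetilde O=\widetilde O(p)$ if on $\widetilde{\mathcal H}$ the operator $\widetilde O(1)$ is a multiple of the identity and $\mathrm{ev}\circ\partial_p\widetilde O|_{p=1}=A\circ\mathrm{ev}$. Then $H^{\mathrm R}$ is an abelian symmetry of the $q$-deformed Haldane–Shastry chain: 1. $[H^{\mathrm L},H^{\mathrm R}]=0$. 2. $H^{\mathrm R}$ is the unique operator on $\mathcal H$ obtained by freezing $\frac{1}{q-q^{-1}}\bigl(\widetilde D_{-1}+\frac{[N]}{N}\widetilde D_N\bigr)$. 3. $H^{\mathrm R}$ commutes with every operator on $\mathcal H$ that is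 obtained by freezing $\frac{1}{q-q^{-1}}\bigl(\widetilde D_r-c\,\widetilde D_N\bigr)$ for some $0\le r\le N$ and $c\in\mathbb{C}$. -/

import Mathlib

open MvPolynomial

noncomputable section

namespace QHS

/-! Conventions: sites and coordinates are indexed from `0`, so the site `k : Fin N` is the
`(k+1)`-st site of the chain.  Spin `0` is `↑` and spin `1` is `↓`.  The parameter `q` is the
anisotropy, and `p` is the shift parameter of the difference operators. -/

/-! ### Spin side -/

/-- Spin configurations: they index the coordinate basis of `(ℂ²)^{⊗N}`. -/
abbrev Conf (N : ℕ) : Type := Fin N → Fin 2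

/-- The spin-chain Hilbert space `(ℂ²)^{⊗N}`, in the coordinate basis. -/
abbrev Spin (N : ℕ) : Type := Conf N → ℂ

/-- Operators on `(ℂ²)^{⊗N}`, in the coordinate basis. -/
abbrev SpinOp (N : ℕ) : Type := Matrix (Conf N) (Conf N) ℂ

/-- The `4 × 4` matrix `M`, given in the ordered basis `↑↑, ↑↓, ↓↑, ↓↓`, acting on the neighbouring
sites `k, k+1` (and the identity on all other sites).  Only used for `k + 1 < N`. -/
def nn {N : ℕ} (k : ℕ) (M : Matrix (Fin (2 * 2)) (Fin (2 * 2)) ℂ) : SpinOp N :=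
  if h : k + 1 < N then
    let a : Fin N := ⟨k, by omega⟩
    let b : Fin N := ⟨k + 1, h⟩
    Matrix.of fun s s' =>
      if ∀ m, m ≠ a → m ≠ b → s m = s' m then
        M (finProdFinEquiv (s a, s b)) (finProdFinEquiv (s' a, s' b))
      else 0
  else 1

/-- `f(u) = (u - 1) / (q u - q⁻¹)`. -/
def fR (q u : ℂ) : ℂ := (u - 1) / (q * u - q⁻¹)

/-- `g(u) = (q - q⁻¹) / (q u - q⁻¹)`. -/
def gR (q u : ℂ) : ℂ := (q - q⁻¹) / (q * u - q⁻¹)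

/-- The six-vertex `R`-matrix `Ř(u)`. -/
def Rcheck (q u : ℂ) : Matrix (Fin (2 * 2)) (Fin (2 * 2)) ℂ :=
  !![1, 0, 0, 0;
     0, u * gR q u, fR q u, 0;
     0, fR q u, gR q u, 0;
     0, 0, 0, 1]

/-- The Temperley–Lieb generator `e^sp = -(q - q⁻¹) Ř'(1)`. -/
def eTL (q : ℂ) : Matrix (Fin (2 * 2)) (Fin (2 * 2)) ℂ :=
  !![0, 0, 0, 0;
     0, q⁻¹, -1, 0;
     0, -1, q, 0;
     0, 0, 0, 0]

/-- The spin representation of the Hecke generator, `T^sp = q - e^sp`. -/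
def THecke (q : ℂ) : Matrix (Fin (2 * 2)) (Fin (2 * 2)) ℂ :=
  !![q, 0, 0, 0;
     0, q - q⁻¹, 1, 0;
     0, 1, 0, 0;
     0, 0, 0, q]

/-- The sites strictly between `i` and `j`, in increasing order. -/
def between {N : ℕ} (i j : Fin N) : List (Fin N) :=
  (List.finRange N).filter fun m => i < m ∧ m < j

/-- The long-range spin interaction with the interaction on the left, for `i < j`:
`Ř_{j-1,j}(z_j/z_{j-1}) ⋯ Ř_{i+1,i+2}(z_j/z_{i+1}) e_{i,i+1}
  Ř_{i+1,i+2}(z_{i+1}/z_j) ⋯ Ř_{j-1,j}(z_{j-1}/z_j)`. -/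
def SL {N : ℕ} (q : ℂ) (z : Fin N → ℂ) (i j : Fin N) : SpinOp N :=
  ((between i j).reverse.map fun m : Fin N => nn (m : ℕ) (Rcheck q (z j / z m))).prod
    * nn (i : ℕ) (eTL q)
    * ((between i j).map fun m : Fin N => nn (m : ℕ) (Rcheck q (z m / z j))).prod

/-- The long-range spin interaction with the interaction on the right, for `i < j`:
`Ř_{i,i+1}(z_{i+1}/z_i) ⋯ Ř_{j-2,j-1}(z_{j-1}/z_i) e_{j-1,j}
  Ř_{j-2,j-1}(z_i/z_{j-1}) ⋯ Ř_{i,i+1}(z_i/z_{i+1})`. -/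
def SR {N : ℕ} (q : ℂ) (z : Fin N → ℂ) (i j : Fin N) : SpinOp N :=
  ((between i j).map fun m : Fin N => nn ((m : ℕ) - 1) (Rcheck q (z m / z i))).prod
    * nn ((j : ℕ) - 1) (eTL q)
    * ((between i j).reverse.map fun m : Fin N => nn ((m : ℕ) - 1) (Rcheck q (z i / z m))).prod

/-- The potential `V(x, y) = x y / ((q x - q⁻¹ y) (q y - q⁻¹ x))`. -/
def V (q x y : ℂ) : ℂ := x * y / ((q * x - q⁻¹ * y) * (q * y - q⁻¹ * x))

/-- The `q`-number `[n] = (qⁿ - q⁻ⁿ) / (q - q⁻¹)`. -/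
def qnum (q : ℂ) (n : ℕ) : ℂ := (q ^ n - (q ^ n)⁻¹) / (q - q⁻¹)

/-- `([N]/N) ∑_{i<j} V(z_i, z_j) S^L_{[i,j]}` at the coordinates `z`. -/
def hamLTilde {N : ℕ} (q : ℂ) (z : Fin N → ℂ) : SpinOp N :=
  (qnum q N / N) • ∑ i : Fin N, ∑ j ∈ Finset.Ioi i, V q (z i) (z j) • SL q z i j

/-- `([N]/N) ∑_{i<j} V(z_i, z_j) S^R_{[i,j]}` at the coordinates `z`. -/
def hamRTilde {N : ℕ} (q : ℂ) (z : Fin N → ℂ) : SpinOp N :=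
  (qnum q N / N) • ∑ i : Fin N, ∑ j ∈ Finset.Ioi i, V q (z i) (z j) • SR q z i j

/-- The evaluation point: the coordinate of the `j`-th site, `1 ≤ j ≤ N`, is `exp (2πi j / N)`. -/
def evPt (N : ℕ) (k : Fin N) : ℂ :=
  Complex.exp (2 * Real.pi * Complex.I / N) ^ ((k : ℕ) + 1)

/-- The `q`-deformed Haldane–Shastry Hamiltonian `H^L`. -/
def hamL (q : ℂ) (N : ℕ) : SpinOp N := hamLTilde q (evPt N)

/-- The Hamiltonian `H^R` of opposite chirality. -/
def hamR (q : ℂ) (N : ℕ) : SpinOp N := hamRTilde q (evPt N)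

/-! ### Polynomial side -/

/-- The polynomials `ℂ[z₁, …, z_N]`. -/
abbrev Pol (N : ℕ) : Type := MvPolynomial (Fin N) ℂ

theorem X_sub_X_dvd_sub_swap {N : ℕ} (a b : Fin N) (F : Pol N) :
    (X a - X b : Pol N) ∣ F - rename (Equiv.swap a b) F := by
  induction F using MvPolynomial.induction_on with
  | C c => simp
  | add F G hF hG =>
    have h : F + G - rename (Equiv.swap a b) (F + G)
        = (F - rename (Equiv.swap a b) F) + (G - rename (Equiv.swap a b) G) := by
      rw [map_add]; ring
    rw [h]
    exact dvd_add hF hG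
  | mul_X F k hF =>
    have hX : (X a - X b : Pol N) ∣ X k - X (Equiv.swap a b k) := by
      by_cases hka : k = a
      · subst hka; simp
      · by_cases hkb : k = b
        · subst hkb
          rw [Equiv.swap_apply_right, ← neg_sub (X a : Pol N)]
          exact dvd_neg.mpr dvd_rfl
        · rw [Equiv.swap_apply_of_ne_of_ne hka hkb]; simp
    have h : F * X k - rename (Equiv.swap a b) (F * X k)
        = (F - rename (Equiv.swap a b) F) * X k
          + rename (Equiv.swap a b) F * (X k - X (Equiv.swap a b k)) := by
      rw [map_mul, rename_X]; ring
    rw [h]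
    exact dvd_add (hF.mul_right _) (hX.mul_left _)

theorem X_sub_X_ne_zero {N : ℕ} {a b : Fin N} (h : a ≠ b) : (X a - X b : Pol N) ≠ 0 :=
  sub_ne_zero.mpr fun h' => h (X_injective h')

/-- The divided difference `(z_a - z_b)⁻¹ (1 - s_{ab})`, as an operator on polynomials. -/
def divDiff {N : ℕ} (a b : Fin N) (hab : a ≠ b) : Module.End ℂ (Pol N) where
  toFun F := (X_sub_X_dvd_sub_swap a b F).choose
  map_add' F G := by
    apply mul_left_cancel₀ (X_sub_X_ne_zero hab)
    rw [mul_add, ← (X_sub_X_dvd_sub_swap a b F).choose_spec,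
      ← (X_sub_X_dvd_sub_swap a b G).choose_spec,
      ← (X_sub_X_dvd_sub_swap a b (F + G)).choose_spec, map_add]
    ring
  map_smul' c F := by
    apply mul_left_cancel₀ (X_sub_X_ne_zero hab)
    rw [RingHom.id_apply, mul_smul_comm, ← (X_sub_X_dvd_sub_swap a b F).choose_spec,
      ← (X_sub_X_dvd_sub_swap a b (c • F)).choose_spec, map_smul, smul_sub]

theorem X_sub_X_mul_divDiff {N : ℕ} (a b : Fin N) (hab : a ≠ b) (F : Pol N) :
    (X a - X b) * divDiff a b hab F = F - rename (Equiv.swap a b) F :=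
  (X_sub_X_dvd_sub_swap a b F).choose_spec.symm

/-- The Demazure–Lusztig operator
`T_k = -q⁻¹ (q² z_k - z_{k+1}) (z_k - z_{k+1})⁻¹ (1 - s_k) + q`.  Only used for `k + 1 < N`. -/
def Tpol {N : ℕ} (q : ℂ) (k : ℕ) : Module.End ℂ (Pol N) :=
  if h : k + 1 < N then
    let a : Fin N := ⟨k, by omega⟩
    let b : Fin N := ⟨k + 1, h⟩
    (-q⁻¹) • (LinearMap.mulLeft ℂ (C (q ^ 2) * X a - X b) *
        divDiff a b (by simp [a, b, Fin.ext_iff])) + q • 1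
  else 1

/-- The inverse of `T_k`, namely `T_k⁻¹ = T_k - (q - q⁻¹)` by the Hecke condition. -/
def TpolInv {N : ℕ} (q : ℂ) (k : ℕ) : Module.End ℂ (Pol N) := Tpol q k - (q - q⁻¹) • 1

/-- The twisted cyclic shift `(π F)(z₁, …, z_N) = F(p z_N, z₁, …, z_{N-1})`. -/
def cyc {N : ℕ} (p : ℂ) : Module.End ℂ (Pol N) :=
  (aeval fun i : Fin N =>
    if (i : ℕ) = 0 then (C p * X ⟨N - 1, by have := i.isLt; omega⟩ : Pol N)
    else X ⟨(i : ℕ) - 1, by have := i.isLt; omega⟩).toLinearMap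

/-- The difference (Cherednik–Dunkl) operators
`Y_i = T_i ⋯ T_{N-1} π T_1⁻¹ ⋯ T_{i-1}⁻¹` (indices from `1` in this formula). -/
def Y {N : ℕ} (q p : ℂ) (i : Fin N) : Module.End ℂ (Pol N) :=
  ((List.range' (i : ℕ) (N - 1 - i)).map (Tpol q)).prod * cyc p
    * ((List.range (i : ℕ)).map (TpolInv q)).prod

/-- The elementary symmetric polynomials
`e_r(Y₁, …, Y_N) = ∑_{i₁ < ⋯ < i_r} Y_{i₁} ⋯ Y_{i_r}`. -/
def esymmY {N : ℕ} (q p : ℂ) (r : ℕ) : Module.End ℂ (Pol N) :=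
  ∑ s ∈ Finset.powersetCard r (Finset.univ : Finset (Fin N)),
    ((s.sort (· ≤ ·)).map (Y q p)).prod

/-! ### Vectors with polynomial coefficients, spin-Macdonald operators, freezing -/

/-- `(ℂ²)^{⊗N} ⊗ ℂ[z₁, …, z_N]`, in the coordinate basis of the first factor. -/
abbrev SpinPol (N : ℕ) : Type := Conf N → Pol N

/-- A vector is physical if the Hecke generators act on it through the spins in the same way as
through the polynomials: `T_k^sp Ψ = T_k^pol Ψ` for `k = 1, …, N - 1`. -/
def IsPhysical {N : ℕ} (q : ℂ) (Ψ : SpinPol N) : Prop :=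
  ∀ k : ℕ, k + 1 < N →
    ((nn k (THecke q) : SpinOp N).map C).mulVec Ψ = fun s => Tpol q k (Ψ s)

/-- The spin-Macdonald operator `D̃_r = e_r(Y)`, acting on the polynomial factor. -/
def spinD {N : ℕ} (q p : ℂ) (r : ℕ) : Module.End ℂ (SpinPol N) :=
  (esymmY q p r).compLeft (Conf N)

/-- The spin-Macdonald operator `D̃_{-1} = D̃_N⁻¹ D̃_{N-1}`. -/
def spinDneg {N : ℕ} (q p : ℂ) : Module.End ℂ (SpinPol N) :=
  Ring.inverse (spinD q p N) * spinD q p (N - 1)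

/-- Evaluation of the coordinates at the `N`-th roots of unity. -/
def ev {N : ℕ} (Ψ : SpinPol N) : Spin N := fun s => eval (evPt N) (Ψ s)

/-- `IsFreezing q O A`: the spin operator `A` is obtained by freezing the family of operators
`O p`.  That is, on physical vectors, `O` is a multiple of the identity at the classical point
`p = 1`, and its linearisation `δO` at `p = 1` satisfies `ev ∘ δO = A ∘ ev`. -/
def IsFreezing {N : ℕ} (q : ℂ) (O : ℂ → Module.End ℂ (SpinPol N)) (A : SpinOp N) : Prop :=
  (∃ κ : ℂ, ∀ Ψ : SpinPol N, IsPhysical q Ψ → O 1 Ψ = κ • Ψ) ∧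
  ∀ Ψ : SpinPol N, IsPhysical q Ψ →
    HasDerivAt (fun p : ℂ => ev (O p Ψ)) (A.mulVec (ev Ψ)) 1

end QHS

end

noncomputable section

namespace QHS

/-! ### Demazure–Lusztig operators on functions of the coordinates -/

/-! On a physical vector the polynomial Hecke generators can be traded for spin operators. The
inverses on the right of `Y_i` become factors `q⁻¹ - e_k`, and the value of `e₁(Y) Ψ` at `z` becomes
a sum over `j` of spin operators applied to `Ψ` at the point in which `p z_j` has been moved to the
front (`evV_esymmY_one`, `Zf_eq_Wf`). Physicality, read at a point, is the exchange relation `Exch`: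
interchanging neighbouring coordinates costs one R-matrix.

At `p = 1` the R-matrices cancel and leave the scalar `∑_j A_j` with `A_j = ∏_{m ≠ j} a(z_j, z_m)`,
which does not depend on `z` (`exists_sum_Acoef`). To first order in `p - 1` there are two kinds of
terms. If the argument of `Ψ` is differentiated, the result is the Euler term `A_j z_j ∂_j Ψ`. If
one R-matrix is differentiated, it turns into `(q - q⁻¹) V(z_i, z_j) e_i`, and the R-matrices left
on its two sides dress `e_i` into `S^L_{[i,j]}` (`Exch.hasDerivAt_insAt`). At the `N`-th roots of
unity every `A_j` equals `[N]/N` (`Acoef_of_pow_eq_one`). The Euler terms then add up to `[N]/N`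
times the derivative of `D̃_N = π^N`, which dilates all coordinates by `p`. Subtracting it shows
that `D̃₁` freezes to `H^L` (`isFreezing_hamL`).

The other chirality follows by reflection. Reading functions at the points `z_{N-1-k}⁻¹` turns `T_k`
into `T_{N-2-k}` and `π⁻¹` into `π`, so that `D̃_{-1} = ∑ Y_i⁻¹` takes the shape of `∑ Y_i`, and
`S^L` turns into `S^R` (`isChart_mir`, `toLin'_SR`). Inversion changes the sign of the Euler terms,
which is why `D̃_N` is added to `D̃_{-1}` (`isFreezing_hamR`).

For the commutation, the relations of the extended affine braid group show that the `Y_i` commute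
and have product `π^N` (`commute_affY`, `prod_affY`). With the quadratic Hecke relation they also
show that each `T_k` commutes with the symmetric functions of the `Y_i` (`Tpol_commute_esymmY`). So
the families commute and preserve the physical space. If they are scalars `κ₁`, `κ₂` at `p = 1`, the
quotients `(O₁ - κ₁)/(p - 1)` and `(O₂ - κ₂)/(p - 1)` commute, and after evaluation their products
tend to `A₁ A₂` and `A₂ A₁` (`tendsto_quotient_quotient`).

Both this conclusion and the uniqueness need that evaluation maps the physical space onto the whole
spin space. This is an interpolation argument (`exists_isPhysical_evV_eq`): physical vectors are
built freely from partially symmetric polynomials, one for each number of down spins. -/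

/-- Exchange of the coordinates `k` and `k + 1`. -/
def sw (k : ℕ) (z : ℕ → ℂ) : ℕ → ℂ := fun m => z (Equiv.swap k (k + 1) m)

/-- The coefficient `(q x - q⁻¹ y) / (x - y)`. -/
def aR (q x y : ℂ) : ℂ := (q * x - q⁻¹ * y) / (x - y)

/-- The coordinates of the first `N` sites are distinct and nonzero. -/
def Dist (N : ℕ) (z : ℕ → ℂ) : Prop :=
  (∀ i < N, z i ≠ 0) ∧ ∀ i j, i < N → j < N → z i = z j → i = j

@[simp] theorem sw_left (k : ℕ) (z : ℕ → ℂ) : sw k z k = z (k + 1) := by simp [sw]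

@[simp] theorem sw_right (k : ℕ) (z : ℕ → ℂ) : sw k z (k + 1) = z k := by simp [sw]

theorem sw_of_ne {k m : ℕ} (z : ℕ → ℂ) (h : m ≠ k) (h' : m ≠ k + 1) : sw k z m = z m := by
  simp [sw, Equiv.swap_apply_of_ne_of_ne h h']

@[simp] theorem sw_sw (k : ℕ) (z : ℕ → ℂ) : sw k (sw k z) = z := by
  funext m; simp [sw]

theorem swap_succ_lt {N k m : ℕ} (hk : k + 1 < N) (hm : m < N) :
    Equiv.swap k (k + 1) m < N := by
  rw [Equiv.swap_apply_def]; split_ifs <;> omega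

theorem Dist.sw {N : ℕ} {z : ℕ → ℂ} (h : Dist N z) {k : ℕ} (hk : k + 1 < N) :
    Dist N (sw k z) :=
  ⟨fun _ hi => h.1 _ (swap_succ_lt hk hi), fun _ _ hi hj hij =>
    (Equiv.swap k (k + 1)).injective (h.2 _ _ (swap_succ_lt hk hi) (swap_succ_lt hk hj) hij)⟩

theorem Dist.ne {N : ℕ} {z : ℕ → ℂ} (h : Dist N z) {i j : ℕ} (hi : i < N) (hj : j < N)
    (hij : i ≠ j) : z i - z j ≠ 0 := fun h' => hij (h.2 i j hi hj (sub_eq_zero.mp h'))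

/-- Moves the coordinate `j` to the last of `N` places. -/
def toLast (N j : ℕ) (z : ℕ → ℂ) : ℕ → ℂ := fun k =>
  if k < j then z k else if k + 1 < N then z (k + 1) else if k + 1 = N then z j else z k

theorem Dist.toLast {N : ℕ} {z : ℕ → ℂ} (h : Dist N z) (j : ℕ) :
    Dist N (toLast N j z) := by
  by_cases hj : j < N
  · refine ⟨fun a ha => ?_, fun a b ha hb hab => ?_⟩
    · unfold QHS.toLast
      split_ifs <;> first | omega | exact h.1 _ (by omega)
    · unfold QHS.toLast at hab
      split_ifs at hab <;>
        first
        | omega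
        | (have := h.2 _ _ (by omega) (by omega) hab; omega)
  · have : ∀ a < N, QHS.toLast N j z a = z a := fun a ha => by
      simp [QHS.toLast, show a < j by omega]
    exact ⟨fun a ha => by rw [this a ha]; exact h.1 a ha, fun a b ha hb hab =>
      h.2 a b ha hb (by rwa [this a ha, this b hb] at hab)⟩

theorem toLast_sw_of_lt {N i j : ℕ} (z : ℕ → ℂ) (h : i + 1 < j) :
    toLast N j (sw i z) = sw i (toLast N j z) := by
  funext k
  by_cases h1 : k = i
  · subst h1; rw [sw_left]; simp [toLast, show k < j by omega, h]
  by_cases h2 : k = i + 1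
  · subst h2; rw [sw_right]; simp [toLast, show i < j by omega, h]
  rw [sw_of_ne _ h1 h2]
  unfold toLast
  split_ifs
  · rw [sw_of_ne _ h1 h2]
  · rw [sw_of_ne] <;> omega
  · rw [sw_of_ne] <;> omega
  · rw [sw_of_ne _ h1 h2]

theorem toLast_succ_sw {N i : ℕ} (z : ℕ → ℂ) (hi : i + 1 < N) :
    toLast N (i + 1) (sw i z) = toLast N i z := by
  funext k
  unfold toLast
  rcases lt_trichotomy k i with h | h | h
  · rw [if_pos (by omega), if_pos h, sw_of_ne] <;> omega
  · subst h; simp [hi]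
  · rw [if_neg (show ¬ k < i + 1 by omega), if_neg (show ¬ k < i by omega), sw_right]
    split_ifs
    · rw [sw_of_ne] <;> omega
    · rfl
    · rw [sw_of_ne] <;> omega

theorem toLast_last {N : ℕ} (z : ℕ → ℂ) : toLast (N + 1) N z = z := by
  funext k
  unfold toLast
  split_ifs with h1 h2 h3
  · rfl
  · omega
  · rw [show N = k by omega]
  · rfl

/-! ### Closed form of the partial sums of `e₁(Y)`. -/

section Core

variable {W : Type*} [AddCommGroup W] [Module ℂ W]

/-- The Demazure–Lusztig operator on functions of the coordinates. -/
def Tf (q : ℂ) (k : ℕ) (Φ : (ℕ → ℂ) → W) : (ℕ → ℂ) → W := fun z =>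
  (q - aR q (z k) (z (k + 1))) • Φ z + aR q (z k) (z (k + 1)) • Φ (sw k z)

/-- `T_i T_{i+1} ⋯ T_{i+d-1} Φ`. -/
def Gf (q : ℂ) : ℕ → ℕ → ((ℕ → ℂ) → W) → (ℕ → ℂ) → W
  | 0, _, Φ => Φ
  | d + 1, i, Φ => Tf q i (Gf q d (i + 1) Φ)

/-- `∑_{m = i}^{i+d-1} t_{m-1}⁻¹ ⋯ t_i⁻¹ T_m ⋯ T_{i+d-2} Φ` with `t_k⁻¹ = q⁻¹ - e_k`. -/
def Zf (q : ℂ) (e : ℕ → Module.End ℂ W) : ℕ → ℕ → ((ℕ → ℂ) → W) → (ℕ → ℂ) → W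
  | 0, _, _ => fun _ => 0
  | d + 1, i, Φ => fun z =>
    Gf q d i Φ z + Zf q e d (i + 1) (fun y => q⁻¹ • Φ y - e i (Φ y)) z

/-- `(a(x, z_{i+l-1}) - e_{i+l-1}) ⋯ (a(x, z_i) - e_i)`. -/
def Bop (q : ℂ) (e : ℕ → Module.End ℂ W) (x : ℂ) (z : ℕ → ℂ) : ℕ → ℕ → Module.End ℂ W
  | 0, _ => 1
  | l + 1, i => Bop q e x z l (i + 1) * (aR q x (z i) • 1 - e i)

theorem Bop_congr (q : ℂ) (e : ℕ → Module.End ℂ W) (x : ℂ) {z z' : ℕ → ℂ} (l i : ℕ)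
    (h : ∀ m, i ≤ m → m < i + l → z m = z' m) : Bop q e x z l i = Bop q e x z' l i := by
  induction l generalizing i with
  | zero => rfl
  | succ l ih =>
    rw [Bop, Bop, ih (i + 1) (fun m h1 h2 => h m (by omega) (by omega)),
      h i le_rfl (by omega)]

theorem aR_add (q : ℂ) {x y : ℂ} (h : x - y ≠ 0) : aR q x y + aR q y x = q + q⁻¹ := by
  have h' : y - x ≠ 0 := by rwa [← neg_sub, neg_ne_zero]
  unfold aR
  rw [show (q * y - q⁻¹ * x) / (y - x) = -((q * y - q⁻¹ * x) / (x - y)) by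
    rw [← neg_sub x y, div_neg], ← sub_eq_add_neg, ← sub_div, div_eq_iff h]
  ring

/-- The three-variable identity behind the terms with `j ≥ i + 2` in `Zf_eq_Wf`. -/
theorem aR_mul (q : ℂ) (hq : q ≠ 0) {x y w : ℂ} (h1 : w - x ≠ 0) (h2 : w - y ≠ 0)
    (h3 : x - y ≠ 0) :
    aR q w x * aR q w y = (q - aR q x y + q⁻¹) * aR q w y + aR q x y * aR q w x - 1 := by
  unfold aR
  field_simp
  ring

/-- The coefficientwise form of the partial sums of `e₁(Y)`. -/
def Wf (q : ℂ) (e : ℕ → Module.End ℂ W) (N i : ℕ) (Φ : (ℕ → ℂ) → W) (z : ℕ → ℂ) : W :=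
  ∑ j ∈ Finset.Ico i N, (∏ m ∈ Finset.Ico (j + 1) N, aR q (z j) (z m)) •
    Bop q e (z j) z (j - i) i (Φ (toLast N j z))

/-- Expanding the strings `T_m ⋯` produces many permuted values of `Φ`, but in the sum only the
cyclic moves `toLast` survive. The hypothesis on `Φ` is the relation satisfied by `Ψ ∘ rot` for an
exchange-covariant `Ψ`: on it `T_k` acts through the spin generator of index `k + 1`, because the
shift moves every coordinate by one place. -/
theorem Zf_eq_Wf (q : ℂ) (hq : q ≠ 0) (e : ℕ → Module.End ℂ W) (N : ℕ)
    (he2 : ∀ k, k + 1 < N → e k * e k = (q + q⁻¹) • e k)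
    (hec : ∀ k l, k + 1 < l → l + 1 < N → Commute (e k) (e l)) (d : ℕ) :
    ∀ i, i + d = N → ∀ Φ : (ℕ → ℂ) → W,
      (∀ k, i ≤ k → k + 2 < N → ∀ z, Dist N z → Tf q k Φ z = q • Φ z - e (k + 1) (Φ z)) →
      ∀ z, Dist N z → Zf q e d i Φ z = Wf q e N i Φ z := by
  induction d using Nat.strong_induction_on with
  | _ d ih =>
  match d with
  | 0 =>
    intro i hi Φ _ z _
    simp [Zf, Wf, ← hi]
  | 1 =>
    intro i hi Φ _ z _
    subst hi
    simp [Zf, Wf, Gf, Bop, toLast_last]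
  | d + 2 =>
    intro i hi Φ hΦ z hz
    have hcom : ∀ k, i + 1 ≤ k → k + 2 < N → ∀ w : W, e (k + 1) (e i w) = e i (e (k + 1) w) := by
      intro k h1 h2 w
      exact (LinearMap.congr_fun (hec i (k + 1) (by omega) (by omega)) w).symm
    have hcom' : ∀ k, i + 2 ≤ k → k + 2 < N → ∀ w : W,
        e (k + 1) (e (i + 1) w) = e (i + 1) (e (k + 1) w) := by
      intro k h1 h2 w
      exact (LinearMap.congr_fun (hec (i + 1) (k + 1) (by omega) (by omega)) w).symm
    -- The factor `q⁻¹ - e_l` preserves the hypothesis on `Φ` whenever `e_l` commutes with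
    -- `e_{k+1}`, so the induction hypothesis also covers the functions that occur inside `Zf`.
    have tauT : ∀ l, ∀ k, (∀ w : W, e (k + 1) (e l w) = e l (e (k + 1) w)) →
        (∀ z, Dist N z → Tf q k Φ z = q • Φ z - e (k + 1) (Φ z)) →
        ∀ z, Dist N z → Tf q k (fun y => q⁻¹ • Φ y - e l (Φ y)) z
          = q • (q⁻¹ • Φ z - e l (Φ z)) - e (k + 1) (q⁻¹ • Φ z - e l (Φ z)) := by
      intro l k hc h z hz
      have h1 := h z hz
      have h2 := congrArg (e l) h1
      simp only [Tf, map_add, map_smul, map_sub] at h1 h2 ⊢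
      rw [hc]
      linear_combination (norm := module) q⁻¹ • h1 - h2
    -- the induction hypotheses
    have I1 := fun z hz => ih (d + 1) (by omega) (i + 1) (by omega) Φ
      (fun k h1 h2 => hΦ k (by omega) h2) z hz
    have I2 := ih (d + 1) (by omega) (i + 1) (by omega) (fun y => q⁻¹ • Φ y - e i (Φ y))
      (fun k h1 h2 => tauT i k (hcom k h1 h2) (hΦ k (by omega) h2)) z hz
    have I3 := fun z hz => ih d (by omega) (i + 2) (by omega)
      (fun y => q⁻¹ • Φ y - e (i + 1) (Φ y))
      (fun k h1 h2 => tauT (i + 1) k (hcom' k h1 h2) (hΦ k (by omega) h2)) z hz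
    -- A single string is the difference of two partial sums, of lengths `d + 1` and `d`, and both
    -- are known. This is why the induction reaches back two steps.
    have hG : ∀ z, Dist N z → Gf q d (i + 1) Φ z = Wf q e N (i + 1) Φ z
        - Wf q e N (i + 2) (fun y => q⁻¹ • Φ y - e (i + 1) (Φ y)) z := by
      intro z hz
      rw [← I1 z hz, ← I3 z hz, Zf, add_sub_cancel_right]
    have hiN : i + 1 < N := by omega
    have hz' : Dist N (sw i z) := hz.sw hiN
    change Tf q i (Gf q d (i + 1) Φ) z
      + Zf q e (d + 1) (i + 1) (fun y => q⁻¹ • Φ y - e i (Φ y)) z = _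
    rw [I2, Tf, hG z hz, hG _ hz']
    have hS1 : Finset.Ico i N = insert i (Finset.Ico (i + 1) N) := by
      ext; simp; omega
    have hS2 : Finset.Ico (i + 1) N = insert (i + 1) (Finset.Ico (i + 2) N) := by
      ext; simp; omega
    unfold Wf
    rw [hS1, Finset.sum_insert (by simp), hS2, Finset.sum_insert (by simp),
      Finset.sum_insert (by simp), Finset.sum_insert (by simp), Finset.sum_insert (by simp)]
    set b := aR q (z i) (z (i + 1)) with hb
    have hbb : aR q (z (i + 1)) (z i) = q + q⁻¹ - b := by
      rw [hb, ← aR_add q (hz.ne (i := i) (j := i + 1) (by omega) (by omega) (by omega))]; ring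
    -- the terms far from `i`
    have hfar : ∀ j ∈ Finset.Ico (i + 2) N,
        (∏ m ∈ Finset.Ico (j + 1) N, aR q (z j) (z m)) •
          Bop q e (z j) z (j - i) i (Φ (toLast N j z)) =
        (q - b) • ((∏ m ∈ Finset.Ico (j + 1) N, aR q (z j) (z m)) •
            Bop q e (z j) z (j - (i + 1)) (i + 1) (Φ (toLast N j z))
          - (∏ m ∈ Finset.Ico (j + 1) N, aR q (z j) (z m)) •
            Bop q e (z j) z (j - (i + 2)) (i + 2) (q⁻¹ • Φ (toLast N j z)
              - e (i + 1) (Φ (toLast N j z))))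
        + b • ((∏ m ∈ Finset.Ico (j + 1) N, aR q (sw i z j) (sw i z m)) •
            Bop q e (sw i z j) (sw i z) (j - (i + 1)) (i + 1) (Φ (toLast N j (sw i z)))
          - (∏ m ∈ Finset.Ico (j + 1) N, aR q (sw i z j) (sw i z m)) •
            Bop q e (sw i z j) (sw i z) (j - (i + 2)) (i + 2) (q⁻¹ • Φ (toLast N j (sw i z))
              - e (i + 1) (Φ (toLast N j (sw i z)))))
        + (∏ m ∈ Finset.Ico (j + 1) N, aR q (z j) (z m)) •
          Bop q e (z j) z (j - (i + 1)) (i + 1) (q⁻¹ • Φ (toLast N j z)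
            - e i (Φ (toLast N j z))) := by
      intro j hj
      rw [Finset.mem_Ico] at hj
      have hP : ∏ m ∈ Finset.Ico (j + 1) N, aR q (sw i z j) (sw i z m)
          = ∏ m ∈ Finset.Ico (j + 1) N, aR q (z j) (z m) := by
        refine Finset.prod_congr rfl fun m hm => ?_
        rw [Finset.mem_Ico] at hm
        rw [sw_of_ne, sw_of_ne] <;> omega
      have hsj : sw i z j = z j := by rw [sw_of_ne] <;> omega
      obtain ⟨l, rfl⟩ : ∃ l, j = i + 2 + l := ⟨j - (i + 2), by omega⟩
      set j := i + 2 + l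
      rw [hP, hsj, show j - i = l + 2 by omega, show j - (i + 1) = l + 1 by omega,
        show j - (i + 2) = l by omega]
      rw [Bop, Bop, Bop, sw_right,
        Bop_congr q e (z j) (z := sw i z) (z' := z) l (i + 2)
          (fun m h1 h2 => by rw [sw_of_ne] <;> omega),
        toLast_sw_of_lt z (by omega)]
      -- Since `j ≥ i + 2`, the coordinates `z_i` and `z_{i+1}` keep their places when `z_j` is
      -- moved to the end. The coefficient at the moved point is therefore again `b`, and the
      -- relation eliminates the swapped value `φ'`.
      have h0 := hΦ i le_rfl (by omega) (toLast N j z) (hz.toLast j)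
      have e1 : toLast N j z i = z i := by simp [toLast, show i < j by omega]
      have e2 : toLast N j z (i + 1) = z (i + 1) := by simp [toLast, show i + 1 < j by omega]
      rw [Tf, e1, e2, ← hb] at h0
      set X := Bop q e (z j) z l (i + 2)
      set P := ∏ m ∈ Finset.Ico (j + 1) N, aR q (z j) (z m)
      set φ := Φ (toLast N j z)
      set φ' := Φ (sw i (toLast N j z))
      have hv := LinearMap.congr_fun (he2 (i + 1) (by omega)) φ
      simp only [Module.End.mul_apply, LinearMap.smul_apply] at hv
      have hb1 : b • φ' = b • φ - e (i + 1) φ := by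
        linear_combination (norm := module) h0
      have hb2 : b • e (i + 1) φ' = b • e (i + 1) φ - (q + q⁻¹) • e (i + 1) φ := by
        rw [← map_smul, hb1, map_sub, map_smul, hv]
      have ha := aR_mul q hq (hz.ne (i := j) (j := i) (by omega) (by omega) (by omega))
        (hz.ne (i := j) (j := i + 1) (by omega) (by omega) (by omega))
        (hz.ne (i := i) (j := i + 1) (by omega) (by omega) (by omega))
      rw [← hb] at ha
      set ai := aR q (z j) (z i)
      set ai' := aR q (z j) (z (i + 1))
      have hin : ai' • (ai • φ - e i φ) - e (i + 1) (ai • φ - e i φ)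
          = (q - b) • ((ai' • φ - e (i + 1) φ) - (q⁻¹ • φ - e (i + 1) φ))
            + ((ai • (b • φ') - b • e (i + 1) φ') - (q⁻¹ • (b • φ') - b • e (i + 1) φ'))
            + (ai' • (q⁻¹ • φ - e i φ) - e (i + 1) (q⁻¹ • φ - e i φ)) := by
        rw [hb2, hb1]
        simp only [map_sub, map_smul, smul_sub]
        have hq' : q * q⁻¹ = 1 := mul_inv_cancel₀ hq
        linear_combination (norm := module) (ha + hq') • φ
      have := congrArg (fun w => P • X w) hin
      simp only [map_add, map_sub, map_smul, Module.End.mul_apply, LinearMap.sub_apply,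
        LinearMap.smul_apply, Module.End.one_apply, smul_add, smul_sub] at this ⊢
      linear_combination (norm := module) this
    rw [Finset.sum_congr rfl hfar]
    -- The summand `j = i + 1` at the swapped point supplies the summand `j = i` of the result. What
    -- remains for `j = i + 1` are the scalars `q - b` and `q⁻¹ - e_i`, which add up to `a(z_{i+1},
    -- z_i) - e_i`.
    have hs1 : ∏ m ∈ Finset.Ico (i + 1 + 1) N, aR q (sw i z (i + 1)) (sw i z m)
        = ∏ m ∈ Finset.Ico (i + 1 + 1) N, aR q (z i) (z m) := by
      refine Finset.prod_congr rfl fun m hm => ?_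
      rw [Finset.mem_Ico] at hm
      rw [sw_right, sw_of_ne] <;> omega
    have hs2 : ∏ m ∈ insert (i + 1) (Finset.Ico (i + 2) N), aR q (z i) (z m)
        = b * ∏ m ∈ Finset.Ico (i + 1 + 1) N, aR q (z i) (z m) := by
      rw [Finset.prod_insert (by simp)]
    rw [hs1, hs2, toLast_succ_sw z hiN, show i - i = 0 by omega,
      show i + 1 - i = 1 by omega, show i + 1 - (i + 1) = 0 by omega]
    simp only [Bop, one_mul, hbb, Module.End.one_apply, Finset.sum_add_distrib,
      Finset.sum_sub_distrib, ← Finset.smul_sum, LinearMap.sub_apply, LinearMap.smul_apply,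
      smul_sub, smul_add]
    module

end Core

/-- The twisted cyclic shift of the first `N` coordinates. -/
def rot (N : ℕ) (p : ℂ) (z : ℕ → ℂ) : ℕ → ℂ := fun k =>
  if k = 0 then p * z (N - 1) else if k < N then z (k - 1) else z k

/-- Moves the coordinate `j` down to the place `i ≤ j` and multiplies it by `p`. -/
def insAt (p : ℂ) (j i : ℕ) (z : ℕ → ℂ) : ℕ → ℂ := fun k =>
  if k < i then z k else if k = i then p * z j else if k ≤ j then z (k - 1) else z k

/-- This is where `p` enters the closed form: summand `j` of `Wf` for `Ψ ∘ rot` sees the coordinates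
with `p z_j` in front and the others in their original order. -/
theorem rot_toLast {N j : ℕ} (hj : j < N) (p : ℂ) (z : ℕ → ℂ) :
    rot N p (toLast N j z) = insAt p j 0 z := by
  funext k
  unfold rot insAt toLast
  rcases Nat.eq_zero_or_pos k with rfl | hk
  · by_cases h : N - 1 < j
    · omega
    · simp [h, show N - 1 + 1 = N by omega]
  · simp only [show k ≠ 0 by omega, if_false, show ¬ k < 0 by omega]
    split_ifs <;> first | rfl | omega | (congr 1; omega)

theorem sw_insAt {i j : ℕ} (hij : i < j) (p : ℂ) (z : ℕ → ℂ) :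
    sw i (insAt p j (i + 1) z) = insAt p j i z := by
  funext k
  by_cases h1 : k = i
  · subst h1; rw [sw_left]; simp [insAt]
  by_cases h2 : k = i + 1
  · subst h2; rw [sw_right]; simp [insAt, hij]
  rw [sw_of_ne _ h1 h2]
  unfold insAt
  split_ifs <;> first | rfl | omega

theorem insAt_one (j : ℕ) (z : ℕ → ℂ) : insAt 1 j j z = z := by
  funext k
  unfold insAt
  split_ifs with h1 h2 h3
  · rfl
  · rw [h2, one_mul]
  · omega
  · rfl

theorem insAt_ne_zero {N j i : ℕ} {p : ℂ} {z : ℕ → ℂ} (hp : p ≠ 0) (hz : ∀ k < N, z k ≠ 0)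
    (hj : j < N) : ∀ k < N, insAt p j i z k ≠ 0 := by
  intro k hk
  unfold insAt
  split_ifs
  · exact hz k hk
  · exact mul_ne_zero hp (hz j hj)
  · exact hz _ (by omega)
  · exact hz k hk

theorem rot_ne_zero {N : ℕ} {p : ℂ} {z : ℕ → ℂ} (hp : p ≠ 0) (hz : ∀ k < N, z k ≠ 0) :
    ∀ k < N, rot N p z k ≠ 0 := by
  intro k hk
  unfold rot
  split_ifs
  · exact mul_ne_zero hp (hz _ (by omega))
  · exact hz _ (by omega)

theorem rot_sw {N k : ℕ} (hk : k + 2 < N) (p : ℂ) (z : ℕ → ℂ) :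
    rot N p (sw k z) = sw (k + 1) (rot N p z) := by
  funext m
  by_cases h1 : m = k + 1
  · subst h1; rw [sw_left]; simp [rot, show k + 1 < N by omega, hk]
  by_cases h2 : m = k + 2
  · subst h2; rw [sw_right]; simp [rot, hk, show k + 1 < N by omega]
  rw [sw_of_ne _ h1 h2]
  unfold rot
  split_ifs
  · rw [sw_of_ne] <;> omega
  · rw [sw_of_ne] <;> omega
  · rw [sw_of_ne] <;> omega

/-! ### Exchange relations, and their consequences at `p = 1`. -/

section Exchange

variable {W : Type*} [AddCommGroup W] [Module ℂ W]

/-- `Ψ` satisfies the exchange relations `Ψ(s_k z) = Ř_k(z_k / z_{k+1}) Ψ(z)`, written without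
denominators. -/
def Exch (q : ℂ) (e : ℕ → Module.End ℂ W) (N : ℕ) (Ψ : (ℕ → ℂ) → W) : Prop :=
  ∀ z : ℕ → ℂ, (∀ k < N, z k ≠ 0) → ∀ k, k + 1 < N →
    (q * z k - q⁻¹ * z (k + 1)) • Ψ (sw k z)
      = (q * z k - q⁻¹ * z (k + 1)) • Ψ z - (z k - z (k + 1)) • e k (Ψ z)

theorem Exch.Tf_rot {q : ℂ} {e : ℕ → Module.End ℂ W} {N : ℕ} {Ψ : (ℕ → ℂ) → W}
    (h : Exch q e N Ψ) {p : ℂ} (hp : p ≠ 0) {k : ℕ} (hk : k + 2 < N) {z : ℕ → ℂ}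
    (hz : Dist N z) :
    Tf q k (fun y => Ψ (rot N p y)) z
      = q • Ψ (rot N p z) - e (k + 1) (Ψ (rot N p z)) := by
  have h1 := h (rot N p z) (rot_ne_zero hp hz.1) (k + 1) hk
  have e1 : rot N p z (k + 1) = z k := by simp [rot, show k + 1 < N by omega]
  have e2 : rot N p z (k + 1 + 1) = z (k + 1) := by simp [rot, hk]
  rw [e1, e2, ← rot_sw hk] at h1
  have h2 := congrArg (fun w => (z k - z (k + 1))⁻¹ • w) h1
  have hne := hz.ne (i := k) (j := k + 1) (by omega) (by omega) (by omega)
  simp only [smul_sub, smul_smul, inv_mul_cancel₀ hne, one_smul] at h2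
  rw [show (z k - z (k + 1))⁻¹ * (q * z k - q⁻¹ * z (k + 1)) = aR q (z k) (z (k + 1)) by
    rw [aR, div_eq_inv_mul]] at h2
  rw [Tf]
  linear_combination (norm := module) h2

/-- `∏_{m ≠ j} a(z_j, z_m)`. -/
def Acoef (q : ℂ) (N : ℕ) (z : ℕ → ℂ) (j : ℕ) : ℂ :=
  ∏ m ∈ (Finset.range N).erase j, aR q (z j) (z m)

theorem Acoef_eq (q : ℂ) {N j : ℕ} (hj : j < N) (z : ℕ → ℂ) :
    Acoef q N z j = (∏ m ∈ Finset.Ico (j + 1) N, aR q (z j) (z m)) *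
      ∏ m ∈ Finset.Ico 0 j, aR q (z j) (z m) := by
  rw [Acoef, ← Finset.prod_union]
  · refine Finset.prod_congr ?_ fun _ _ => rfl
    ext m; simp; omega
  · rw [Finset.disjoint_left]; intro m; simp; omega

/-- Each factor `a(z_j, z_m) - e_m` of `Bop` is, by the exchange relation, `a(z_j, z_m)` times the
move of `z_j` past `z_m`. The string carries `z_j` back to its own place and only the scalars
remain. -/
theorem Exch.Bop_insAt_one {q : ℂ} {e : ℕ → Module.End ℂ W} {N : ℕ} {Ψ : (ℕ → ℂ) → W}
    (h : Exch q e N Ψ) {z : ℕ → ℂ} (hz : Dist N z) {j : ℕ} (hj : j < N) (l : ℕ) :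
    ∀ i, i + l = j → Bop q e (z j) z l i (Ψ (insAt 1 j i z))
      = (∏ m ∈ Finset.Ico i j, aR q (z j) (z m)) • Ψ z := by
  induction l with
  | zero => rintro i rfl; simp [Bop, insAt_one]
  | succ l ih =>
    intro i hi
    have h1 := h (insAt 1 j i z) (insAt_ne_zero one_ne_zero hz.1 hj) i (by omega)
    have e1 : insAt 1 j i z i = z j := by simp [insAt]
    have e2 : insAt 1 j i z (i + 1) = z i := by simp [insAt, show i + 1 ≤ j by omega]
    rw [e1, e2, ← sw_insAt (by omega : i < j), sw_sw] at h1
    have h2 := congrArg (fun w => (z j - z i)⁻¹ • w) h1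
    have hne := hz.ne (i := j) (j := i) (by omega) (by omega) (by omega)
    simp only [smul_sub, smul_smul, inv_mul_cancel₀ hne, one_smul] at h2
    rw [show (z j - z i)⁻¹ * (q * z j - q⁻¹ * z i) = aR q (z j) (z i) by
      rw [aR, div_eq_inv_mul], sw_insAt (by omega : i < j)] at h2
    rw [Bop, Module.End.mul_apply, LinearMap.sub_apply, LinearMap.smul_apply,
      Module.End.one_apply, ← h2, map_smul, ih (i + 1) (by omega), smul_smul,
      Finset.prod_eq_prod_Ico_succ_bot (by omega : i < j)]

theorem Exch.Wf_rot_one {q : ℂ} {e : ℕ → Module.End ℂ W} {N : ℕ} {Ψ : (ℕ → ℂ) → W}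
    (h : Exch q e N Ψ) {z : ℕ → ℂ} (hz : Dist N z) :
    Wf q e N 0 (fun y => Ψ (rot N 1 y)) z
      = (∑ j ∈ Finset.range N, Acoef q N z j) • Ψ z := by
  rw [Wf, Finset.sum_smul, Finset.range_eq_Ico]
  refine Finset.sum_congr rfl fun j hj => ?_
  have hj' : j < N := (Finset.mem_Ico.mp hj).2
  rw [Nat.sub_zero, rot_toLast hj', h.Bop_insAt_one hz hj' j 0 (by omega), smul_smul,
    Acoef_eq q hj']

theorem Gf_const_one (q : ℂ) (c : ℂ) (d : ℕ) : ∀ (i : ℕ),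
    Gf q d i (fun _ => c) = fun _ => q ^ d * c := by
  induction d with
  | zero => intro i; simp [Gf]
  | succ d ih =>
    intro i
    rw [Gf, ih]
    funext z
    simp only [Tf, smul_eq_mul]
    ring

theorem Zf_const (q : ℂ) (d : ℕ) : ∀ i c, ∃ κ : ℂ, ∀ z,
    Zf q (0 : ℕ → Module.End ℂ ℂ) d i (fun _ => c) z = κ := by
  induction d with
  | zero => intro i c; exact ⟨0, fun z => rfl⟩
  | succ d ih =>
    intro i c
    obtain ⟨κ, hκ⟩ := ih (i + 1) (q⁻¹ * c)
    refine ⟨q ^ d * c + κ, fun z => ?_⟩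
    rw [← hκ z]
    simp [Zf, Gf_const_one]

/-- The constant function `1` with `e = 0` satisfies the exchange relations, so the sum is the value
of `e₁(Y)` on `1`. Every `T_k` multiplies constants by `q`, hence this value cannot depend on `z`.
-/
theorem exists_sum_Acoef (q : ℂ) (hq : q ≠ 0) (N : ℕ) :
    ∃ κ : ℂ, ∀ z, Dist N z → ∑ j ∈ Finset.range N, Acoef q N z j = κ := by
  obtain ⟨κ, hκ⟩ := Zf_const q N 0 1
  refine ⟨κ, fun z hz => ?_⟩
  have hE : Exch q (0 : ℕ → Module.End ℂ ℂ) N (fun _ => (1 : ℂ)) := by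
    intro z _ k _; simp
  have h1 := hE.Wf_rot_one hz
  rw [← Zf_eq_Wf q hq (0 : ℕ → Module.End ℂ ℂ) N (by simp) (fun _ _ _ _ => by simp) N 0
    (by simp) _ (fun k _ hk z hz => hE.Tf_rot one_ne_zero hk hz) z hz, hκ z] at h1
  simpa using h1.symm

/-- The `R`-matrix `Ř_k(u) = 1 - f(u) e_k`. -/
def Rop (q : ℂ) (e : ℕ → Module.End ℂ W) (u : ℂ) (k : ℕ) : Module.End ℂ W :=
  1 - fR q u • e k

/-- `Ř_{k+l-1}(x / z_{k+l-1}) ⋯ Ř_k(x / z_k)`. -/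
def Bc (q : ℂ) (e : ℕ → Module.End ℂ W) (x : ℂ) (z : ℕ → ℂ) : ℕ → ℕ → Module.End ℂ W
  | 0, _ => 1
  | l + 1, k => Bc q e x z l (k + 1) * Rop q e (x / z k) k

/-- `Ř_k(z_k / x) ⋯ Ř_{k+l-1}(z_{k+l-1} / x)`. -/
def Cc (q : ℂ) (e : ℕ → Module.End ℂ W) (x : ℂ) (z : ℕ → ℂ) : ℕ → ℕ → Module.End ℂ W
  | 0, _ => 1
  | l + 1, k => Rop q e (z k / x) k * Cc q e x z l (k + 1)

/-- The long-range interaction `S^L_{[i,j]}` built from the operators `e_k`. -/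
def SLop (q : ℂ) (e : ℕ → Module.End ℂ W) (z : ℕ → ℂ) (i j : ℕ) : Module.End ℂ W :=
  Bc q e (z j) z (j - i - 1) (i + 1) * e i * Cc q e (z j) z (j - i - 1) (i + 1)

theorem fR_div {q x y : ℂ} (hy : y ≠ 0) : fR q (x / y) = (x - y) / (q * x - q⁻¹ * y) := by
  rw [fR, show x / y - 1 = (x - y) / y by field_simp,
    show q * (x / y) - q⁻¹ = (q * x - q⁻¹ * y) / y by field_simp, div_div_div_cancel_right₀ hy]

/-- The coordinates avoid the poles of the `R`-matrices. -/
def NoPole (q : ℂ) (N : ℕ) (z : ℕ → ℂ) : Prop :=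
  ∀ i j, i < N → j < N → i ≠ j → q * z i - q⁻¹ * z j ≠ 0

/-- Because `f(x / y) = 1 / a(x, y)`, each factor of `Bop` is a multiple of an R-matrix. -/
theorem Bop_eq_Bc {q : ℂ} {e : ℕ → Module.End ℂ W} {N : ℕ} {z : ℕ → ℂ} (hz : Dist N z)
    (hP : NoPole q N z) {j : ℕ} (hj : j < N) (l : ℕ) :
    ∀ i, i + l = j → Bop q e (z j) z l i
      = (∏ m ∈ Finset.Ico i j, aR q (z j) (z m)) • Bc q e (z j) z l i := by
  induction l with
  | zero => rintro i rfl; simp [Bop, Bc]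
  | succ l ih =>
    intro i hi
    have hne := hz.ne (i := j) (j := i) (by omega) (by omega) (by omega)
    have hp := hP j i hj (by omega) (by omega)
    have : aR q (z j) (z i) • (1 : Module.End ℂ W) - e i
        = aR q (z j) (z i) • Rop q e (z j / z i) i := by
      rw [Rop, fR_div (hz.1 i (by omega)), smul_sub, smul_smul, aR,
        div_mul_div_cancel₀ hne, div_self hp, one_smul]
    rw [Bop, Bc, ih (i + 1) (by omega), this, smul_mul_smul_comm, mul_comm,
      Finset.prod_eq_prod_Ico_succ_bot (by omega : i < j)]

theorem Exch.insAt_one_eq {q : ℂ} {e : ℕ → Module.End ℂ W} {N : ℕ} {Ψ : (ℕ → ℂ) → W}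
    (h : Exch q e N Ψ) {p : ℂ} (hp : p ≠ 0) {z : ℕ → ℂ} (hz : ∀ k < N, z k ≠ 0)
    {i j : ℕ} (hij : i < j) (hj : j < N) (hP : q * z i - q⁻¹ * (p * z j) ≠ 0) :
    Ψ (insAt p j i z) = Ψ (insAt p j (i + 1) z) -
      ((z i - p * z j) / (q * z i - q⁻¹ * (p * z j))) • e i (Ψ (insAt p j (i + 1) z)) := by
  have h1 := h (insAt p j (i + 1) z) (insAt_ne_zero hp hz hj) i (by omega)
  have e1 : insAt p j (i + 1) z i = z i := by simp [insAt]
  have e2 : insAt p j (i + 1) z (i + 1) = p * z j := by simp [insAt]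
  rw [e1, e2, sw_insAt hij] at h1
  have h2 := congrArg (fun w => (q * z i - q⁻¹ * (p * z j))⁻¹ • w) h1
  simp only [smul_sub, smul_smul, inv_mul_cancel₀ hP, one_smul] at h2
  rw [h2, div_eq_inv_mul]

theorem Exch.insAt_eq_Cc {q : ℂ} {e : ℕ → Module.End ℂ W} {N : ℕ} {Ψ : (ℕ → ℂ) → W}
    (h : Exch q e N Ψ) {z : ℕ → ℂ} (hz : ∀ k < N, z k ≠ 0) (hP : NoPole q N z)
    {j : ℕ} (hj : j < N) (l : ℕ) :
    ∀ i, i + l = j → Ψ (insAt 1 j i z) = Cc q e (z j) z l i (Ψ z) := by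
  induction l with
  | zero => rintro i rfl; simp [Cc, insAt_one]
  | succ l ih =>
    intro i hi
    rw [h.insAt_one_eq one_ne_zero hz (by omega) hj
      (by rw [one_mul]; exact hP i j (by omega) hj (by omega)), ih (i + 1) (by omega), Cc, Rop,
      fR_div (hz j hj)]
    simp

end Exchange

/-! ### The first-order term at `p = 1`, where the long-range interactions appear. -/

section Derivative

variable {W : Type*} [NormedAddCommGroup W] [NormedSpace ℂ W] [FiniteDimensional ℂ W]

theorem hasDerivAt_exchange_coeff {q x y : ℂ} (h : q * x - q⁻¹ * y ≠ 0) :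
    HasDerivAt (fun p : ℂ => (x - p * y) / (q * x - q⁻¹ * (p * y)))
      (-((q - q⁻¹) * (x * y) / (q * x - q⁻¹ * y) ^ 2)) 1 := by
  have h1 : HasDerivAt (fun p : ℂ => x - p * y) (-(1 * y)) 1 :=
    ((hasDerivAt_id (1 : ℂ)).mul_const y).const_sub x
  have h2 : HasDerivAt (fun p : ℂ => q * x - q⁻¹ * (p * y)) (-(q⁻¹ * (1 * y))) 1 :=
    (((hasDerivAt_id (1 : ℂ)).mul_const y).const_mul q⁻¹).const_sub (q * x)
  have h3 := h1.div h2 (by simpa using h)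
  rw [show -((q - q⁻¹) * (x * y) / (q * x - q⁻¹ * y) ^ 2)
      = (-(1 * y) * (q * x - q⁻¹ * (1 * y)) - (x - 1 * y) * -(q⁻¹ * (1 * y)))
        / (q * x - q⁻¹ * (1 * y)) ^ 2 by
    rw [← neg_div, one_mul]; congr 1; ring]
  exact h3

/-- The product rule for moving `p z_j` from place `j` down to place `i`, one R-matrix at a time.
`Bop` then undoes the R-matrices that are not differentiated, up to scalars. Where step `m` is
differentiated it leaves `e_m`, with the string `Cc` of earlier moves on its right and the undoing
string `Bc` on its left, which is `SLop` for the pair `m, j`. -/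
theorem Exch.hasDerivAt_insAt {q : ℂ} {e : ℕ → Module.End ℂ W} {N : ℕ} {Ψ : (ℕ → ℂ) → W}
    (h : Exch q e N Ψ) (he2 : ∀ k, k + 1 < N → e k * e k = (q + q⁻¹) • e k)
    {z : ℕ → ℂ} (hz : Dist N z) (hP : NoPole q N z)
    {j : ℕ} (hj : j < N) {D : W} (hD : HasDerivAt (fun p : ℂ => Ψ (insAt p j j z)) D 1) (l : ℕ) :
    ∀ i, i + l = j → ∃ v, HasDerivAt (fun p : ℂ => Ψ (insAt p j i z)) v 1 ∧
      Bop q e (z j) z l i v = (∏ m ∈ Finset.Ico i j, aR q (z j) (z m)) •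
        (D + (q - q⁻¹) • ∑ m ∈ Finset.Ico i j, V q (z m) (z j) • SLop q e z m j (Ψ z)) := by
  induction l with
  | zero => rintro i rfl; exact ⟨D, hD, by simp [Bop]⟩
  | succ l ih =>
    intro i hi
    obtain ⟨v, hv, hB⟩ := ih (i + 1) (by omega)
    have hp := hP i j (by omega) hj (by omega)
    have hp' := hP j i hj (by omega) (by omega)
    have hne := hz.ne (i := j) (j := i) (by omega) (by omega) (by omega)
    have hne' := hz.ne (i := i) (j := j) (by omega) (by omega) (by omega)
    have hc := hasDerivAt_exchange_coeff hp
    have hev : HasDerivAt (fun p : ℂ => e i (Ψ (insAt p j (i + 1) z))) (e i v) 1 :=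
      (LinearMap.toContinuousLinearMap (e i)).hasFDerivAt.comp_hasDerivAt (1 : ℂ) hv
    have h1 := hv.sub (hc.smul hev)
    have hloc : ∀ᶠ p : ℂ in nhds 1, Ψ (insAt p j i z) = Ψ (insAt p j (i + 1) z) -
        ((z i - p * z j) / (q * z i - q⁻¹ * (p * z j))) • e i (Ψ (insAt p j (i + 1) z)) := by
      have c1 : ∀ᶠ p : ℂ in nhds 1, p ≠ 0 := isOpen_ne.mem_nhds one_ne_zero
      have c2 : ∀ᶠ p : ℂ in nhds 1, q * z i - q⁻¹ * (p * z j) ≠ 0 := by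
        refine ContinuousAt.eventually_ne (by fun_prop) ?_
        rwa [one_mul]
      filter_upwards [c1, c2] with p hp1 hp2
      exact h.insAt_one_eq hp1 hz.1 (by omega) hj hp2
    have h2 := h1.congr_of_eventuallyEq hloc
    refine ⟨_, h2, ?_⟩
    have hC := h.insAt_eq_Cc hz.1 hP hj l (i + 1) (by omega)
    simp only [one_mul]
    rw [hC]
    set w := Cc q e (z j) z l (i + 1) (Ψ z) with hw
    have hee : ∀ x, e i (e i x) = (q + q⁻¹) • e i x := fun x =>
      LinearMap.congr_fun (he2 i (by omega)) x
    have hS : SLop q e z i j (Ψ z) = Bc q e (z j) z l (i + 1) (e i w) := by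
      rw [SLop, show j - i - 1 = l by omega]; rfl
    -- Unitarity of the R-matrix: `f(z_i / z_j)` is the inverse of `a(z_i, z_j) = q + q⁻¹ - a(z_j,
    -- z_i)`. With the quadratic relation for `e_i` this gives `(a - e_i)(1 - f e_i) = a`, where `a
    -- = a(z_j, z_i)`.
    have hfa : (z i - z j) / (q * z i - q⁻¹ * z j) * (q + q⁻¹ - aR q (z j) (z i)) = 1 := by
      rw [← aR_add q hne, add_sub_cancel_left, aR, div_mul_div_cancel₀ hp, div_self hne']
    -- The derivative of the coefficient of `e_i`, multiplied by the eigenvalue of `a - e_i` on the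
    -- image of `e_i`. The potential `V` originates here.
    have hVa : (q - q⁻¹) * (z i * z j) / (q * z i - q⁻¹ * z j) ^ 2
        * (aR q (z j) (z i) - (q + q⁻¹)) = (q - q⁻¹) * (aR q (z j) (z i) * V q (z i) (z j)) := by
      rw [← aR_add q hne, sub_add_cancel_left, aR, aR, V,
        show z i - z j = -(z j - z i) by ring]
      generalize q * z i - q⁻¹ * z j = A at *
      generalize q * z j - q⁻¹ * z i = B at *
      generalize q⁻¹ = r
      field_simp
    have hin : aR q (z j) (z i) • (v - (((z i - z j) / (q * z i - q⁻¹ * z j)) • e i v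
          + -((q - q⁻¹) * (z i * z j) / (q * z i - q⁻¹ * z j) ^ 2) • e i w))
        - e i (v - (((z i - z j) / (q * z i - q⁻¹ * z j)) • e i v
          + -((q - q⁻¹) * (z i * z j) / (q * z i - q⁻¹ * z j) ^ 2) • e i w))
        = aR q (z j) (z i) • v
          + ((q - q⁻¹) * (aR q (z j) (z i) * V q (z i) (z j))) • e i w := by
      simp only [map_sub, map_add, map_smul, hee]
      linear_combination (norm := module) hfa • e i v + hVa • e i w
    rw [Bop, Module.End.mul_apply, LinearMap.sub_apply, LinearMap.smul_apply,
      Module.End.one_apply, hin, map_add, map_smul, map_smul, hB, Bop_eq_Bc hz hP hj l (i + 1)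
      (by omega), LinearMap.smul_apply, ← hS,
      Finset.prod_eq_prod_Ico_succ_bot (by omega : i < j),
      Finset.sum_eq_sum_Ico_succ_bot (by omega : i < j)]
    module

/-- The derivative at `p = 1` of the image of `Ψ` under `e₁(Y)`. -/
theorem Exch.hasDerivAt_Zf {q : ℂ} (hq : q ≠ 0) {e : ℕ → Module.End ℂ W} {N : ℕ}
    {Ψ : (ℕ → ℂ) → W} (h : Exch q e N Ψ)
    (he2 : ∀ k, k + 1 < N → e k * e k = (q + q⁻¹) • e k)
    (hec : ∀ k l, k + 1 < l → l + 1 < N → Commute (e k) (e l))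
    {z : ℕ → ℂ} (hz : Dist N z) (hP : NoPole q N z) {D : ℕ → W}
    (hD : ∀ j < N, HasDerivAt (fun p : ℂ => Ψ (insAt p j j z)) (D j) 1) :
    HasDerivAt (fun p : ℂ => Zf q e N 0 (fun y => Ψ (rot N p y)) z)
      (∑ j ∈ Finset.range N, Acoef q N z j •
        (D j + (q - q⁻¹) • ∑ i ∈ Finset.range j, V q (z i) (z j) • SLop q e z i j (Ψ z))) 1 := by
  have hloc : ∀ᶠ p : ℂ in nhds 1, Zf q e N 0 (fun y => Ψ (rot N p y)) z
      = ∑ j ∈ Finset.range N, (∏ m ∈ Finset.Ico (j + 1) N, aR q (z j) (z m)) •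
        Bop q e (z j) z j 0 (Ψ (insAt p j 0 z)) := by
    filter_upwards [isOpen_ne.mem_nhds (one_ne_zero (α := ℂ))] with p hp
    rw [Zf_eq_Wf q hq e N he2 hec N 0 (by simp) _ (fun k _ hk z hz => h.Tf_rot hp hk hz) z hz,
      Wf, Finset.range_eq_Ico]
    refine Finset.sum_congr rfl fun j hj => ?_
    rw [rot_toLast (Finset.mem_Ico.mp hj).2, Nat.sub_zero]
  refine HasDerivAt.congr_of_eventuallyEq ?_ hloc
  refine HasDerivAt.fun_sum fun j hj => ?_
  rw [Finset.mem_range] at hj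
  obtain ⟨v, hv, hB⟩ := h.hasDerivAt_insAt he2 hz hP hj (hD j hj) j 0 (by simp)
  have h1 : HasDerivAt (fun p : ℂ => Bop q e (z j) z j 0 (Ψ (insAt p j 0 z)))
      (Bop q e (z j) z j 0 v) 1 :=
    (LinearMap.toContinuousLinearMap (Bop q e (z j) z j 0)).hasFDerivAt.comp_hasDerivAt (1 : ℂ) hv
  have h2 := h1.const_smul (∏ m ∈ Finset.Ico (j + 1) N, aR q (z j) (z m))
  rw [hB, smul_smul, ← Acoef_eq q hj, ← Finset.range_eq_Ico] at h2
  exact h2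

end Derivative

/-! ### The commuting elements of the extended affine braid group -/

section Braid

variable {G : Type*} [Group G]

/-- The relations of the extended affine braid group on `n + 1` strands. -/
structure AffBraid (n : ℕ) (T : ℕ → G) (c : G) : Prop where
  braid : ∀ k, k + 1 < n → T k * T (k + 1) * T k = T (k + 1) * T k * T (k + 1)
  comm : ∀ k l, k + 1 < l → l < n → Commute (T k) (T l)
  shift : ∀ k, k + 1 < n → c * T (k + 1) = T k * c
  shift_two : 0 < n → c * c * T 0 = T (n - 1) * (c * c)

/-- `T_i ⋯ T_{i+l-1}`. -/
def ascT (T : ℕ → G) (i l : ℕ) : G := ((List.range' i l).map T).prod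

/-- `T_{i+l-1} ⋯ T_i`. -/
def descT (T : ℕ → G) (i : ℕ) : ℕ → G
  | 0 => 1
  | l + 1 => T (i + l) * descT T i l

/-- The element `T_i ⋯ T_{n-1} c T_0⁻¹ ⋯ T_{i-1}⁻¹`. -/
def affY (n : ℕ) (T : ℕ → G) (c : G) (i : ℕ) : G :=
  ascT T i (n - i) * c * ((List.range i).map fun k => (T k)⁻¹).prod

theorem ascT_succ (T : ℕ → G) (i l : ℕ) : ascT T i (l + 1) = T i * ascT T (i + 1) l := by
  simp [ascT, List.range'_succ]

theorem ascT_succ' (T : ℕ → G) (i l : ℕ) : ascT T i (l + 1) = ascT T i l * T (i + l) := by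
  simp [ascT, List.range'_concat]

theorem descT_succ' (T : ℕ → G) (i l : ℕ) : descT T i (l + 1) = descT T (i + 1) l * T i := by
  induction l generalizing i with
  | zero => simp [descT]
  | succ l ih => rw [descT, ih, descT, mul_assoc, show i + (l + 1) = i + 1 + l by omega]

theorem prod_inv_eq_descT (T : ℕ → G) (m : ℕ) :
    ((List.range m).map fun k => (T k)⁻¹).prod = (descT T 0 m)⁻¹ := by
  induction m with
  | zero => simp [descT]
  | succ m ih => simp [List.range_succ, ih, descT]

variable {n : ℕ} {T : ℕ → G} {c : G}

theorem affY_eq {i : ℕ} (hi : i < n) :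
    affY n T c i = T i * affY n T c (i + 1) * T i := by
  rw [affY, affY, show n - i = n - (i + 1) + 1 by omega, ascT_succ, List.range_succ]
  simp [mul_assoc]

theorem affY_succ {i : ℕ} (hi : i < n) :
    affY n T c (i + 1) = (T i)⁻¹ * affY n T c i * (T i)⁻¹ := by
  rw [affY_eq hi]; group

namespace AffBraid

theorem comm_ascT (h : AffBraid n T c) {k i l : ℕ} (hi : k + 1 < i) (hl : i + l ≤ n) :
    Commute (T k) (ascT T i l) := by
  induction l with
  | zero => simp [ascT]
  | succ l ih =>
    rw [ascT_succ']
    exact (ih (by omega)).mul_right (h.comm _ _ (by omega) (by omega))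

/-- Moving a generator across an ascending string raises its index by one; the braid relation acts
where the string contains `T_k T_{k+1}`, and the other letters commute. -/
theorem ascT_mul (h : AffBraid n T c) {l : ℕ} : ∀ {k i : ℕ}, i ≤ k → k + 1 < i + l → i + l ≤ n →
    ascT T i l * T k = T (k + 1) * ascT T i l := by
  induction l with
  | zero => intros; omega
  | succ l ih =>
    intro k i h1 h2 h3
    rw [ascT_succ]
    rcases Nat.eq_or_lt_of_le h1 with rfl | h1
    · obtain ⟨l, rfl⟩ : ∃ l', l = l' + 1 := ⟨l - 1, by omega⟩
      rw [ascT_succ, mul_assoc, mul_assoc, ← (h.comm_ascT (by omega) (by omega)).eq,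
        ← mul_assoc, ← mul_assoc, h.braid i (by omega)]
      simp only [mul_assoc]
    · rw [mul_assoc, ih h1 (by omega) (by omega), ← mul_assoc, ← mul_assoc,
        (h.comm i (k + 1) (by omega) (by omega)).eq]

theorem comm_affY_zero (h : AffBraid n T c) {k : ℕ} (hk : k + 1 < n) :
    Commute (T (k + 1)) (affY n T c 0) := by
  have := h.ascT_mul (l := n) (k := k) (i := 0) (by omega) (by omega) (by omega)
  simp only [affY, Nat.sub_zero, List.range_zero, List.map_nil, List.prod_nil, mul_one]
  rw [Commute, SemiconjBy, mul_assoc, h.shift k hk, ← mul_assoc, ← mul_assoc, this]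

/-- Induction through `Y_{i+1} = T_i⁻¹ Y_i T_i⁻¹`. The one case that is not immediate is `T_k`
against `Y_{k+2}`: by the braid relation `T_k` passes the outer factors as `T_{k+1}`, commutes with
`Y_k`, and returns to `T_k` on the other side. -/
theorem comm_affY (h : AffBraid n T c) (i : ℕ) : i ≤ n → ∀ k, k < n → k ≠ i → k + 1 ≠ i →
    Commute (T k) (affY n T c i) := by
  induction i using Nat.strong_induction_on with
  | _ i ih =>
  match i with
  | 0 =>
    intro _ k hk h1 _
    obtain ⟨k, rfl⟩ : ∃ l, k = l + 1 := ⟨k - 1, by omega⟩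
    exact h.comm_affY_zero hk
  | i + 1 =>
    intro hi k hk h1 h2
    rw [affY_succ (by omega)]
    rcases lt_or_ge i k with h3 | h3
    · have c1 : Commute (T k) (T i) := (h.comm i k (by omega) hk).symm
      exact (c1.inv_right.mul_right (ih i (by omega) (by omega) k hk (by omega) (by omega))).mul_right
        c1.inv_right
    rcases Nat.lt_or_ge (k + 1) i with h4 | h4
    · have c1 : Commute (T k) (T i) := h.comm k i (by omega) (by omega)
      exact (c1.inv_right.mul_right (ih i (by omega) (by omega) k hk (by omega) (by omega))).mul_right
        c1.inv_right
    · obtain rfl : i = k + 1 := by omega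
      rw [affY_succ (by omega)]
      have c1 := ih k (by omega) (by omega) (k + 1) (by omega) (by omega) (by omega)
      have hb := h.braid k (by omega)
      have b1 : T k * (T (k + 1))⁻¹ * (T k)⁻¹ = (T (k + 1))⁻¹ * (T k)⁻¹ * T (k + 1) := by
        rw [mul_inv_eq_iff_eq_mul, mul_inv_eq_iff_eq_mul]
        simp only [mul_assoc] at hb ⊢
        rw [eq_inv_mul_iff_mul_eq, eq_inv_mul_iff_mul_eq, hb]
      have b2 : T (k + 1) * (T k)⁻¹ * (T (k + 1))⁻¹ = (T k)⁻¹ * (T (k + 1))⁻¹ * T k := by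
        rw [mul_inv_eq_iff_eq_mul, mul_inv_eq_iff_eq_mul]
        simp only [mul_assoc] at hb ⊢
        rw [eq_inv_mul_iff_mul_eq, eq_inv_mul_iff_mul_eq, hb]
      rw [Commute, SemiconjBy]
      calc T k * ((T (k + 1))⁻¹ * ((T k)⁻¹ * affY n T c k * (T k)⁻¹) * (T (k + 1))⁻¹)
          = (T k * (T (k + 1))⁻¹ * (T k)⁻¹) * affY n T c k * (T k)⁻¹ * (T (k + 1))⁻¹ := by group
        _ = (T (k + 1))⁻¹ * (T k)⁻¹ * (T (k + 1) * affY n T c k) * (T k)⁻¹ * (T (k + 1))⁻¹ := by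
          rw [b1]; group
        _ = (T (k + 1))⁻¹ * (T k)⁻¹ * affY n T c k *
            (T (k + 1) * (T k)⁻¹ * (T (k + 1))⁻¹) := by rw [c1.eq]; group
        _ = _ := by rw [b2]; group

/-- Here `Y_0 = T_0 u` and `Y_1 = u T_0⁻¹` with `u = T_1 ⋯ T_{n-1} c`, so the claim is that `T_0`
commutes with `u²`. Collecting the shifts gives `u² = (T_1 ⋯ T_{n-1})(T_0 ⋯ T_{n-2}) c²`, and `c²`
is where `shift_two` enters. -/
theorem commute_affY_zero_one (h : AffBraid n T c) (hn : 0 < n) :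
    Commute (affY n T c 0) (affY n T c 1) := by
  obtain ⟨n, rfl⟩ : ∃ m, n = m + 1 := ⟨n - 1, by omega⟩
  have e1 : affY (n + 1) T c 1 = ascT T 1 n * c * (T 0)⁻¹ := by simp [affY, List.range_succ]
  have e0 : affY (n + 1) T c 0 = T 0 * (ascT T 1 n * c) := by
    simp [affY, ascT_succ, mul_assoc]
  set u := ascT T 1 n * c with hu
  have hsh : ∀ l, l ≤ n → c * ascT T 1 l = ascT T 0 l * c := by
    intro l hl
    induction l with
    | zero => simp [ascT]
    | succ l ih =>
      rw [ascT_succ', ascT_succ', ← mul_assoc, ih (by omega), mul_assoc, add_comm 1 l,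
        h.shift l (by omega), zero_add, mul_assoc]
  have huu : u * u = ascT T 1 n * ascT T 0 n * (c * c) := by
    rw [hu, show ascT T 1 n * c * (ascT T 1 n * c) = ascT T 1 n * (c * ascT T 1 n) * c by
      group, hsh n le_rfl]
    group
  have hA : ∀ l, l ≤ n →
      ascT T 0 (n + 1) * ascT T 0 l = ascT T 1 l * ascT T 0 (n + 1) := by
    intro l hl
    induction l with
    | zero => simp [ascT]
    | succ l ih =>
      rw [ascT_succ' T 0 l, ascT_succ' T 1 l, ← mul_assoc, ih (by omega), zero_add, mul_assoc,
        mul_assoc, h.ascT_mul (by omega) (by omega) (by omega), add_comm 1 l]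
  have hcom : T 0 * (u * u) = u * u * T 0 := by
    have h2 := h.shift_two (by omega)
    rw [Nat.add_sub_cancel] at h2
    rw [huu, mul_assoc (ascT T 1 n * ascT T 0 n), h2, ← mul_assoc (T 0), ← mul_assoc (T 0),
      show T 0 * ascT T 1 n = ascT T 0 (n + 1) from (ascT_succ T 0 n).symm,
      hA n le_rfl, ascT_succ']
    simp only [zero_add, mul_assoc]
  rw [e0, e1, Commute, SemiconjBy]
  calc T 0 * u * (u * (T 0)⁻¹) = T 0 * (u * u) * (T 0)⁻¹ := by group
    _ = u * u := by rw [hcom]; group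
    _ = _ := by group

theorem commute_affY_lt (h : AffBraid n T c) (i : ℕ) : ∀ j, i < j → j ≤ n →
    Commute (affY n T c i) (affY n T c j) := by
  induction i with
  | zero =>
    intro j hj
    induction j, hj using Nat.le_induction with
    | base => intro hn; exact h.commute_affY_zero_one (by omega)
    | succ j hj ih =>
      intro hn
      rw [affY_succ (by omega)]
      have c1 := (h.comm_affY 0 (by omega) j (by omega) (by omega) (by omega)).symm.inv_right
      exact (c1.mul_right (ih (by omega))).mul_right c1
  | succ i ih =>
    intro j hj hn
    rw [affY_succ (by omega)]
    have c1 := (h.comm_affY j hn i (by omega) (by omega) (by omega)).inv_left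
    exact (c1.mul_left (ih j (by omega) hn)).mul_left c1

theorem commute_affY (h : AffBraid n T c) {i j : ℕ} (hi : i ≤ n) (hj : j ≤ n) :
    Commute (affY n T c i) (affY n T c j) := by
  rcases lt_trichotomy i j with h1 | rfl | h1
  · exact h.commute_affY_lt i j h1 hj
  · exact Commute.refl _
  · exact (h.commute_affY_lt j i h1 hi).symm

/-! ### The product of all the `Y_i`. -/

theorem pow_mul_shift (h : AffBraid n T c) (m : ℕ) : ∀ k, k + m < n →
    c ^ m * T (k + m) = T k * c ^ m := by
  induction m with
  | zero => intro k _; simp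
  | succ m ih =>
    intro k hk
    rw [pow_succ, mul_assoc, ← add_assoc, h.shift (k + m) (by omega), ← mul_assoc,
      ih k (by omega), mul_assoc]

/-- The first `k` shifts lower `T_k` to `T_0`, the next two wrap it around to `T_{n-1}` by
`shift_two`, and the remaining `m - 1 - k` lower it again. -/
theorem pow_mul_wrap (h : AffBraid n T c) {m k : ℕ} (hk : k < m) (hm : m ≤ n) :
    c ^ (m + 1) * T k = T (n - m + k) * c ^ (m + 1) := by
  have h1 := h.pow_mul_shift k 0 (by omega)
  rw [zero_add] at h1
  have h2 : c ^ (k + 2) * T k = T (n - 1) * c ^ (k + 2) := by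
    rw [add_comm, pow_add, mul_assoc, h1, ← mul_assoc, sq, h.shift_two (by omega), mul_assoc]
  have h3 := h.pow_mul_shift (m - 1 - k) (n - m + k) (by omega)
  rw [show n - m + k + (m - 1 - k) = n - 1 by omega] at h3
  rw [show m + 1 = (m - 1 - k) + (k + 2) by omega, pow_add, mul_assoc, h2, ← mul_assoc, h3,
    mul_assoc]

theorem pow_mul_ascT (h : AffBraid n T c) (m l : ℕ) (hl : m + l ≤ n) :
    c ^ m * ascT T m l = ascT T 0 l * c ^ m := by
  induction l with
  | zero => simp [ascT]
  | succ l ih =>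
    rw [ascT_succ', ascT_succ', ← mul_assoc, ih (by omega), mul_assoc, add_comm m l,
      h.pow_mul_shift m l (by omega), zero_add, mul_assoc]

theorem pow_mul_descT (h : AffBraid n T c) {m l : ℕ} (hl : l ≤ m) (hm : m ≤ n) :
    c ^ (m + 1) * descT T 0 l = descT T (n - m) l * c ^ (m + 1) := by
  induction l with
  | zero => simp [descT]
  | succ l ih =>
    rw [descT, descT, ← mul_assoc, zero_add, h.pow_mul_wrap (by omega) hm, mul_assoc,
      ih (by omega), mul_assoc]

theorem comm_descT (h : AffBraid n T c) {k i l : ℕ} (hk : i + l < k) (hn : k < n) :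
    Commute (T k) (descT T i l) := by
  induction l with
  | zero => simp [descT]
  | succ l ih =>
    rw [descT]
    exact (h.comm _ _ (by omega) hn).symm.mul_right (ih (by omega))

theorem descT_mul (h : AffBraid n T c) {l : ℕ} : ∀ {k r : ℕ}, r ≤ k → k < r + l → r + l < n →
    descT T r (l + 1) * T (k + 1) = T k * descT T r (l + 1) := by
  induction l with
  | zero => intros; omega
  | succ l ih =>
    intro k r h1 h2 h3
    rw [descT]
    rcases Nat.lt_or_ge k (r + l) with h4 | h4
    · rw [mul_assoc, ih h1 h4 (by omega), ← mul_assoc, ← mul_assoc,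
        (h.comm k (r + (l + 1)) (by omega) (by omega)).eq]
    · obtain rfl : k = r + l := by omega
      rw [descT, mul_assoc, mul_assoc, ← (h.comm_descT (by omega) (by omega)).eq, ← mul_assoc,
        ← mul_assoc, show r + (l + 1) = r + l + 1 by omega, ← h.braid (r + l) (by omega)]
      simp only [mul_assoc]

theorem descT_mul_descT (h : AffBraid n T c) {s m l : ℕ} (hl : l ≤ m) (hm : s + m < n) :
    descT T s (m + 1) * descT T (s + 1) l = descT T s l * descT T s (m + 1) := by
  induction l with
  | zero => simp [descT]
  | succ l ih =>
    rw [descT.eq_2 T (s + 1), descT.eq_2 T s l, ← mul_assoc, show s + 1 + l = s + l + 1 by omega,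
      h.descT_mul (by omega) (by omega) hm, mul_assoc, ih (by omega), mul_assoc]

theorem prod_descT_mul (h : AffBraid n T c) {m : ℕ} (s : ℕ) (hs : s + m ≤ n) :
    ((List.range s).map fun r => descT T r (m + 1)).prod * descT T s m
      = descT T 0 m * ((List.range s).map fun r => descT T r (m + 1)).prod := by
  induction s with
  | zero => simp
  | succ s ih =>
    simp only [List.range_succ, List.map_append, List.map_cons, List.map_nil, List.prod_append,
      List.prod_cons, List.prod_nil, mul_one]
    rw [mul_assoc, h.descT_mul_descT le_rfl (by omega), ← mul_assoc, ih (by omega), mul_assoc]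

theorem prod_descT_mul_ascT (h : AffBraid n T c) {m : ℕ} (s : ℕ) (hs : s + m ≤ n) :
    ((List.range s).map fun r => descT T (r + 1) m).prod * ascT T 0 s
      = ((List.range s).map fun r => descT T r (m + 1)).prod := by
  induction s with
  | zero => simp [ascT]
  | succ s ih =>
    have hc : ∀ l, l ≤ m → Commute (descT T (s + 1) l) (ascT T 0 s) := by
      intro l hl
      induction l with
      | zero => simp [descT]
      | succ l ihl =>
        rw [descT]
        refine Commute.mul_left ?_ (ihl (by omega))
        have : ∀ t, t ≤ s → Commute (T (s + 1 + l)) (ascT T 0 t) := by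
          intro t ht
          induction t with
          | zero => simp [ascT]
          | succ t iht =>
            rw [ascT_succ']
            exact (iht (by omega)).mul_right (h.comm _ _ (by omega) (by omega)).symm
        exact this s le_rfl
    simp only [List.range_succ, List.map_append, List.map_cons, List.map_nil, List.prod_append,
      List.prod_cons, List.prod_nil, mul_one]
    rw [ascT_succ', ← ih (by omega), descT_succ', mul_assoc, ← mul_assoc (descT T (s + 1) m),
      (hc m le_rfl).eq]
    simp only [zero_add, mul_assoc]

/-- The invariant for multiplying the `Y_i` one by one: with each new factor the descending strings
get longer by one letter and fewer by one. At `m = n + 1` no string is left and only the power of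
`c` remains. -/
theorem prod_affY_range (h : AffBraid n T c) (m : ℕ) (hm : m ≤ n + 1) :
    ((List.range m).map (affY n T c)).prod
      = ((List.range (n + 1 - m)).map fun r => descT T r m).prod * c ^ m := by
  induction m with
  | zero => simp [descT, List.map_const']
  | succ m ih =>
    have hmn : m ≤ n := by omega
    rw [List.range_succ, List.map_append, List.prod_append, ih (by omega)]
    simp only [List.map_cons, List.map_nil, List.prod_cons, List.prod_nil, mul_one]
    have h1 : c ^ m * affY n T c m
        = ascT T 0 (n - m) * (descT T (n - m) m)⁻¹ * c ^ (m + 1) := by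
      have h2 := h.pow_mul_descT (m := m) le_rfl hmn
      rw [affY, prod_inv_eq_descT, ← mul_assoc, ← mul_assoc, h.pow_mul_ascT m (n - m) (by omega),
        mul_assoc (ascT T 0 (n - m)) _ c, ← pow_succ, mul_inv_eq_iff_eq_mul]
      rw [mul_assoc, h2]
      group
    rw [mul_assoc, h1, ← mul_assoc, ← mul_assoc, show n + 1 - m = n - m + 1 by omega,
      List.range_succ_eq_map]
    simp only [List.map_cons, List.map_map, List.prod_cons, Function.comp_def,
      Nat.succ_eq_add_one]
    rw [mul_assoc (descT T 0 m), h.prod_descT_mul_ascT (n - m) (by omega),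
      ← h.prod_descT_mul (n - m) (by omega), mul_inv_cancel_right,
      show n + 1 - (m + 1) = n - m by omega]

theorem prod_affY (h : AffBraid n T c) :
    ((List.range (n + 1)).map (affY n T c)).prod = c ^ (n + 1) := by
  rw [h.prod_affY_range (n + 1) le_rfl]; simp

end AffBraid

end Braid

/-! ### The affine Hecke relations for the operators on polynomials -/

/-- Evaluation of a polynomial at the first `N` coordinates of `z`. -/
def evN {N : ℕ} (z : ℕ → ℂ) (F : Pol N) : ℂ := eval (fun i : Fin N => z i) F

section evN

variable {N : ℕ} (z : ℕ → ℂ)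

@[simp] theorem evN_add (F G : Pol N) : evN z (F + G) = evN z F + evN z G := map_add _ _ _
@[simp] theorem evN_sub (F G : Pol N) : evN z (F - G) = evN z F - evN z G := map_sub _ _ _
@[simp] theorem evN_mul (F G : Pol N) : evN z (F * G) = evN z F * evN z G := map_mul _ _ _
@[simp] theorem evN_smul (c : ℂ) (F : Pol N) : evN z (c • F) = c * evN z F := smul_eval _ _ _
@[simp] theorem evN_zero : evN z (0 : Pol N) = 0 := map_zero _
@[simp] theorem evN_C (c : ℂ) : evN z (C c : Pol N) = c := eval_C _
@[simp] theorem evN_X (i : Fin N) : evN z (X i : Pol N) = z i := eval_X _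
@[simp] theorem evN_sum {ι : Type*} (s : Finset ι) (F : ι → Pol N) :
    evN z (∑ i ∈ s, F i) = ∑ i ∈ s, evN z (F i) := map_sum _ _ _

theorem evN_congr {z z' : ℕ → ℂ} (h : ∀ k < N, z k = z' k) (F : Pol N) : evN z F = evN z' F := by
  unfold evN
  congr 2
  funext i
  exact h i i.isLt

end evN

/-- The difference times all coordinates and all their differences vanishes everywhere, and the
polynomial ring is a domain. Operator identities can thus be checked where the denominators of the
Demazure–Lusztig operators do not vanish. -/
theorem ext_of_evN {N : ℕ} {F G : Pol N} (h : ∀ z, Dist N z → evN z F = evN z G) : F = G := by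
  set D : Pol N := (∏ i, X i) * ∏ i : Fin N, ∏ j ∈ Finset.univ.erase i, (X i - X j) with hD
  have hD0 : D ≠ 0 := by
    refine mul_ne_zero (Finset.prod_ne_zero_iff.mpr fun i _ => X_ne_zero i)
      (Finset.prod_ne_zero_iff.mpr fun i _ => Finset.prod_ne_zero_iff.mpr fun j hj => ?_)
    exact X_sub_X_ne_zero (Finset.ne_of_mem_erase hj).symm
  refine sub_eq_zero.mp ((mul_eq_zero.mp ?_).resolve_left hD0)
  refine MvPolynomial.funext fun x => ?_
  rw [map_zero, map_mul, mul_eq_zero]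
  by_cases hx : (∀ i, x i ≠ 0) ∧ Function.Injective x
  · right
    have := h (fun k => if hk : k < N then x ⟨k, hk⟩ else 0)
      ⟨fun i hi => by simpa [hi] using hx.1 _, fun i j hi hj hij => by
        simp only [hi, hj, dif_pos] at hij
        simpa using hx.2 hij⟩
    rw [map_sub, sub_eq_zero]
    simpa [evN] using this
  · left
    rw [hD, map_mul, map_prod, map_prod, mul_eq_zero]
    by_cases h0 : ∀ i, x i ≠ 0
    · right
      have h1 : ¬ Function.Injective x := fun h1 => hx ⟨h0, h1⟩
      simp only [Function.Injective, not_forall] at h1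
      obtain ⟨i, j, hij, hne⟩ := h1
      refine Finset.prod_eq_zero (Finset.mem_univ i) ?_
      rw [map_prod]
      refine Finset.prod_eq_zero (Finset.mem_erase.mpr ⟨Ne.symm hne, Finset.mem_univ j⟩) ?_
      simp [hij]
    · left
      push Not at h0
      obtain ⟨i, hi⟩ := h0
      exact Finset.prod_eq_zero (Finset.mem_univ i) (by simpa using hi)

theorem end_ext {N : ℕ} {A B : Module.End ℂ (Pol N)}
    (h : ∀ F z, Dist N z → evN z (A F) = evN z (B F)) : A = B :=
  LinearMap.ext fun F => ext_of_evN (h F)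

theorem evN_rename_swap {N k : ℕ} (hk : k + 1 < N) (z : ℕ → ℂ) (F : Pol N) :
    evN z (rename (Equiv.swap (⟨k, by omega⟩ : Fin N) ⟨k + 1, hk⟩) F) = evN (sw k z) F := by
  rw [evN, eval_rename, evN]
  congr 2
  funext i
  rw [Function.comp_apply]
  by_cases h1 : i = ⟨k, by omega⟩
  · subst h1; simp
  by_cases h2 : i = ⟨k + 1, hk⟩
  · subst h2; simp
  · rw [Equiv.swap_apply_of_ne_of_ne h1 h2,
      sw_of_ne _ (fun h => h1 (Fin.ext h)) (fun h => h2 (Fin.ext h))]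

/-- Kept free of denominators because the exchange relations are also needed at points with
coinciding coordinates, such as may arise when one coordinate is multiplied by `p`. -/
theorem evN_Tpol_mul {N k : ℕ} (hk : k + 1 < N) (q : ℂ) (hq : q ≠ 0) (z : ℕ → ℂ) (F : Pol N) :
    (z k - z (k + 1)) * evN z (Tpol q k F) = q * (z k - z (k + 1)) * evN z F
      - (q * z k - q⁻¹ * z (k + 1)) * (evN z F - evN (sw k z) F) := by
  have h1 := congrArg (evN z) (X_sub_X_mul_divDiff (⟨k, by omega⟩ : Fin N) ⟨k + 1, hk⟩
    (by simp [Fin.ext_iff]) F)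
  simp only [evN_mul, evN_sub, evN_X, evN_rename_swap hk] at h1
  rw [Tpol, dif_pos hk]
  simp only [LinearMap.add_apply, LinearMap.smul_apply, Module.End.mul_apply,
    LinearMap.mulLeft_apply, Module.End.one_apply, evN_add, evN_smul, evN_mul, evN_sub, evN_C,
    evN_X]
  have hqq : q⁻¹ * q ^ 2 = q := by field_simp
  linear_combination (-q⁻¹ * (q ^ 2 * z k - z (k + 1))) * h1
    - (z k * (evN z F - evN (sw k z) F)) * hqq

theorem evN_Tpol {N k : ℕ} (hk : k + 1 < N) (q : ℂ) (hq : q ≠ 0) {z : ℕ → ℂ}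
    (hz : z k - z (k + 1) ≠ 0) (F : Pol N) :
    evN z (Tpol q k F) = (q - aR q (z k) (z (k + 1))) * evN z F
      + aR q (z k) (z (k + 1)) * evN (sw k z) F := by
  have h := evN_Tpol_mul hk q hq z F
  rw [← mul_right_inj' hz, h]
  have : (z k - z (k + 1)) * aR q (z k) (z (k + 1)) = q * z k - q⁻¹ * z (k + 1) := by
    rw [aR, mul_div_cancel₀ _ hz]
  linear_combination (evN z F - evN (sw k z) F) * this

theorem Tpol_mul_self {N k : ℕ} (hk : k + 1 < N) {q : ℂ} (hq : q ≠ 0) :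
    (Tpol q k * Tpol q k : Module.End ℂ (Pol N)) = (q - q⁻¹) • Tpol q k + 1 := by
  refine end_ext fun F z hz => ?_
  have hne := hz.ne (i := k) (j := k + 1) (by omega) hk (by omega)
  have hne' : sw k z k - sw k z (k + 1) ≠ 0 := by
    rw [sw_left, sw_right, ← neg_sub, neg_ne_zero]; exact hne
  simp only [Module.End.mul_apply, LinearMap.add_apply, LinearMap.smul_apply,
    Module.End.one_apply, evN_add, evN_smul]
  rw [evN_Tpol hk q hq hne, evN_Tpol hk q hq hne', evN_Tpol hk q hq hne, sw_sw, sw_left, sw_right]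
  have ha := aR_add q hne
  have hqq : q * q⁻¹ = 1 := mul_inv_cancel₀ hq
  set a := aR q (z k) (z (k + 1))
  have hb : aR q (z (k + 1)) (z k) = q + q⁻¹ - a := by rw [← ha]; ring
  rw [hb]
  linear_combination evN z F * hqq

theorem Tpol_mul_TpolInv {N k : ℕ} (hk : k + 1 < N) {q : ℂ} (hq : q ≠ 0) :
    (Tpol q k * TpolInv q k : Module.End ℂ (Pol N)) = 1 := by
  rw [TpolInv, mul_sub, Tpol_mul_self hk hq, mul_smul_comm, mul_one, add_sub_cancel_left]

theorem TpolInv_mul_Tpol {N k : ℕ} (hk : k + 1 < N) {q : ℂ} (hq : q ≠ 0) :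
    (TpolInv q k * Tpol q k : Module.End ℂ (Pol N)) = 1 := by
  rw [TpolInv, sub_mul, Tpol_mul_self hk hq, smul_mul_assoc, one_mul, add_sub_cancel_left]

theorem sw_comm {k l : ℕ} (h : k + 1 < l) (z : ℕ → ℂ) : sw k (sw l z) = sw l (sw k z) := by
  funext m
  have h1 : Commute (Equiv.swap k (k + 1)) (Equiv.swap l (l + 1)) := by
    apply Equiv.Perm.Disjoint.commute
    intro m
    by_cases hm : m = k ∨ m = k + 1
    · right; rw [Equiv.swap_apply_of_ne_of_ne] <;> omega
    · left; rw [Equiv.swap_apply_of_ne_of_ne] <;> omega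
  have := congrArg (fun σ : Equiv.Perm ℕ => z (σ m)) h1.eq
  simpa [sw] using this.symm

theorem Tpol_comm {N k l : ℕ} (h : k + 1 < l) (hl : l + 1 < N) {q : ℂ} (hq : q ≠ 0) :
    Commute (Tpol q k : Module.End ℂ (Pol N)) (Tpol q l) := by
  refine end_ext fun F z hz => ?_
  have hk : k + 1 < N := by omega
  have n1 := hz.ne (i := k) (j := k + 1) (by omega) hk (by omega)
  have n2 := hz.ne (i := l) (j := l + 1) (by omega) hl (by omega)
  have e1 : sw k z l = z l := by rw [sw_of_ne] <;> omega
  have e2 : sw k z (l + 1) = z (l + 1) := by rw [sw_of_ne] <;> omega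
  have e3 : sw l z k = z k := by rw [sw_of_ne] <;> omega
  have e4 : sw l z (k + 1) = z (k + 1) := by rw [sw_of_ne] <;> omega
  simp only [Module.End.mul_apply]
  rw [evN_Tpol hk q hq n1, evN_Tpol hl q hq n2, evN_Tpol hl q hq (by rwa [e1, e2]),
    evN_Tpol hl q hq n2, evN_Tpol hk q hq n1, evN_Tpol hk q hq (by rwa [e3, e4]),
    e1, e2, e3, e4, sw_comm h]
  ring

theorem sw_braid (k : ℕ) (z : ℕ → ℂ) :
    sw k (sw (k + 1) (sw k z)) = sw (k + 1) (sw k (sw (k + 1) z)) := by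
  funext m
  by_cases h0 : m = k
  · subst h0
    rw [sw_left, sw_left, sw_of_ne _ (by omega) (by omega), sw_of_ne _ (by omega) (by omega),
      sw_left, sw_left]
  by_cases h1 : m = k + 1
  · subst h1
    rw [sw_right, sw_of_ne _ (by omega) (by omega), sw_left, sw_left,
      sw_of_ne _ (by omega) (by omega), sw_right]
  by_cases h2 : m = k + 2
  · subst h2
    rw [sw_of_ne _ (by omega) (by omega), sw_right, sw_right, sw_right, sw_right,
      sw_of_ne _ (by omega) (by omega)]
  rw [sw_of_ne, sw_of_ne, sw_of_ne, sw_of_ne, sw_of_ne, sw_of_ne] <;> omega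

theorem Tpol_braid {N k : ℕ} (hk : k + 2 < N) {q : ℂ} (hq : q ≠ 0) :
    (Tpol q k * Tpol q (k + 1) * Tpol q k : Module.End ℂ (Pol N))
      = Tpol q (k + 1) * Tpol q k * Tpol q (k + 1) := by
  refine end_ext fun F z hz => ?_
  have hk' : k + 1 < N := by omega
  have n1 := hz.ne (i := k) (j := k + 1) (by omega) (by omega) (by omega)
  have n2 := hz.ne (i := k) (j := k + 2) (by omega) (by omega) (by omega)
  have n3 := hz.ne (i := k + 1) (j := k + 2) (by omega) (by omega) (by omega)
  have n1' := hz.ne (i := k + 1) (j := k) (by omega) (by omega) (by omega)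
  have n3' := hz.ne (i := k + 2) (j := k + 1) (by omega) (by omega) (by omega)
  have A1 : ∀ y : ℕ → ℂ, Dist N y → ∀ G : Pol N, evN y (Tpol q k G) =
      (q - aR q (y k) (y (k + 1))) * evN y G + aR q (y k) (y (k + 1)) * evN (sw k y) G :=
    fun y hy G => evN_Tpol hk' q hq (hy.ne (by omega) (by omega) (by omega)) G
  have A2 : ∀ y : ℕ → ℂ, Dist N y → ∀ G : Pol N, evN y (Tpol q (k + 1) G) =
      (q - aR q (y (k + 1)) (y (k + 2))) * evN y G
        + aR q (y (k + 1)) (y (k + 2)) * evN (sw (k + 1) y) G :=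
    fun y hy G => evN_Tpol hk q hq (hy.ne (by omega) (by omega) (by omega)) G
  have d1 : Dist N (sw k z) := hz.sw hk'
  have d2 : Dist N (sw (k + 1) z) := hz.sw hk
  have d12 : Dist N (sw (k + 1) (sw k z)) := d1.sw hk
  have d21 : Dist N (sw k (sw (k + 1) z)) := d2.sw hk'
  have s1 : sw k z (k + 2) = z (k + 2) := by rw [sw_of_ne] <;> omega
  have s2 : sw (k + 1) z k = z k := by rw [sw_of_ne] <;> omega
  have s3 : sw (k + 1) z (k + 2) = z (k + 1) := sw_right _ _
  have s4 : sw (k + 1) (sw k z) k = z (k + 1) := by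
    rw [sw_of_ne _ (by omega) (by omega), sw_left]
  have s5 : sw (k + 1) (sw k z) (k + 1) = z (k + 2) := by rw [sw_left]; exact s1
  have s6 : sw k (sw (k + 1) z) (k + 1) = z k := by rw [sw_right]; exact s2
  have s7 : sw k (sw (k + 1) z) (k + 2) = z (k + 1) := by
    rw [sw_of_ne _ (by omega) (by omega)]; exact s3
  have s8 : sw (k + 1) z (k + 1) = z (k + 2) := sw_left _ _
  simp only [Module.End.mul_apply]
  simp only [A1 _ hz, A2 _ hz, A1 _ d1, A2 _ d1, A1 _ d2, A2 _ d2, A1 _ d12, A2 _ d21, s1, s2, s3,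
    s4, s5, s6, s7, s8, sw_left, sw_right, sw_sw]
  rw [sw_braid]
  have h12 : aR q (z (k + 1)) (z k) = q + q⁻¹ - aR q (z k) (z (k + 1)) := by
    rw [← aR_add q n1]; ring
  have h23 : aR q (z (k + 2)) (z (k + 1)) = q + q⁻¹ - aR q (z (k + 1)) (z (k + 2)) := by
    rw [← aR_add q n3]; ring
  -- The three-term relation of the coefficients; the two sides of the braid relation differ by a
  -- multiple of it.
  have key : aR q (z k) (z (k + 1)) * aR q (z (k + 1)) (z (k + 2))
      = aR q (z k) (z (k + 2)) * aR q (z (k + 1)) (z (k + 2))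
        + aR q (z k) (z (k + 1)) * aR q (z k) (z (k + 2))
        - q⁻¹ * aR q (z k) (z (k + 2)) - q * aR q (z k) (z (k + 2)) + 1 := by
    unfold aR
    field_simp
    ring
  rw [h12, h23]
  have hqq : q * q⁻¹ = 1 := mul_inv_cancel₀ hq
  generalize aR q (z k) (z (k + 1)) = a at *
  generalize aR q (z (k + 1)) (z (k + 2)) = b at *
  generalize aR q (z k) (z (k + 2)) = c at *
  generalize q⁻¹ = r at *
  linear_combination ((b - a) * evN z F + a * evN (sw k z) F - b * evN (sw (k + 1) z) F) *
    (key - hqq)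

theorem evN_cyc {N : ℕ} (p : ℂ) (z : ℕ → ℂ) (F : Pol N) :
    evN z (cyc p F) = evN (rot N p z) F := by
  rw [cyc, AlgHom.toLinearMap_apply, evN, evN, ← coe_aeval_eq_eval, ← coe_aeval_eq_eval,
    RingHom.coe_coe, RingHom.coe_coe, comp_aeval_apply]
  congr 2
  funext i
  unfold rot
  split_ifs with h h'
  · simp
  · simp
  · exact absurd i.isLt h'

/-- The inverse of the twisted cyclic shift. -/
def cycInv {N : ℕ} (p : ℂ) : Module.End ℂ (Pol N) :=
  (aeval fun i : Fin N =>
    if h : (i : ℕ) + 1 < N then (X ⟨(i : ℕ) + 1, h⟩ : Pol N)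
    else C p⁻¹ * X ⟨0, by have := i.isLt; omega⟩).toLinearMap

/-- The inverse of `rot`. -/
def rotInv (N : ℕ) (p : ℂ) (z : ℕ → ℂ) : ℕ → ℂ := fun k =>
  if k + 1 < N then z (k + 1) else if k + 1 = N then p⁻¹ * z 0 else z k

theorem evN_cycInv {N : ℕ} (p : ℂ) (z : ℕ → ℂ) (F : Pol N) :
    evN z (cycInv p F) = evN (rotInv N p z) F := by
  rw [cycInv, AlgHom.toLinearMap_apply, evN, evN, ← coe_aeval_eq_eval, ← coe_aeval_eq_eval,
    RingHom.coe_coe, RingHom.coe_coe, comp_aeval_apply]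
  congr 2
  funext i
  unfold rotInv
  split_ifs with h h'
  · simp
  · simp
  · have := i.isLt; omega

theorem cyc_mul_cycInv {N : ℕ} {p : ℂ} (hp : p ≠ 0) :
    (cyc p * cycInv p : Module.End ℂ (Pol N)) = 1 := by
  refine end_ext fun F z _ => ?_
  rw [Module.End.mul_apply, evN_cyc, evN_cycInv]
  refine evN_congr (fun k hk => ?_) F
  unfold rotInv rot
  rcases Nat.lt_or_ge (k + 1) N with h0 | h0
  · simp [h0]
  · obtain rfl : N = k + 1 := by omega
    simp [hp]

theorem cycInv_mul_cyc {N : ℕ} {p : ℂ} (hp : p ≠ 0) :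
    (cycInv p * cyc p : Module.End ℂ (Pol N)) = 1 := by
  refine end_ext fun F z _ => ?_
  rw [Module.End.mul_apply, evN_cycInv, evN_cyc]
  refine evN_congr (fun k hk => ?_) F
  unfold rotInv rot
  rcases Nat.eq_zero_or_pos k with rfl | h0
  · simp [show N - 1 + 1 = N by omega, hp]
  · simp [h0.ne', hk, show k - 1 + 1 = k by omega]

theorem cyc_mul_Tpol {N k : ℕ} (hk : k + 2 < N) {q : ℂ} (hq : q ≠ 0) (p : ℂ) :
    (cyc p * Tpol q (k + 1) : Module.End ℂ (Pol N)) = Tpol q k * cyc p := by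
  refine end_ext fun F z hz => ?_
  have n1 := hz.ne (i := k) (j := k + 1) (by omega) (by omega) (by omega)
  have e1 : rot N p z (k + 1) = z k := by simp [rot, show k + 1 < N by omega]
  have e2 : rot N p z (k + 1 + 1) = z (k + 1) := by simp [rot, hk]
  rw [Module.End.mul_apply, Module.End.mul_apply, evN_cyc,
    evN_Tpol (by omega) q hq (by rwa [e1, e2]), evN_Tpol (by omega) q hq n1, evN_cyc, evN_cyc,
    e1, e2, rot_sw hk]

theorem rot_rot_sw {N : ℕ} (p : ℂ) (z : ℕ → ℂ) :
    rot (N + 2) p (rot (N + 2) p (sw N z)) = sw 0 (rot (N + 2) p (rot (N + 2) p z)) := by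
  have e0 : ∀ y, rot (N + 2) p (rot (N + 2) p y) 0 = p * y N := by
    intro y; cases N <;> simp [rot]
  have e1 : ∀ y, rot (N + 2) p (rot (N + 2) p y) 1 = p * y (N + 1) := by
    intro y; simp [rot]
  funext m
  by_cases h1 : m = 0
  · subst h1; rw [sw_left, e0, zero_add, e1, sw_left]
  by_cases h2 : m = 1
  · subst h2; rw [show (1 : ℕ) = 0 + 1 from rfl, sw_right, e0, zero_add, e1, sw_right]
  rw [sw_of_ne _ h1 h2]
  unfold rot
  simp only [h1, if_false, show m - 1 ≠ 0 by omega]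
  split_ifs <;> (rw [sw_of_ne] <;> omega)

/-- After two shifts the first two places hold the last two coordinates, both multiplied by `p`, and
`a(x, y)` is homogeneous of degree zero. -/
theorem cyc_sq_mul_Tpol {N : ℕ} {q : ℂ} (hq : q ≠ 0) {p : ℂ} (hp : p ≠ 0) :
    (cyc p * cyc p * Tpol q 0 : Module.End ℂ (Pol (N + 2))) = Tpol q N * (cyc p * cyc p) := by
  refine end_ext fun F z hz => ?_
  have n1 := hz.ne (i := N) (j := N + 1) (by omega) (by omega) (by omega)
  have e0 : rot (N + 2) p (rot (N + 2) p z) 0 = p * z N := by cases N <;> simp [rot]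
  have e1 : rot (N + 2) p (rot (N + 2) p z) (0 + 1) = p * z (N + 1) := by simp [rot]
  have ea : aR q (p * z N) (p * z (N + 1)) = aR q (z N) (z (N + 1)) := by
    rw [aR, aR, show q * (p * z N) - q⁻¹ * (p * z (N + 1)) = p * (q * z N - q⁻¹ * z (N + 1)) by
      ring, ← mul_sub, mul_div_mul_left _ _ hp]
  rw [Module.End.mul_apply, Module.End.mul_apply, Module.End.mul_apply, Module.End.mul_apply,
    evN_cyc, evN_cyc, evN_Tpol (by omega) q hq (by
      rw [e0, e1, ← mul_sub]; exact mul_ne_zero hp n1),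
    evN_Tpol (by omega) q hq n1, evN_cyc, evN_cyc, evN_cyc, evN_cyc, e0, e1, ea, rot_rot_sw]

/-! ### Ordered products of commuting elements -/

section OrderedProducts

variable {A : Type*} [Ring A] {N : ℕ} {f : Fin N → A}

/-- The product of `f` over `s` in increasing order. -/
def sprod (f : Fin N → A) (s : Finset (Fin N)) : A := ((s.sort (· ≤ ·)).map f).prod

theorem sprod_insert (hf : ∀ i j, Commute (f i) (f j)) {a : Fin N} {s : Finset (Fin N)}
    (ha : a ∉ s) : sprod f (insert a s) = f a * sprod f s := by
  have hp : ((insert a s).sort (· ≤ ·)).Perm (a :: s.sort (· ≤ ·)) := by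
    refine (List.perm_ext_iff_of_nodup (Finset.sort_nodup _ _) ?_).mpr fun x => ?_
    · exact List.nodup_cons.mpr ⟨by simpa using ha, Finset.sort_nodup _ _⟩
    · simp
  rw [sprod, (hp.map f).prod_eq', List.map_cons, List.prod_cons, sprod]
  exact List.pairwise_map.mpr (List.pairwise_of_forall fun i j => hf i j)

theorem commute_sprod {x : A} {s : Finset (Fin N)} (h : ∀ i ∈ s, Commute x (f i)) :
    Commute x (sprod f s) := by
  refine Commute.list_prod_right _ _ fun y hy => ?_
  obtain ⟨i, hi, rfl⟩ := List.mem_map.mp hy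
  exact h i (by simpa using hi)

theorem commute_sprod_sprod (hf : ∀ i j, Commute (f i) (f j)) (s t : Finset (Fin N)) :
    Commute (sprod f s) (sprod f t) :=
  commute_sprod fun i _ => (commute_sprod fun j _ => hf i j).symm

theorem sum_powersetCard_pred (hN : 0 < N) (g : Finset (Fin N) → A) :
    ∑ s ∈ Finset.powersetCard (N - 1) (Finset.univ : Finset (Fin N)), g s
      = ∑ i : Fin N, g (Finset.univ.erase i) := by
  symm
  refine Finset.sum_bij (fun i _ => Finset.univ.erase i) ?_ ?_ ?_ ?_
  · intro i _
    simp [Finset.mem_powersetCard]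
  · intro i _ j _ hij
    by_contra hne
    have : j ∈ Finset.univ.erase i := by simp [Ne.symm hne]
    rw [hij] at this
    simp at this
  · intro s hs
    rw [Finset.mem_powersetCard] at hs
    have : (sᶜ).card = 1 := by
      rw [Finset.card_compl, hs.2, Fintype.card_fin]; omega
    obtain ⟨i, hi⟩ := Finset.card_eq_one.mp this
    refine ⟨i, Finset.mem_univ _, ?_⟩
    rw [← Finset.compl_singleton, ← hi, compl_compl]
  · intro i _; rfl

/-- An element which commutes with the symmetric functions of a pair `f a, f b`, and with all
other `f i`, commutes with the elementary symmetric functions of `f`. -/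
theorem commute_esymm (hf : ∀ i j, Commute (f i) (f j)) {a b : Fin N} (hab : a ≠ b) {t : A}
    (ht : ∀ i, i ≠ a → i ≠ b → Commute t (f i)) (hs : Commute t (f a + f b))
    (hp : Commute t (f a * f b)) (r : ℕ) :
    Commute t (∑ s ∈ Finset.powersetCard r (Finset.univ : Finset (Fin N)), sprod f s) := by
  have hmixed : ∀ {a b : Fin N} {s : Finset (Fin N)}, a ≠ b → a ∈ s → b ∉ s →
      s.map (Equiv.swap a b).toEmbedding = insert b (s.erase a) := by
    intro a b s hab ha hb
    ext x
    simp only [Finset.mem_map_equiv, Equiv.symm_swap, Finset.mem_insert, Finset.mem_erase]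
    by_cases h1 : x = a
    · subst h1; simp [hb, hab]
    by_cases h2 : x = b
    · subst h2; simp [ha]
    · simp [Equiv.swap_apply_of_ne_of_ne h1 h2, h1, h2]
  have hcomm0 : ∀ s : Finset (Fin N), (a ∈ s ↔ b ∈ s) → Commute t (sprod f s) := by
    intro s hs'
    by_cases ha : a ∈ s
    · have hb := hs'.mp ha
      rw [← Finset.insert_erase ha, sprod_insert hf (Finset.notMem_erase a s),
        ← Finset.insert_erase (Finset.mem_erase.mpr ⟨hab.symm, hb⟩),
        sprod_insert hf (Finset.notMem_erase b _), ← mul_assoc]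
      refine hp.mul_right (commute_sprod fun i hi => ht i ?_ ?_)
      · exact Finset.ne_of_mem_erase (Finset.mem_of_mem_erase hi)
      · exact Finset.ne_of_mem_erase hi
    · refine commute_sprod fun i hi => ht i ?_ ?_
      · rintro rfl; exact ha hi
      · rintro rfl; exact ha (hs'.mpr hi)
  have hpair : ∀ s : Finset (Fin N), a ∈ s → b ∉ s →
      Commute t (sprod f s + sprod f (insert b (s.erase a))) := by
    intro s ha hb
    have hb' : b ∉ s.erase a := fun h => hb (Finset.mem_of_mem_erase h)
    have h1 := sprod_insert hf (Finset.notMem_erase a s)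
    rw [Finset.insert_erase ha] at h1
    rw [h1, sprod_insert hf hb', ← add_mul]
    refine hs.mul_right (commute_sprod fun i hi => ht i (Finset.ne_of_mem_erase hi) ?_)
    rintro rfl
    exact hb' hi
  have hpair' : ∀ s : Finset (Fin N), b ∈ s → a ∉ s →
      Commute t (sprod f s + sprod f (insert a (s.erase b))) := by
    intro s hb ha
    have ha' : a ∉ s.erase b := fun h => ha (Finset.mem_of_mem_erase h)
    have h1 := sprod_insert hf (Finset.notMem_erase b s)
    rw [Finset.insert_erase hb] at h1
    rw [h1, sprod_insert hf ha', ← add_mul, add_comm (f b)]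
    refine hs.mul_right (commute_sprod fun i hi => ht i ?_ (Finset.ne_of_mem_erase hi))
    rintro rfl
    exact ha' hi
  rw [Commute, SemiconjBy, ← sub_eq_zero, Finset.mul_sum, Finset.sum_mul, ← Finset.sum_sub_distrib]
  have hsum : ∀ x y : A, Commute t (x + y) → t * x - x * t + (t * y - y * t) = 0 := by
    intro x y h
    have := h.eq
    rw [mul_add, add_mul] at this
    rw [sub_add_sub_comm, this, sub_self]
  have hself : ∀ s : Finset (Fin N), (a ∈ s ↔ b ∈ s) →
      s.map (Equiv.swap a b).toEmbedding = s := by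
    intro s hs'
    ext x
    simp only [Finset.mem_map_equiv, Equiv.symm_swap]
    by_cases h1 : x = a
    · subst h1; simp [hs']
    by_cases h2 : x = b
    · subst h2; simp [hs']
    · simp [Equiv.swap_apply_of_ne_of_ne h1 h2]
  -- Index sets containing exactly one of `a`, `b` are paired by exchanging these two, and the
  -- commutators cancel in pairs. All other index sets contribute zero individually.
  refine Finset.sum_involution (fun s _ => s.map (Equiv.swap a b).toEmbedding) ?_ ?_ ?_ ?_
  · intro s _
    by_cases ha : a ∈ s <;> by_cases hb : b ∈ s
    · rw [(hcomm0 s (by tauto)).eq, (hcomm0 (s.map _) (by simp [hself s (by tauto), ha, hb])).eq]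
      simp
    · rw [hmixed hab ha hb]; exact hsum _ _ (hpair s ha hb)
    · rw [Equiv.swap_comm, hmixed hab.symm hb ha]; exact hsum _ _ (hpair' s hb ha)
    · rw [(hcomm0 s (by tauto)).eq, (hcomm0 (s.map _) (by simp [hself s (by tauto), ha, hb])).eq]
      simp
  · intro s _ hne heq
    have hiff : ¬ (a ∈ s ↔ b ∈ s) := fun h => hne (by rw [(hcomm0 s h).eq, sub_self])
    apply hiff
    have : b ∈ s.map (Equiv.swap a b).toEmbedding ↔ a ∈ s := by simp [Finset.mem_map_equiv]
    rw [heq] at this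
    exact this.symm
  · intro s hs'
    rw [Finset.mem_powersetCard] at hs' ⊢
    exact ⟨Finset.subset_univ _, by rw [Finset.card_map, hs'.2]⟩
  · intro s _
    ext x
    simp [Finset.mem_map_equiv]

end OrderedProducts

/-! ### The operators `Y_i` -/

section YOps

variable {N : ℕ} {q p : ℂ}

/-- `T_k` as a unit. -/
def TU (N : ℕ) (hq : q ≠ 0) (k : ℕ) : (Module.End ℂ (Pol N))ˣ :=
  if h : k + 1 < N then
    ⟨Tpol q k, TpolInv q k, Tpol_mul_TpolInv h hq, TpolInv_mul_Tpol h hq⟩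
  else 1

/-- The twisted cyclic shift as a unit. -/
def cycU (N : ℕ) (hp : p ≠ 0) : (Module.End ℂ (Pol N))ˣ :=
  ⟨cyc p, cycInv p, cyc_mul_cycInv hp, cycInv_mul_cyc hp⟩

theorem coe_TU (hq : q ≠ 0) {k : ℕ} (hk : k + 1 < N) :
    (TU N hq k : Module.End ℂ (Pol N)) = Tpol q k := by
  rw [TU, dif_pos hk]

theorem coe_TU_inv (hq : q ≠ 0) {k : ℕ} (hk : k + 1 < N) :
    (((TU N hq k)⁻¹ : (Module.End ℂ (Pol N))ˣ) : Module.End ℂ (Pol N)) = TpolInv q k := by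
  rw [TU, dif_pos hk]; rfl

theorem affBraid_pol (hq : q ≠ 0) (hp : p ≠ 0) :
    AffBraid (N - 1) (TU N hq) (cycU N hp) where
  braid k hk := by
    apply Units.ext
    simp only [Units.val_mul, coe_TU hq (show k + 1 < N by omega),
      coe_TU hq (show k + 1 + 1 < N by omega)]
    exact Tpol_braid (by omega) hq
  comm k l h hl := by
    apply Units.ext
    simp only [Units.val_mul, coe_TU hq (show k + 1 < N by omega),
      coe_TU hq (show l + 1 < N by omega)]
    exact Tpol_comm h (by omega) hq
  shift k hk := by
    apply Units.ext
    simp only [Units.val_mul, coe_TU hq (show k + 1 < N by omega),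
      coe_TU hq (show k + 1 + 1 < N by omega)]
    exact cyc_mul_Tpol (by omega) hq p
  shift_two h := by
    obtain ⟨M, rfl⟩ : ∃ M, N = M + 2 := ⟨N - 2, by omega⟩
    apply Units.ext
    simp only [Units.val_mul, coe_TU hq (show 0 + 1 < M + 2 by omega),
      coe_TU hq (show M + 2 - 1 - 1 + 1 < M + 2 by omega)]
    exact cyc_sq_mul_Tpol hq hp

theorem coe_list_prod_map {A : Type*} [Monoid A] {ι : Type*} (l : List ι) (u : ι → Aˣ) (f : ι → A)
    (h : ∀ i ∈ l, (u i : A) = f i) : (((l.map u).prod : Aˣ) : A) = (l.map f).prod := by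
  induction l with
  | nil => simp
  | cons a l ih =>
    simp only [List.map_cons, List.prod_cons, Units.val_mul]
    rw [h a (by simp), ih fun i hi => h i (by simp [hi])]

theorem Y_eq (hq : q ≠ 0) (hp : p ≠ 0) (i : Fin N) :
    Y q p i = (affY (N - 1) (TU N hq) (cycU N hp) i : (Module.End ℂ (Pol N))ˣ) := by
  have hi := i.isLt
  rw [Y, affY, ascT, Units.val_mul, Units.val_mul,
    coe_list_prod_map _ _ (Tpol q) fun k hk => ?_,
    coe_list_prod_map _ _ (TpolInv q) fun k hk => ?_]
  · rfl
  · rw [List.mem_range] at hk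
    exact coe_TU_inv hq (by omega)
  · rw [List.mem_range'_1] at hk
    exact coe_TU hq (by omega)

theorem Y_commute (hq : q ≠ 0) (hp : p ≠ 0) (i j : Fin N) : Commute (Y q p i) (Y q p j) := by
  rw [Y_eq hq hp, Y_eq hq hp]
  exact ((affBraid_pol hq hp).commute_affY (by omega) (by omega)).units_val

theorem Tpol_commute_Y (hq : q ≠ 0) (hp : p ≠ 0) {k : ℕ} (hk : k + 1 < N) (i : Fin N)
    (h1 : k ≠ i) (h2 : k + 1 ≠ i) : Commute (Tpol q k) (Y q p i) := by
  rw [Y_eq hq hp, ← coe_TU hq hk]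
  exact ((affBraid_pol hq hp).comm_affY i (by omega) k (by omega) h1 h2).units_val

theorem Y_eq_Tpol_mul (hq : q ≠ 0) (hp : p ≠ 0) {k : ℕ} (hk : k + 1 < N) :
    (Y q p (⟨k, by omega⟩ : Fin N)) = Tpol q k * Y q p ⟨k + 1, hk⟩ * Tpol q k := by
  rw [Y_eq hq hp, Y_eq hq hp, ← coe_TU hq hk, ← Units.val_mul, ← Units.val_mul,
    affY_eq (by simp only; omega)]

theorem Tpol_commute_Y_mul (hq : q ≠ 0) (hp : p ≠ 0) {k : ℕ} (hk : k + 1 < N) :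
    Commute (Tpol q k) (Y q p (⟨k, by omega⟩ : Fin N) * Y q p ⟨k + 1, hk⟩) := by
  have h := Y_commute hq hp (⟨k, by omega⟩ : Fin N) ⟨k + 1, hk⟩
  have h1 := Y_eq_Tpol_mul hq hp hk
  rw [Commute, SemiconjBy]
  calc _ = Tpol q k * (Y q p (⟨k, by omega⟩ : Fin N) * Y q p ⟨k + 1, hk⟩) := rfl
    _ = Tpol q k * (Y q p ⟨k + 1, hk⟩ * Y q p (⟨k, by omega⟩ : Fin N)) := by rw [h.eq]
    _ = Tpol q k * Y q p ⟨k + 1, hk⟩ * (Tpol q k * Y q p ⟨k + 1, hk⟩ * Tpol q k) := by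
      rw [← h1, mul_assoc]
    _ = Y q p (⟨k, by omega⟩ : Fin N) * Y q p ⟨k + 1, hk⟩ * Tpol q k := by
      rw [h1]; simp only [mul_assoc]

theorem Tpol_commute_Y_add (hq : q ≠ 0) (hp : p ≠ 0) {k : ℕ} (hk : k + 1 < N) :
    Commute (Tpol q k) (Y q p (⟨k, by omega⟩ : Fin N) + Y q p ⟨k + 1, hk⟩) := by
  rw [Y_eq_Tpol_mul hq hp hk]
  set y := Y q p (⟨k + 1, hk⟩ : Fin N)
  have h2 := Tpol_mul_self hk hq
  rw [Commute, SemiconjBy]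
  have e1 : Tpol q k * (Tpol q k * y * Tpol q k)
      = (q - q⁻¹) • (Tpol q k * y * Tpol q k) + y * Tpol q k := by
    rw [← mul_assoc, ← mul_assoc, h2, add_mul, add_mul, one_mul, smul_mul_assoc, smul_mul_assoc]
  have e2 : Tpol q k * y * Tpol q k * Tpol q k
      = (q - q⁻¹) • (Tpol q k * y * Tpol q k) + Tpol q k * y := by
    rw [mul_assoc _ (Tpol q k), h2, mul_add, mul_one, mul_smul_comm]
  rw [mul_add, add_mul, e1, e2]
  abel

theorem esymmY_eq (r : ℕ) : (esymmY q p r : Module.End ℂ (Pol N))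
    = ∑ s ∈ Finset.powersetCard r (Finset.univ : Finset (Fin N)), sprod (Y q p) s := rfl

theorem Tpol_commute_esymmY (hq : q ≠ 0) (hp : p ≠ 0) {k : ℕ} (hk : k + 1 < N) (r : ℕ) :
    Commute (Tpol q k : Module.End ℂ (Pol N)) (esymmY q p r) := by
  rw [esymmY_eq]
  refine commute_esymm (Y_commute hq hp) (a := ⟨k, by omega⟩) (b := ⟨k + 1, hk⟩)
    (by simp [Fin.ext_iff]) (fun i h1 h2 => Tpol_commute_Y hq hp hk i ?_ ?_)
    (Tpol_commute_Y_add hq hp hk) (Tpol_commute_Y_mul hq hp hk) r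
  · rintro rfl; exact h1 rfl
  · intro h; exact h2 (Fin.ext h.symm)

theorem esymmY_commute (hq : q ≠ 0) (hp : p ≠ 0) (r s : ℕ) :
    Commute (esymmY q p r : Module.End ℂ (Pol N)) (esymmY q p s) := by
  rw [esymmY_eq, esymmY_eq]
  exact Commute.sum_left _ _ _ fun i _ => Commute.sum_right _ _ _ fun j _ =>
    commute_sprod_sprod (Y_commute hq hp) i j

theorem esymmY_top_eq_sprod : (esymmY q p N : Module.End ℂ (Pol N)) = sprod (Y q p) Finset.univ := by
  have h : Finset.powersetCard N (Finset.univ : Finset (Fin N)) = {Finset.univ} := by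
    have := Finset.powersetCard_self (Finset.univ : Finset (Fin N))
    rwa [Finset.card_univ, Fintype.card_fin] at this
  rw [esymmY_eq, h, Finset.sum_singleton]

theorem esymmY_top (hq : q ≠ 0) (hp : p ≠ 0) (hN : 0 < N) :
    (esymmY q p N : Module.End ℂ (Pol N)) = cyc p ^ N := by
  have h1 := (affBraid_pol (N := N) hq hp).prod_affY
  rw [Nat.sub_add_cancel hN] at h1
  have h2 := congrArg Units.val h1
  rw [Units.val_pow_eq_pow_val, coe_list_prod_map _ _
    (fun i => ((affY (N - 1) (TU N hq) (cycU N hp) i : (Module.End ℂ (Pol N))ˣ) :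
      Module.End ℂ (Pol N))) fun _ _ => rfl] at h2
  rw [esymmY_top_eq_sprod, sprod, Fin.sort_univ]
  refine Eq.trans ?_ h2
  rw [← List.map_coe_finRange_eq_range, List.map_map]
  congr 1
  exact List.map_congr_left fun i _ => Y_eq hq hp i

/-- The inverse of `Y_i`. -/
def Yinv (hq : q ≠ 0) (hp : p ≠ 0) (i : Fin N) : Module.End ℂ (Pol N) :=
  ((affY (N - 1) (TU N hq) (cycU N hp) i)⁻¹ : (Module.End ℂ (Pol N))ˣ)

/-- The `Y_j` commute, so the product that omits `Y_i` is the full product times `Y_i⁻¹`. This turns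
`D̃_{-1}` into `∑ Y_i⁻¹`. -/
theorem esymmY_pred (hq : q ≠ 0) (hp : p ≠ 0) (hN : 0 < N) :
    (esymmY q p (N - 1) : Module.End ℂ (Pol N)) = esymmY q p N * ∑ i, Yinv hq hp i := by
  rw [esymmY_eq, sum_powersetCard_pred hN, esymmY_top_eq_sprod, Finset.mul_sum]
  refine Finset.sum_congr rfl fun i _ => ?_
  have h1 := sprod_insert (Y_commute (N := N) hq hp) (Finset.notMem_erase i Finset.univ)
  rw [Finset.insert_erase (Finset.mem_univ i)] at h1
  have h2 : Commute (Y q p i) (sprod (Y q p) (Finset.univ.erase i)) :=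
    commute_sprod fun j _ => Y_commute hq hp i j
  rw [h1, h2.eq, mul_assoc, Yinv, Y_eq hq hp, Units.mul_inv, mul_one]

theorem isUnit_esymmY_top (hq : q ≠ 0) (hp : p ≠ 0) (hN : 0 < N) :
    IsUnit (esymmY q p N : Module.End ℂ (Pol N)) := by
  rw [esymmY_top hq hp hN]
  exact (cycU N hp).isUnit.pow N

theorem spinDneg_eq (hq : q ≠ 0) (hp : p ≠ 0) (hN : 0 < N) :
    (spinDneg q p : Module.End ℂ (SpinPol N)) = (∑ i, Yinv hq hp i).compLeft (Conf N) := by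
  obtain ⟨u, hu⟩ := isUnit_esymmY_top (N := N) hq hp hN
  -- `Ring.inverse` is zero away from units, so invertibility of `D̃_N` has to be established before
  -- it can be cancelled.
  have hun : IsUnit (spinD q p N : Module.End ℂ (SpinPol N)) := by
    refine ⟨⟨(u : Module.End ℂ (Pol N)).compLeft _, ((u⁻¹ : (Module.End ℂ (Pol N))ˣ) :
      Module.End ℂ (Pol N)).compLeft _, ?_, ?_⟩, ?_⟩
    · refine LinearMap.ext fun Ψ => _root_.funext fun s => ?_
      exact LinearMap.congr_fun u.mul_inv (Ψ s)
    · refine LinearMap.ext fun Ψ => _root_.funext fun s => ?_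
      exact LinearMap.congr_fun u.inv_mul (Ψ s)
    · rw [spinD, ← hu]
  have h1 : (spinD q p (N - 1) : Module.End ℂ (SpinPol N))
      = spinD q p N * (∑ i, Yinv hq hp i).compLeft (Conf N) := by
    rw [spinD, esymmY_pred hq hp hN]; rfl
  rw [spinDneg, h1, ← mul_assoc, Ring.inverse_mul_cancel _ hun, one_mul]

end YOps

/-! ### The Temperley–Lieb action on spin vectors -/

section SpinAction

variable {N : ℕ}

theorem sum_map_nn {R : Type*} [CommRing R] (φ : ℂ →+* R) {k : ℕ} (h : k + 1 < N)
    (M : Matrix (Fin (2 * 2)) (Fin (2 * 2)) ℂ) (v : Conf N → R) (s : Conf N) :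
    (((nn k M : SpinOp N).map φ).mulVec v) s = ∑ xy : Fin 2 × Fin 2,
      φ (M (finProdFinEquiv (s ⟨k, by omega⟩, s ⟨k + 1, h⟩)) (finProdFinEquiv xy)) *
        v (Function.update (Function.update s ⟨k, by omega⟩ xy.1) ⟨k + 1, h⟩ xy.2) := by
  have hab : (⟨k, by omega⟩ : Fin N) ≠ ⟨k + 1, h⟩ := by simp [Fin.ext_iff]
  rw [Matrix.mulVec, dotProduct]
  symm
  refine Finset.sum_of_injOn (fun xy : Fin 2 × Fin 2 =>
    Function.update (Function.update s ⟨k, by omega⟩ xy.1) ⟨k + 1, h⟩ xy.2) ?_ ?_ ?_ ?_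
  · intro x _ y _ hxy
    have h1 := congrFun hxy ⟨k, by omega⟩
    have h2 := congrFun hxy ⟨k + 1, h⟩
    simp only [Function.update_of_ne hab, Function.update_self] at h1 h2
    exact Prod.ext h1 h2
  · intro x _; simp
  · intro s' _ hs'
    have : ¬ ∀ m, m ≠ (⟨k, by omega⟩ : Fin N) → m ≠ ⟨k + 1, h⟩ → s m = s' m := by
      intro hall
      refine hs' ⟨(s' ⟨k, by omega⟩, s' ⟨k + 1, h⟩), by simp, ?_⟩
      funext m
      by_cases h2 : m = ⟨k + 1, h⟩
      · subst h2; simp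
      by_cases h1 : m = ⟨k, by omega⟩
      · subst h1; simp
      · simp [Function.update_of_ne h2, Function.update_of_ne h1, hall m h1 h2]
    simp only [Matrix.map_apply, nn, dif_pos h, Matrix.of_apply]
    rw [if_neg this, map_zero, zero_mul]
  · intro xy _
    simp only [Matrix.map_apply, nn, dif_pos h, Matrix.of_apply]
    rw [if_pos]
    · simp
    · intro m h1 h2
      simp [Function.update_of_ne h2, Function.update_of_ne h1]

/-- The exchange of two neighbouring spins. -/
def swConf (k : ℕ) (h : k + 1 < N) (s : Conf N) : Conf N :=
  fun m => s (Equiv.swap (⟨k, by omega⟩ : Fin N) ⟨k + 1, h⟩ m)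

/-- The diagonal weight of the Temperley–Lieb generator. -/
def eWt (q : ℂ) (x : Fin 2) : ℂ := if x = 0 then q⁻¹ else q

variable (M : Type*) [AddCommGroup M] [Module ℂ M]

/-- The Temperley–Lieb generator acting on the spins of `M`-valued vectors. -/
def eAct (q : ℂ) (k : ℕ) : Module.End ℂ (Conf N → M) :=
  if h : k + 1 < N then
    { toFun := fun v s => if s ⟨k, by omega⟩ = s ⟨k + 1, h⟩ then 0 else
        eWt q (s ⟨k, by omega⟩) • v s - v (swConf k h s)
      map_add' := fun v w => by
        funext s; simp only [Pi.add_apply]; split_ifs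
        · simp
        · rw [smul_add]; abel
      map_smul' := fun c v => by
        funext s; simp only [Pi.smul_apply, RingHom.id_apply]; split_ifs
        · simp
        · rw [smul_sub, smul_comm] }
  else 1

variable {M}

theorem eAct_apply (q : ℂ) {k : ℕ} (h : k + 1 < N) (v : Conf N → M) (s : Conf N) :
    eAct M q k v s = if s ⟨k, by omega⟩ = s ⟨k + 1, h⟩ then 0 else
        eWt q (s ⟨k, by omega⟩) • v s - v (swConf k h s) := by
  rw [eAct, dif_pos h]; rfl

theorem swConf_left {k : ℕ} (h : k + 1 < N) (s : Conf N) :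
    swConf k h s ⟨k, by omega⟩ = s ⟨k + 1, h⟩ := by simp [swConf]

theorem swConf_right {k : ℕ} (h : k + 1 < N) (s : Conf N) :
    swConf k h s ⟨k + 1, h⟩ = s ⟨k, by omega⟩ := by simp [swConf]

theorem swConf_of_ne {k : ℕ} (h : k + 1 < N) (s : Conf N) {m : Fin N} (h1 : (m : ℕ) ≠ k)
    (h2 : (m : ℕ) ≠ k + 1) : swConf k h s m = s m := by
  rw [swConf, Equiv.swap_apply_of_ne_of_ne (fun e => h1 (congrArg Fin.val e))
    (fun e => h2 (congrArg Fin.val e))]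

theorem swConf_swConf {k : ℕ} (h : k + 1 < N) (s : Conf N) :
    swConf k h (swConf k h s) = s := by
  funext m; simp [swConf]

theorem swConf_comm {k l : ℕ} (hk : k + 1 < N) (hl : l + 1 < N) (h : k + 1 < l) (s : Conf N) :
    swConf k hk (swConf l hl s) = swConf l hl (swConf k hk s) := by
  funext m
  by_cases h1 : (m : ℕ) = k
  · rw [show m = ⟨k, by omega⟩ from Fin.ext h1]
    rw [swConf_left, swConf_of_ne hl _ (by simp; omega) (by simp; omega),
      swConf_of_ne hl _ (by simp; omega) (by simp; omega), swConf_left]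
  by_cases h2 : (m : ℕ) = k + 1
  · rw [show m = ⟨k + 1, hk⟩ from Fin.ext h2]
    rw [swConf_right, swConf_of_ne hl _ (by simp; omega) (by simp; omega),
      swConf_of_ne hl _ (by simp; omega) (by simp; omega), swConf_right]
  rw [swConf_of_ne hk _ h1 h2]
  by_cases h3 : (m : ℕ) = l
  · rw [show m = ⟨l, by omega⟩ from Fin.ext h3]
    rw [swConf_left, swConf_left, swConf_of_ne hk _ (by simp; omega) (by simp; omega)]
  by_cases h4 : (m : ℕ) = l + 1
  · rw [show m = ⟨l + 1, hl⟩ from Fin.ext h4]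
    rw [swConf_right, swConf_right, swConf_of_ne hk _ (by simp; omega) (by simp; omega)]
  rw [swConf_of_ne hl _ h3 h4, swConf_of_ne hl _ h3 h4, swConf_of_ne hk _ h1 h2]

theorem eAct_sq {q : ℂ} (hq : q ≠ 0) {k : ℕ} (h : k + 1 < N) :
    (eAct M q k * eAct M q k : Module.End ℂ (Conf N → M)) = (q + q⁻¹) • eAct M q k := by
  refine LinearMap.ext fun v => _root_.funext fun s => ?_
  rw [Module.End.mul_apply, LinearMap.smul_apply, Pi.smul_apply]
  rw [eAct_apply q h, eAct_apply q h v s, eAct_apply q h v (swConf k h s), swConf_left,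
    swConf_right, swConf_swConf]
  split_ifs with h1 h2
  · simp
  · exact absurd h2.symm h1
  · have hw : (eWt q (s ⟨k, by omega⟩) = q⁻¹ ∧ eWt q (s ⟨k + 1, h⟩) = q) ∨
        (eWt q (s ⟨k, by omega⟩) = q ∧ eWt q (s ⟨k + 1, h⟩) = q⁻¹) := by
      generalize s ⟨k, by omega⟩ = x at *
      generalize s ⟨k + 1, h⟩ = y at *
      fin_cases x <;> fin_cases y <;> simp_all [eWt]
    have hqq : q * q⁻¹ = 1 := mul_inv_cancel₀ hq
    rcases hw with ⟨e1, e2⟩ | ⟨e1, e2⟩ <;> rw [e1, e2] <;>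
      linear_combination (norm := module) (-hqq) • v s

theorem eAct_comm {q : ℂ} {k l : ℕ} (h : k + 1 < l) (hl : l + 1 < N) :
    Commute (eAct M q k : Module.End ℂ (Conf N → M)) (eAct M q l) := by
  refine LinearMap.ext fun v => _root_.funext fun s => ?_
  have hk : k + 1 < N := by omega
  rw [Module.End.mul_apply, Module.End.mul_apply, eAct_apply q hk, eAct_apply q hl, eAct_apply q hl,
    eAct_apply q hl, eAct_apply q hk, eAct_apply q hk]
  rw [swConf_of_ne hk s (m := ⟨l, by omega⟩) (by simp; omega) (by simp; omega),
    swConf_of_ne hk s (m := ⟨l + 1, hl⟩) (by simp; omega) (by simp; omega),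
    swConf_of_ne hl s (m := ⟨k, by omega⟩) (by simp; omega) (by simp; omega),
    swConf_of_ne hl s (m := ⟨k + 1, hk⟩) (by simp; omega) (by simp; omega),
    swConf_comm hk hl h]
  split_ifs
  · rfl
  · simp
  · simp
  · module

theorem update_update_self {k : ℕ} (h : k + 1 < N) (s : Conf N) :
    Function.update (Function.update s ⟨k, by omega⟩ (s ⟨k, by omega⟩)) ⟨k + 1, h⟩
      (s ⟨k + 1, h⟩) = s := by
  simp

theorem update_update_swap {k : ℕ} (h : k + 1 < N) (s : Conf N) :
    Function.update (Function.update s ⟨k, by omega⟩ (s ⟨k + 1, h⟩)) ⟨k + 1, h⟩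
      (s ⟨k, by omega⟩) = swConf k h s := by
  funext m
  by_cases h2 : m = ⟨k + 1, h⟩
  · subst h2; rw [swConf_right]; simp
  by_cases h1 : m = ⟨k, by omega⟩
  · subst h1; rw [swConf_left]; simp
  · rw [Function.update_of_ne h2, Function.update_of_ne h1, swConf_of_ne h s
      (fun e => h1 (Fin.ext e)) (fun e => h2 (Fin.ext e))]

/-- Stated over a general algebra to serve both spin vectors and vectors with polynomial
coefficients. -/
theorem map_nn_eTL {R : Type*} [CommRing R] [Algebra ℂ R] (q : ℂ) {k : ℕ} (h : k + 1 < N)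
    (v : Conf N → R) :
    ((nn k (eTL q) : SpinOp N).map (algebraMap ℂ R)).mulVec v = eAct R q k v := by
  funext s
  rw [sum_map_nn (algebraMap ℂ R) h, eAct_apply q h, Fintype.sum_prod_type]
  have u1 := update_update_self h s
  have u2 := update_update_swap h s
  simp only [Fin.sum_univ_two]
  have e00 : finProdFinEquiv ((0 : Fin 2), (0 : Fin 2)) = (0 : Fin 4) := rfl
  have e01 : finProdFinEquiv ((0 : Fin 2), (1 : Fin 2)) = (1 : Fin 4) := rfl
  have e10 : finProdFinEquiv ((1 : Fin 2), (0 : Fin 2)) = (2 : Fin 4) := rfl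
  have e11 : finProdFinEquiv ((1 : Fin 2), (1 : Fin 2)) = (3 : Fin 4) := rfl
  obtain hx | hx : s ⟨k, by omega⟩ = 0 ∨ s ⟨k, by omega⟩ = 1 := by omega
  all_goals
    obtain hy | hy : s ⟨k + 1, h⟩ = 0 ∨ s ⟨k + 1, h⟩ = 1 := by omega
  all_goals
    rw [hx, hy] at u1 u2
    simp [hx, hy, e00, e01, e10, e11, eTL, eWt, u1, u2, Algebra.smul_def]
  · ring
  · ring

theorem toLin'_nn_eTL (q : ℂ) (k : ℕ) :
    Matrix.toLin' (nn k (eTL q) : SpinOp N) = eAct ℂ q k := by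
  by_cases h : k + 1 < N
  · refine LinearMap.ext fun v => ?_
    rw [Matrix.toLin'_apply, ← map_nn_eTL q h]
    congr 1
  · rw [nn, dif_neg h, eAct, dif_neg h, Matrix.toLin'_one]; rfl

theorem nn_linear {k : ℕ} (h : k + 1 < N) (c d : ℂ) (A : Matrix (Fin (2 * 2)) (Fin (2 * 2)) ℂ) :
    (nn k (c • 1 + d • A) : SpinOp N) = c • 1 + d • nn k A := by
  ext s s'
  simp only [nn, dif_pos h, Matrix.of_apply, Matrix.add_apply, Matrix.smul_apply]
  split_ifs with hs
  · congr 2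
    rw [Matrix.one_apply, Matrix.one_apply]
    congr 1
    rw [eq_iff_iff, EmbeddingLike.apply_eq_iff_eq, Prod.mk.injEq]
    constructor
    · rintro ⟨h1, h2⟩
      funext m
      by_cases e1 : m = ⟨k, by omega⟩
      · rw [e1, h1]
      by_cases e2 : m = ⟨k + 1, h⟩
      · rw [e2, h2]
      exact hs m e1 e2
    · rintro rfl; exact ⟨rfl, rfl⟩
  · have : s ≠ s' := by rintro rfl; exact hs fun _ _ _ => rfl
    simp [Matrix.one_apply_ne this]

theorem THecke_eq (q : ℂ) : THecke q = q • 1 + (-1 : ℂ) • eTL q := by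
  ext i j
  fin_cases i <;> fin_cases j <;> simp [THecke, eTL, sub_eq_add_neg]

theorem Rcheck_eq {q u : ℂ} (h : q * u - q⁻¹ ≠ 0) :
    Rcheck q u = (1 : ℂ) • 1 + (-fR q u) • eTL q := by
  ext i j
  fin_cases i <;> fin_cases j <;> simp [Rcheck, eTL]
  all_goals
    rw [gR, fR, div_eq_mul_inv, div_eq_mul_inv]
    linear_combination mul_inv_cancel₀ h

theorem toLin'_nn_Rcheck {q u : ℂ} (h : q * u - q⁻¹ ≠ 0) {k : ℕ} (hk : k + 1 < N) :
    Matrix.toLin' (nn k (Rcheck q u) : SpinOp N) = Rop q (eAct ℂ q) u k := by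
  rw [Rcheck_eq h, nn_linear hk, map_add, map_smul, map_smul, toLin'_nn_eTL, Matrix.toLin'_one,
    Rop, one_smul, neg_smul (fR q u) (eAct ℂ q k), ← sub_eq_add_neg]
  rfl

theorem isPhysical_iff {q : ℂ} {Ψ : SpinPol N} : IsPhysical q Ψ ↔
    ∀ k, k + 1 < N → (Tpol q k).compLeft (Conf N) Ψ = q • Ψ - eAct (Pol N) q k Ψ := by
  have key : ∀ k, k + 1 < N → ((nn k (THecke q) : SpinOp N).map C).mulVec Ψ
      = q • Ψ - eAct (Pol N) q k Ψ := by
    intro k hk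
    rw [THecke_eq, nn_linear hk, ← map_nn_eTL q hk]
    have : ((q • (1 : SpinOp N) + (-1 : ℂ) • nn k (eTL q)).map C : Matrix _ _ (Pol N))
        = (C q : Pol N) • (1 : Matrix (Conf N) (Conf N) (Pol N)) - (nn k (eTL q) : SpinOp N).map (algebraMap ℂ (Pol N)) := by
      ext s s'
      simp only [Matrix.map_apply, Matrix.add_apply, Matrix.smul_apply, Matrix.sub_apply,
        smul_eq_mul, map_add, map_mul, Matrix.one_apply, algebraMap_eq]
      split_ifs <;> simp [sub_eq_add_neg]
    rw [this, Matrix.sub_mulVec, Matrix.smul_mulVec, Matrix.one_mulVec]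
    congr 1
    funext s
    simp [smul_eq_C_mul]
  constructor
  · intro h k hk
    rw [← key k hk, h k hk]
    rfl
  · intro h k hk
    rw [key k hk, ← h k hk]
    rfl

/-! ### The long-range interactions as products -/

theorem map_between (i j : Fin N) :
    (between i j).map (fun m : Fin N => (m : ℕ)) = List.range' (i + 1) (j - i - 1) := by
  have hs : ((between i j).map (fun m : Fin N => (m : ℕ))).Pairwise (· < ·) := by
    rw [List.pairwise_map]
    exact (List.pairwise_lt_finRange N).filter _
  refine List.Perm.eq_of_pairwise (le := (· < ·)) (fun a b _ _ h1 h2 => ?_) hs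
    List.pairwise_lt_range' ?_
  · omega
  · refine (List.perm_ext_iff_of_nodup (hs.imp fun h => h.ne) List.nodup_range').mpr fun x => ?_
    simp only [between, List.mem_map, List.mem_filter, List.mem_finRange, true_and,
      decide_eq_true_eq, List.mem_range'_1]
    have hj := j.isLt
    constructor
    · rintro ⟨m, ⟨h1, h2⟩, rfl⟩
      rw [Fin.lt_def] at h1 h2; omega
    · rintro ⟨h1, h2⟩
      exact ⟨⟨x, by omega⟩, ⟨by rw [Fin.lt_def]; simp; omega, by rw [Fin.lt_def]; simp; omega⟩, rfl⟩

theorem Bc_eq_prod {W : Type*} [AddCommGroup W] [Module ℂ W] (q : ℂ) (e : ℕ → Module.End ℂ W)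
    (x : ℂ) (z : ℕ → ℂ) (l k : ℕ) :
    Bc q e x z l k = ((List.range' k l).reverse.map fun m => Rop q e (x / z m) m).prod := by
  induction l generalizing k with
  | zero => simp [Bc]
  | succ l ih => simp [Bc, ih, List.range'_succ]

theorem Cc_eq_prod {W : Type*} [AddCommGroup W] [Module ℂ W] (q : ℂ) (e : ℕ → Module.End ℂ W)
    (x : ℂ) (z : ℕ → ℂ) (l k : ℕ) :
    Cc q e x z l k = ((List.range' k l).map fun m => Rop q e (z m / x) m).prod := by
  induction l generalizing k with
  | zero => simp [Cc]
  | succ l ih => simp [Cc, ih, List.range'_succ]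

theorem toLin'_list_prod {ι : Type*} (l : List ι) (f : ι → SpinOp N) :
    Matrix.toLin' (l.map f).prod = (l.map fun i => Matrix.toLin' (f i)).prod := by
  induction l with
  | nil => simp [Matrix.toLin'_one]; rfl
  | cons a l ih => rw [List.map_cons, List.prod_cons, Matrix.toLin'_mul, ih]; simp; rfl

theorem pole_div {q x y : ℂ} (hy : y ≠ 0) (h : q * x - q⁻¹ * y ≠ 0) : q * (x / y) - q⁻¹ ≠ 0 := by
  rw [show q * (x / y) - q⁻¹ = (q * x - q⁻¹ * y) / y by field_simp]
  exact div_ne_zero h hy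

theorem toLin'_SL {q : ℂ} {z : ℕ → ℂ} (hz : Dist N z) (hP : NoPole q N z) (i j : Fin N) :
    Matrix.toLin' (SL q (fun m : Fin N => z m) i j) = SLop q (eAct ℂ q) z i j := by
  have hmem : ∀ m ∈ between i j, i < m ∧ m < j := by
    intro m hm; simpa [between] using hm
  rw [SL, SLop, Matrix.toLin'_mul, Matrix.toLin'_mul, toLin'_list_prod, toLin'_list_prod,
    toLin'_nn_eTL, Bc_eq_prod, Cc_eq_prod, ← map_between, ← List.map_reverse, List.map_map,
    List.map_map]
  have hj := j.isLt
  rw [List.map_congr_left (g := (fun m => Rop q (eAct ℂ q) (z j / z m) m) ∘ Fin.val)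
      (l := (between i j).reverse) fun m hm => ?_,
    List.map_congr_left (g := (fun m => Rop q (eAct ℂ q) (z m / z j) m) ∘ Fin.val)
      (l := between i j) fun m hm => ?_]
  · rfl
  · have := (hmem m hm).2; rw [Fin.lt_def] at this
    exact toLin'_nn_Rcheck (pole_div (hz.1 _ hj) (hP _ _ m.isLt hj (by omega))) (by omega)
  · have := (hmem m (by simpa using hm)).2; rw [Fin.lt_def] at this
    exact toLin'_nn_Rcheck (pole_div (hz.1 _ m.isLt) (hP _ _ hj m.isLt (by omega))) (by omega)

end SpinAction

/-! ### Evaluation of the difference operators on physical vectors -/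

section Charts

variable {N : ℕ}

/-- Evaluation of a vector with polynomial coefficients. -/
def evV (x : ℕ → ℂ) (Ψ : SpinPol N) : Spin N := fun s => evN x (Ψ s)

theorem evV_add (x : ℕ → ℂ) (Ψ Φ : SpinPol N) : evV x (Ψ + Φ) = evV x Ψ + evV x Φ := by
  funext s; exact evN_add _ _ _

theorem evV_sub (x : ℕ → ℂ) (Ψ Φ : SpinPol N) : evV x (Ψ - Φ) = evV x Ψ - evV x Φ := by
  funext s; exact evN_sub _ _ _

theorem evV_smul (x : ℕ → ℂ) (c : ℂ) (Ψ : SpinPol N) : evV x (c • Ψ) = c • evV x Ψ := by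
  funext s; exact evN_smul _ _ _

theorem evV_sum {ι : Type*} (t : Finset ι) (x : ℕ → ℂ) (Ψ : ι → SpinPol N) :
    evV x (∑ i ∈ t, Ψ i) = ∑ i ∈ t, evV x (Ψ i) := by
  funext s
  rw [evV, Finset.sum_apply, evN_sum, Finset.sum_apply]
  rfl

theorem evV_congr {x y : ℕ → ℂ} (h : ∀ k < N, x k = y k) (Ψ : SpinPol N) : evV x Ψ = evV y Ψ :=
  _root_.funext fun _ => evN_congr h _

theorem evV_eAct (x : ℕ → ℂ) (q : ℂ) {k : ℕ} (hk : k + 1 < N) (Ψ : SpinPol N) :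
    evV x (eAct (Pol N) q k Ψ) = eAct ℂ q k (evV x Ψ) := by
  funext s
  rw [eAct_apply q hk, evV, eAct_apply q hk]
  split_ifs
  · simp
  · rw [evN_sub, evN_smul]; rfl

theorem compLeft_eAct (A : Module.End ℂ (Pol N)) (q : ℂ) {k : ℕ} (hk : k + 1 < N)
    (Ψ : SpinPol N) : A.compLeft (Conf N) (eAct (Pol N) q k Ψ)
      = eAct (Pol N) q k (A.compLeft (Conf N) Ψ) := by
  funext s
  rw [eAct_apply q hk, LinearMap.compLeft_apply, Function.comp_apply, eAct_apply q hk]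
  split_ifs
  · simp
  · rw [map_sub, map_smul]; rfl

/-- A parametrisation `μ` of the coordinates in which the operator `T_{κ k}` acts as the `k`-th
Demazure–Lusztig operator. -/
structure IsChart (q : ℂ) (N : ℕ) (μ : (ℕ → ℂ) → ℕ → ℂ) (κ : ℕ → ℕ) : Prop where
  lt : ∀ k, k + 1 < N → κ k + 1 < N
  rel : ∀ z : ℕ → ℂ, (∀ k < N, z k ≠ 0) → ∀ k, k + 1 < N → ∀ F : Pol N,
    (z k - z (k + 1)) * evN (μ z) (Tpol q (κ k) F) = q * (z k - z (k + 1)) * evN (μ z) F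
      - (q * z k - q⁻¹ * z (k + 1)) * (evN (μ z) F - evN (μ (sw k z)) F)

theorem isChart_id {q : ℂ} (hq : q ≠ 0) (N : ℕ) : IsChart q N id id where
  lt _ h := h
  rel z _ _ hk F := evN_Tpol_mul hk q hq z F

/-- The reflection `z_k ↦ z_{N-1-k}⁻¹`. -/
def mir (N : ℕ) (z : ℕ → ℂ) : ℕ → ℂ := fun k => (z (N - 1 - k))⁻¹

theorem mir_mir {z : ℕ → ℂ} {k : ℕ} (hk : k < N) : mir N (mir N z) k = z k := by
  rw [mir, mir, inv_inv]; congr 1; omega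

theorem Dist.mir {z : ℕ → ℂ} (h : Dist N z) : Dist N (mir N z) := by
  refine ⟨fun k hk => inv_ne_zero (h.1 _ (by omega)), fun i j hi hj hij => ?_⟩
  have := h.2 _ _ (by omega) (by omega) (inv_injective hij)
  omega

/-- The coefficients satisfy `a(y⁻¹, x⁻¹) = a(x, y)`, so they survive inverting the coordinates
together with reversing their order. -/
theorem isChart_mir {q : ℂ} (hq : q ≠ 0) (N : ℕ) : IsChart q N (mir N) (fun k => N - 2 - k) where
  lt _ h := by omega
  rel z hz k hk F := by
    have h := evN_Tpol_mul (k := N - 2 - k) (by omega) q hq (mir N z) F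
    have e1 : mir N z (N - 2 - k) = (z (k + 1))⁻¹ := by rw [mir]; congr 2; omega
    have e2 : mir N z (N - 2 - k + 1) = (z k)⁻¹ := by rw [mir]; congr 2; omega
    have e3 : evN (sw (N - 2 - k) (mir N z)) F = evN (mir N (sw k z)) F := by
      refine evN_congr (fun m hm => ?_) F
      by_cases h1 : m = N - 2 - k
      · subst h1
        rw [sw_left, e2, mir, show N - 1 - (N - 2 - k) = k + 1 by omega, sw_right]
      by_cases h2 : m = N - 2 - k + 1
      · subst h2
        rw [sw_right, e1, mir, show N - 1 - (N - 2 - k + 1) = k by omega, sw_left]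
      rw [sw_of_ne _ h1 h2, mir, mir, sw_of_ne] <;> omega
    rw [e1, e2, e3] at h
    have h0 := hz k (by omega)
    have h0' := hz (k + 1) hk
    have c1 : z k * z (k + 1) * ((z (k + 1))⁻¹ - (z k)⁻¹) = z k - z (k + 1) := by
      field_simp
    have c2 : z k * z (k + 1) * (q * (z (k + 1))⁻¹ - q⁻¹ * (z k)⁻¹)
        = q * z k - q⁻¹ * z (k + 1) := by
      generalize q⁻¹ = r
      field_simp
    rw [← c1, ← c2]
    linear_combination z k * z (k + 1) * h

variable {q : ℂ} {μ : (ℕ → ℂ) → ℕ → ℂ} {κ : ℕ → ℕ}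

theorem IsChart.exch (h : IsChart q N μ κ) {Ψ : SpinPol N} (hΨ : IsPhysical q Ψ) :
    Exch q (fun k => eAct ℂ q (κ k)) N (fun y => evV (μ y) Ψ) := by
  intro z hz k hk
  have h1 := isPhysical_iff.mp hΨ (κ k) (h.lt k hk)
  have h2 := congrArg (evV (μ z)) h1
  rw [evV_sub, evV_smul, evV_eAct _ _ (h.lt k hk)] at h2
  funext s
  have h3 := h.rel z hz k hk (Ψ s)
  have h4 := congrFun h2 s
  simp only [evV, LinearMap.compLeft_apply, Function.comp_apply, Pi.sub_apply, Pi.smul_apply,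
    smul_eq_mul] at h4 ⊢
  rw [h4] at h3
  linear_combination -h3

/-! ### Hecke strings on physical vectors, traded for spin factors. -/

/-- `T_{κ i} T_{κ (i+1)} ⋯ T_{κ (i+d-1)}`. -/
def ascPol (N : ℕ) (q : ℂ) (κ : ℕ → ℕ) (i d : ℕ) : Module.End ℂ (Pol N) :=
  ((List.range' i d).map fun k => Tpol q (κ k)).prod

theorem IsChart.Gf_eq (h : IsChart q N μ κ) (G : SpinPol N) (d : ℕ) : ∀ i, i + d + 1 ≤ N →
    ∀ z, Dist N z → evV (μ z) ((ascPol N q κ i d).compLeft (Conf N) G)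
      = Gf q d i (fun y => evV (μ y) G) z := by
  induction d with
  | zero => intro i _ z _; simp [ascPol, Gf]; rfl
  | succ d ih =>
    intro i hi z hz
    have hk : i + 1 < N := by omega
    have e1 : (ascPol N q κ i (d + 1)).compLeft (Conf N) G
        = (Tpol q (κ i)).compLeft (Conf N) ((ascPol N q κ (i + 1) d).compLeft (Conf N) G) := by
      rw [ascPol, List.range'_succ, List.map_cons, List.prod_cons]; rfl
    rw [e1, Gf, Tf, ← ih (i + 1) (by omega) z hz, ← ih (i + 1) (by omega) _ (hz.sw hk)]
    set G' := (ascPol N q κ (i + 1) d).compLeft (Conf N) G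
    funext s
    have h3 := h.rel z hz.1 i hk (G' s)
    have hne := hz.ne (i := i) (j := i + 1) (by omega) hk (by omega)
    simp only [evV, LinearMap.compLeft_apply, Function.comp_apply, Pi.add_apply, Pi.smul_apply,
      smul_eq_mul]
    rw [← mul_right_inj' hne, h3]
    have : (z i - z (i + 1)) * aR q (z i) (z (i + 1)) = q * z i - q⁻¹ * z (i + 1) := by
      rw [aR, mul_div_cancel₀ _ hne]
    linear_combination (evN (μ z) (G' s) - evN (μ (sw i z)) (G' s)) * this

/-- `t_k⁻¹ = q⁻¹ - e_k` acting on the spins. -/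
def tauE (N : ℕ) (q : ℂ) (k : ℕ) : Module.End ℂ (SpinPol N) := q⁻¹ • 1 - eAct (Pol N) q k

theorem tauE_apply (k : ℕ) (Ψ : SpinPol N) :
    tauE N q k Ψ = q⁻¹ • Ψ - eAct (Pol N) q k Ψ := rfl

/-- `t_{κ (i+m-1)}⁻¹ ⋯ t_{κ i}⁻¹` acting on the spins. -/
def tauP (N : ℕ) (q : ℂ) (κ : ℕ → ℕ) : ℕ → ℕ → Module.End ℂ (SpinPol N)
  | _, 0 => 1
  | i, m + 1 => tauP N q κ (i + 1) m * tauE N q (κ i)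

theorem tauP_succ (i m : ℕ) :
    tauP N q κ i (m + 1) = tauE N q (κ (i + m)) * tauP N q κ i m := by
  induction m generalizing i with
  | zero => simp [tauP]
  | succ m ih =>
    rw [tauP, ih, tauP, mul_assoc, show i + 1 + m = i + (m + 1) by omega]

theorem compLeft_tau (A : Module.End ℂ (Pol N)) {k : ℕ} (hk : k + 1 < N) (Ψ : SpinPol N) :
    A.compLeft (Conf N) (tauE N q k Ψ)
      = tauE N q k (A.compLeft (Conf N) Ψ) := by
  rw [tauE_apply, tauE_apply, map_sub, map_smul, compLeft_eAct A q hk]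

theorem IsChart.compLeft_tauP (h : IsChart q N μ κ) (A : Module.End ℂ (Pol N)) (m : ℕ) :
    ∀ i, i + m + 1 ≤ N → ∀ Ψ : SpinPol N, A.compLeft (Conf N) (tauP N q κ i m Ψ)
      = tauP N q κ i m (A.compLeft (Conf N) Ψ) := by
  induction m with
  | zero => intro i _ Ψ; rfl
  | succ m ih =>
    intro i hi Ψ
    rw [tauP, Module.End.mul_apply, ih (i + 1) (by omega), Module.End.mul_apply,
      compLeft_tau A (h.lt i (by omega))]

theorem IsChart.Zf_eq (h : IsChart q N μ κ) (d : ℕ) : ∀ i, i + d = N → ∀ G : SpinPol N,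
    ∀ z, Dist N z → ∑ m ∈ Finset.range d,
        evV (μ z) ((ascPol N q κ (i + m) (d - 1 - m)).compLeft (Conf N) (tauP N q κ i m G))
      = Zf q (fun k => eAct ℂ q (κ k)) d i (fun y => evV (μ y) G) z := by
  induction d with
  | zero => intro i _ G z _; simp [Zf]
  | succ d ih =>
    intro i hi G z hz
    rw [Finset.sum_range_succ']
    change _ = Gf q d i (fun y => evV (μ y) G) z + Zf q (fun k => eAct ℂ q (κ k)) d (i + 1)
      (fun y => q⁻¹ • evV (μ y) G - eAct ℂ q (κ i) (evV (μ y) G)) z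
    rw [← h.Gf_eq G d i (by omega) z hz, add_comm]
    congr 1
    rcases Nat.eq_zero_or_pos d with rfl | hd
    · simp [Zf]
    have hG : (fun y => q⁻¹ • evV (μ y) G - eAct ℂ q (κ i) (evV (μ y) G))
        = fun y => evV (μ y) (tauE N q (κ i) G) := by
      funext y
      rw [← evV_eAct _ _ (h.lt i (by omega)), ← evV_smul, ← evV_sub]
      rfl
    rw [hG, ← ih (i + 1) (by omega) _ z hz]
    refine Finset.sum_congr rfl fun m _ => ?_
    rw [show i + (m + 1) = i + 1 + m by omega, show d + 1 - 1 - (m + 1) = d - 1 - m by omega]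
    rfl

theorem TpolInv_compLeft {Ψ : SpinPol N} (hΨ : IsPhysical q Ψ) {k : ℕ} (hk : k + 1 < N) :
    (TpolInv q k).compLeft (Conf N) Ψ
      = tauE N q k Ψ := by
  have h1 := isPhysical_iff.mp hΨ k hk
  have h2 : (TpolInv q k).compLeft (Conf N) Ψ
      = (Tpol q k).compLeft (Conf N) Ψ - (q - q⁻¹) • Ψ := rfl
  rw [h2, h1, tauE_apply]
  module

/-- Only a generator acting directly on the physical vector can be traded. Once traded it commutes
with the polynomial operators and moves to the left of them, so the order of the factors is
reversed. -/
theorem prod_TpolInv_compLeft {Ψ : SpinPol N} (hΨ : IsPhysical q Ψ) (m : ℕ)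
    (hm : m + 1 ≤ N) : (((List.range m).map (TpolInv q)).prod).compLeft (Conf N) Ψ
      = tauP N q id 0 m Ψ := by
  induction m with
  | zero => rfl
  | succ m ih =>
    rw [tauP_succ, List.range_succ, List.map_append, List.prod_append, List.map_cons, List.map_nil,
      List.prod_cons, List.prod_nil, mul_one, Module.End.mul_apply, ← ih (by omega)]
    have e : (((List.range m).map (TpolInv q)).prod * TpolInv q m).compLeft (Conf N) Ψ
        = (((List.range m).map (TpolInv q)).prod).compLeft (Conf N)
          ((TpolInv q m).compLeft (Conf N) Ψ) := rfl
    rw [e, TpolInv_compLeft hΨ (by omega), compLeft_tau _ (by omega)]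
    simp

theorem evV_cyc (p : ℂ) (x : ℕ → ℂ) (Ψ : SpinPol N) :
    evV x ((cyc p).compLeft (Conf N) Ψ) = evV (rot N p x) Ψ :=
  _root_.funext fun _ => evN_cyc _ _ _

theorem evV_cycInv_mir {p : ℂ} (y : ℕ → ℂ) (Ψ : SpinPol N) :
    evV (mir N y) ((cycInv p).compLeft (Conf N) Ψ) = evV (mir N (rot N p y)) Ψ := by
  have h1 : evV (mir N y) ((cycInv p).compLeft (Conf N) Ψ) = evV (rotInv N p (mir N y)) Ψ :=
    _root_.funext fun _ => evN_cycInv _ _ _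
  rw [h1]
  refine evV_congr (fun k hk => ?_) Ψ
  unfold rotInv mir rot
  rcases Nat.lt_or_ge (k + 1) N with h0 | h0
  · rw [if_pos h0, if_neg (by omega), if_pos (by omega)]
    congr 2
  · obtain rfl : N = k + 1 := by omega
    simp [mul_comm]

/-- The value of `e₁(Y) Ψ` for a physical vector. -/
theorem evV_esymmY_one (hq : q ≠ 0) (p : ℂ) {Ψ : SpinPol N} (hΨ : IsPhysical q Ψ) {z : ℕ → ℂ}
    (hz : Dist N z) : evV z ((esymmY q p 1).compLeft (Conf N) Ψ)
      = Zf q (eAct ℂ q) N 0 (fun y => evV (rot N p y) Ψ) z := by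
  have hc := isChart_id hq N
  have h1 := hc.Zf_eq N 0 (by simp) ((cyc p).compLeft (Conf N) Ψ) z hz
  have h2 : (esymmY q p 1 : Module.End ℂ (Pol N)) = ∑ i : Fin N, Y q p i := by
    rw [esymmY, Finset.powersetCard_one, Finset.sum_map]
    refine Finset.sum_congr rfl fun i _ => ?_
    simp
  have h3 : (esymmY q p 1).compLeft (Conf N) Ψ = ∑ i : Fin N, (Y q p i).compLeft (Conf N) Ψ := by
    rw [h2]
    funext s
    simp
  rw [h3, evV_sum]
  simp only [evV_cyc, id] at h1
  rw [← h1, ← Fin.sum_univ_eq_sum_range (fun m => evV z ((ascPol N q id (0 + m)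
    (N - 1 - m)).compLeft (Conf N) (tauP N q id 0 m ((cyc p).compLeft (Conf N) Ψ))))]
  refine Finset.sum_congr rfl fun i _ => ?_
  have hi := i.isLt
  have e : (Y q p i).compLeft (Conf N) Ψ = (ascPol N q id i (N - 1 - i)).compLeft (Conf N)
      ((cyc p).compLeft (Conf N) ((((List.range i).map (TpolInv q)).prod).compLeft (Conf N) Ψ)) :=
    rfl
  rw [e, prod_TpolInv_compLeft hΨ i (by omega), hc.compLeft_tauP _ i 0 (by omega), zero_add]

theorem descT_eq_prod {G : Type*} [Group G] (T : ℕ → G) (i : ℕ) : ∀ m,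
    descT T 0 i = ((List.range' m i).map fun k => T (m + i - 1 - k)).prod := by
  induction i with
  | zero => intro m; simp [descT]
  | succ i ih =>
    intro m
    rw [descT, List.range'_succ, List.map_cons, List.prod_cons, ih (m + 1), zero_add,
      show m + (i + 1) - 1 - m = i by omega]
    congr 2
    refine List.map_congr_left fun k _ => ?_
    congr 1; omega

theorem ascT_inv_compLeft (hq : q ≠ 0) {Ψ : SpinPol N} (hΨ : IsPhysical q Ψ) (m : ℕ) :
    ∀ i, i + m + 1 = N →
      (((ascT (TU N hq) i m)⁻¹ : (Module.End ℂ (Pol N))ˣ) : Module.End ℂ (Pol N)).compLeft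
        (Conf N) Ψ = tauP N q (fun k => N - 2 - k) 0 m Ψ := by
  induction m with
  | zero => intro i _; simp [ascT, tauP]; rfl
  | succ m ih =>
    intro i hi
    have e : (((ascT (TU N hq) i (m + 1))⁻¹ : (Module.End ℂ (Pol N))ˣ) :
          Module.End ℂ (Pol N)).compLeft (Conf N) Ψ
        = (((ascT (TU N hq) (i + 1) m)⁻¹ : (Module.End ℂ (Pol N))ˣ) :
          Module.End ℂ (Pol N)).compLeft (Conf N) ((TpolInv q i).compLeft (Conf N) Ψ) := by
      rw [ascT_succ, mul_inv_rev, Units.val_mul, coe_TU_inv hq (by omega)]; rfl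
    rw [e, TpolInv_compLeft hΨ (by omega), compLeft_tau _ (by omega), ih (i + 1) (by omega),
      tauP_succ, Module.End.mul_apply, show N - 2 - (0 + m) = i by omega]

/-- The value of `∑ Y_i⁻¹ Ψ` for a physical vector. -/
theorem evV_sum_Yinv (hq : q ≠ 0) {p : ℂ} (hp : p ≠ 0) {Ψ : SpinPol N} (hΨ : IsPhysical q Ψ)
    {z : ℕ → ℂ} (hz : Dist N z) :
    evV (mir N z) ((∑ i : Fin N, Yinv hq hp i).compLeft (Conf N) Ψ)
      = Zf q (fun k => eAct ℂ q (N - 2 - k)) N 0 (fun y => evV (mir N (rot N p y)) Ψ) z := by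
  have hc := isChart_mir hq N
  have h1 := hc.Zf_eq N 0 (by simp) ((cycInv p).compLeft (Conf N) Ψ) z hz
  have h3 : (∑ i : Fin N, Yinv hq hp i).compLeft (Conf N) Ψ
      = ∑ i : Fin N, (Yinv hq hp i).compLeft (Conf N) Ψ := by
    funext s
    simp
  rw [h3, evV_sum]
  simp only [evV_cycInv_mir] at h1
  rw [← h1, ← Fin.sum_univ_eq_sum_range (fun m => evV (mir N z) ((ascPol N q (fun k => N - 2 - k)
    (0 + m) (N - 1 - m)).compLeft (Conf N) (tauP N q (fun k => N - 2 - k) 0 m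
      ((cycInv p).compLeft (Conf N) Ψ)))), ← Equiv.sum_comp Fin.revPerm]
  refine Finset.sum_congr rfl fun i _ => ?_
  have hi := i.isLt
  have hrev : ((Fin.revPerm i : Fin N) : ℕ) = N - 1 - i := by
    rw [Fin.revPerm_apply, Fin.val_rev]; omega
  -- The inverse is `Y_i⁻¹ = T_{i-1} ⋯ T_0 π⁻¹ T_{N-2}⁻¹ ⋯ T_i⁻¹`. Read through `k ↦ N - 2 - k` its
  -- descending string is ascending, and `Y_i⁻¹` acquires the shape of a `Y`.
  have hdesc : ((descT (TU N hq) 0 (N - 1 - i) : (Module.End ℂ (Pol N))ˣ) :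
      Module.End ℂ (Pol N)) = ascPol N q (fun k => N - 2 - k) i (N - 1 - i) := by
    rw [descT_eq_prod _ _ i, ascPol]
    refine coe_list_prod_map _ _ _ fun k hk => ?_
    rw [List.mem_range'_1] at hk
    rw [coe_TU hq (by omega)]
    congr 1; omega
  have e : (Yinv hq hp (Fin.revPerm i)).compLeft (Conf N) Ψ
      = (ascPol N q (fun k => N - 2 - k) i (N - 1 - i)).compLeft (Conf N)
        ((cycInv p).compLeft (Conf N)
          ((((ascT (TU N hq) (N - 1 - i) i)⁻¹ : (Module.End ℂ (Pol N))ˣ) :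
            Module.End ℂ (Pol N)).compLeft (Conf N) Ψ)) := by
    rw [Yinv, hrev, affY, prod_inv_eq_descT, mul_inv_rev, mul_inv_rev, inv_inv, Units.val_mul,
      Units.val_mul, hdesc, show N - 1 - (N - 1 - (i : ℕ)) = i by omega]
    rfl
  rw [e, ascT_inv_compLeft hq hΨ i _ (by omega), hc.compLeft_tauP _ i 0 (by omega), zero_add]

end Charts

/-! ### Physical vectors with prescribed values -/

section Surjectivity

variable {N : ℕ}

/-- The position sum of the down spins. -/
def energy (s : Conf N) : ℕ := ∑ i : Fin N, (i : ℕ) * (s i : ℕ)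

/-- The number of down spins. -/
def wt (s : Conf N) : ℕ := ∑ i, (s i : ℕ)

theorem energy_swConf {k : ℕ} (hk : k + 1 < N) {s : Conf N} (h0 : s ⟨k, by omega⟩ = 0)
    (h1 : s ⟨k + 1, hk⟩ = 1) : energy (swConf k hk s) + 1 = energy s := by
  have hab : (⟨k, by omega⟩ : Fin N) ≠ ⟨k + 1, hk⟩ := by simp [Fin.ext_iff]
  have e1 : energy (swConf k hk s) = ∑ i : Fin N,
      ((Equiv.swap (⟨k, by omega⟩ : Fin N) ⟨k + 1, hk⟩ i : Fin N) : ℕ) * (s i : ℕ) := by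
    rw [energy, ← Equiv.sum_comp (Equiv.swap (⟨k, by omega⟩ : Fin N) ⟨k + 1, hk⟩)]
    simp [swConf]
  rw [e1, energy, ← Finset.add_sum_erase _ _ (Finset.mem_univ (⟨k + 1, hk⟩ : Fin N)),
    ← Finset.add_sum_erase _ (fun i : Fin N => (i : ℕ) * (s i : ℕ))
      (Finset.mem_univ (⟨k + 1, hk⟩ : Fin N))]
  have e2 : ∑ i ∈ Finset.univ.erase (⟨k + 1, hk⟩ : Fin N),
      ((Equiv.swap (⟨k, by omega⟩ : Fin N) ⟨k + 1, hk⟩ i : Fin N) : ℕ) * (s i : ℕ)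
      = ∑ i ∈ Finset.univ.erase (⟨k + 1, hk⟩ : Fin N), (i : ℕ) * (s i : ℕ) := by
    refine Finset.sum_congr rfl fun i hi => ?_
    by_cases h : i = ⟨k, by omega⟩
    · subst h; simp [h0]
    · rw [Equiv.swap_apply_of_ne_of_ne h (Finset.ne_of_mem_erase hi)]
  rw [e2]
  simp [h1]
  omega

open Classical in
/-- The components of the physical vector generated by the polynomials `F M` in the sectors with
`M` down spins. -/
def psi (q : ℂ) (F : ℕ → Pol N) (s : Conf N) : Pol N :=
  -- An arbitrary neighbouring pair `↑↓` is chosen, and exchanging it lowers the energy. The result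
  -- does not depend on the choice (`psi_descent`); the recursion ends at configurations with all
  -- down spins on the left.
  if h : ∃ k, ∃ hk : k + 1 < N, s ⟨k, by omega⟩ = 0 ∧ s ⟨k + 1, hk⟩ = 1 then
    Tpol q h.choose (psi q F (swConf h.choose h.choose_spec.choose s))
  else F (wt s)
termination_by energy s
decreasing_by
  have := energy_swConf h.choose_spec.choose h.choose_spec.choose_spec.1
    h.choose_spec.choose_spec.2
  omega

variable {q : ℂ} {F : ℕ → Pol N}

theorem psi_of_not (s : Conf N)
    (h : ¬ ∃ k, ∃ hk : k + 1 < N, s ⟨k, by omega⟩ = 0 ∧ s ⟨k + 1, hk⟩ = 1) :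
    psi q F s = F (wt s) := by
  rw [psi, dif_neg h]

theorem exists_psi_eq (s : Conf N)
    (h : ∃ k, ∃ hk : k + 1 < N, s ⟨k, by omega⟩ = 0 ∧ s ⟨k + 1, hk⟩ = 1) :
    ∃ k, ∃ hk : k + 1 < N, s ⟨k, by omega⟩ = 0 ∧ s ⟨k + 1, hk⟩ = 1 ∧
      psi q F s = Tpol q k (psi q F (swConf k hk s)) := by
  refine ⟨h.choose, h.choose_spec.choose, h.choose_spec.choose_spec.1,
    h.choose_spec.choose_spec.2, ?_⟩
  conv_lhs => rw [psi, dif_pos h]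

/-- Two distinct pairs `↑↓` cannot overlap, so the corresponding generators commute. By induction on
the energy both choices lead to the same vector. -/
theorem psi_descent (hq : q ≠ 0) (n : ℕ) : ∀ (s : Conf N), energy s = n → ∀ k, ∀ hk : k + 1 < N,
    s ⟨k, by omega⟩ = 0 → s ⟨k + 1, hk⟩ = 1 →
      psi q F s = Tpol q k (psi q F (swConf k hk s)) := by
  induction n using Nat.strong_induction_on with
  | _ n ih =>
  intro s hs k hk h0 h1
  obtain ⟨l, hl, l0, l1, hl'⟩ := exists_psi_eq (q := q) (F := F) s ⟨k, hk, h0, h1⟩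
  have key : ∀ k l, ∀ hk : k + 1 < N, ∀ hl : l + 1 < N, k + 1 < l →
      s ⟨k, by omega⟩ = 0 → s ⟨k + 1, hk⟩ = 1 → s ⟨l, by omega⟩ = 0 → s ⟨l + 1, hl⟩ = 1 →
      Tpol q l (psi q F (swConf l hl s)) = Tpol q k (psi q F (swConf k hk s)) := by
    intro k l hk hl hkl h0 h1 l0 l1
    have el := energy_swConf hl l0 l1
    have ek := energy_swConf hk h0 h1
    rw [ih (energy (swConf l hl s)) (by omega) _ rfl k hk
        (by rw [swConf_of_ne hl _ (by simp; omega) (by simp; omega)]; exact h0)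
        (by rw [swConf_of_ne hl _ (by simp; omega) (by simp; omega)]; exact h1),
      ih (energy (swConf k hk s)) (by omega) _ rfl l hl
        (by rw [swConf_of_ne hk _ (by simp; omega) (by simp; omega)]; exact l0)
        (by rw [swConf_of_ne hk _ (by simp; omega) (by simp; omega)]; exact l1),
      swConf_comm hk hl hkl]
    exact (LinearMap.congr_fun (Tpol_comm hkl hl hq).eq _).symm
  rw [hl']
  rcases lt_trichotomy k l with h | rfl | h
  · have : k + 1 ≠ l := by rintro rfl; rw [h1] at l0; exact absurd l0 (by decide)
    exact key k l hk hl (by omega) h0 h1 l0 l1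
  · rfl
  · have : l + 1 ≠ k := by rintro rfl; rw [l1] at h0; exact absurd h0 (by decide)
    exact (key l k hl hk (by omega) l0 l1 h0 h1).symm

theorem antitone_of_not_descent (s : Conf N)
    (h : ¬ ∃ k, ∃ hk : k + 1 < N, s ⟨k, by omega⟩ = 0 ∧ s ⟨k + 1, hk⟩ = 1) {i j : ℕ} (hij : i ≤ j)
    (hj : j < N) (hi0 : s ⟨i, by omega⟩ = 0) : s ⟨j, hj⟩ = 0 := by
  induction j, hij using Nat.le_induction with
  | base => exact hi0
  | succ j hij ih =>
    have h1 := ih (by omega) hi0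
    by_contra h2
    exact h ⟨j, hj, h1, by omega⟩

/-- Without a pair `↑↓` the down spins fill exactly the places below `wt s`, so equal neighbours
never straddle the boundary between `wt s - 1` and `wt s`. -/
theorem wt_ne_of_not_descent (s : Conf N)
    (h : ¬ ∃ k, ∃ hk : k + 1 < N, s ⟨k, by omega⟩ = 0 ∧ s ⟨k + 1, hk⟩ = 1) {k : ℕ} (hk : k + 1 < N)
    (hs : s ⟨k, by omega⟩ = s ⟨k + 1, hk⟩) : k + 1 ≠ wt s := by
  obtain h0 | h0 : s ⟨k, by omega⟩ = 0 ∨ s ⟨k, by omega⟩ = 1 := by omega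
  · have h1 : wt s = ∑ i ∈ Finset.Iio (⟨k, by omega⟩ : Fin N), (s i : ℕ) := by
      rw [wt]
      symm
      refine Finset.sum_subset (Finset.subset_univ _) fun i _ hi => ?_
      rw [Finset.mem_Iio, not_lt, Fin.le_def] at hi
      rw [antitone_of_not_descent s h hi i.isLt h0]; rfl
    have h2 : ∑ i ∈ Finset.Iio (⟨k, by omega⟩ : Fin N), (s i : ℕ)
        ≤ (Finset.Iio (⟨k, by omega⟩ : Fin N)).card • 1 :=
      Finset.sum_le_card_nsmul _ _ _ fun i _ => by have := (s i).isLt; omega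
    rw [Fin.card_Iio, smul_eq_mul, mul_one] at h2
    simp only at h2
    omega
  · have h1 : ∀ i ≤ (⟨k + 1, hk⟩ : Fin N), s i = 1 := by
      intro i hi
      by_contra h2
      have h3 := antitone_of_not_descent s h (Fin.le_def.mp hi) hk
        (show s ⟨i, _⟩ = 0 by simp only [Fin.eta]; omega)
      rw [← hs, h0] at h3
      exact absurd h3 (by decide)
    have h2 : ∑ i ∈ Finset.Iic (⟨k + 1, hk⟩ : Fin N), (s i : ℕ) ≤ wt s :=
      Finset.sum_le_sum_of_subset (Finset.subset_univ _)
    rw [Finset.sum_congr rfl fun i hi => by rw [h1 i (Finset.mem_Iic.mp hi)]] at h2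
    simp [Fin.card_Iic] at h2
    omega

/-- If some pair `↑↓` is disjoint from the equal pair, the generators commute. In the patterns `↑↑↓`
and `↑↓↓` the braid relation carries the equal pair past the third spin, where the energy is
smaller. Sorted configurations are covered by the symmetry of `F`. -/
theorem psi_equal (hq : q ≠ 0)
    (hF : ∀ k M, k + 1 < N → k + 1 ≠ M → Tpol q k (F M) = q • F M) (n : ℕ) :
    ∀ (s : Conf N), energy s = n → ∀ k, ∀ hk : k + 1 < N,
      s ⟨k, by omega⟩ = s ⟨k + 1, hk⟩ → Tpol q k (psi q F s) = q • psi q F s := by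
  induction n using Nat.strong_induction_on with
  | _ n ih =>
  intro s hs k hk hkk
  by_cases hd : ∃ k, ∃ hk : k + 1 < N, s ⟨k, by omega⟩ = 0 ∧ s ⟨k + 1, hk⟩ = 1
  swap
  · rw [psi_of_not s hd]
    exact hF k _ hk (wt_ne_of_not_descent s hd hk hkk)
  obtain ⟨l, hl, l0, l1⟩ := hd
  have el := energy_swConf hl l0 l1
  have hfar : k + 1 < l ∨ l + 1 < k → Tpol q k (psi q F s) = q • psi q F s := by
    intro hkl
    have hc : (Tpol q k * Tpol q l : Module.End ℂ (Pol N)) = Tpol q l * Tpol q k := by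
      rcases hkl with h | h
      · exact Tpol_comm h hl hq
      · exact (Tpol_comm h hk hq).symm
    rw [psi_descent hq _ s rfl l hl l0 l1]
    have := LinearMap.congr_fun hc (psi q F (swConf l hl s))
    rw [Module.End.mul_apply, Module.End.mul_apply] at this
    rw [this, ih _ (by omega) (swConf l hl s) rfl k hk, map_smul]
    rw [swConf_of_ne hl _ (by simp; omega) (by simp; omega),
      swConf_of_ne hl _ (by simp; omega) (by simp; omega), hkk]
  have hne : k ≠ l := by rintro rfl; rw [l0, l1] at hkk; exact absurd hkk (by decide)
  rcases Nat.lt_or_ge (k + 1) l with h | h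
  · exact hfar (Or.inl h)
  rcases Nat.lt_or_ge (l + 1) k with h' | h'
  · exact hfar (Or.inr h')
  rcases Nat.lt_or_ge k l with h2 | h2
  · obtain rfl : l = k + 1 := by omega
    have k0 : s ⟨k, by omega⟩ = 0 := hkk.trans l0
    have a0 : swConf (k + 1) hl s ⟨k, by omega⟩ = 0 := by
      rw [swConf_of_ne hl _ (by simp) (by simp; omega)]; exact k0
    have a1 : swConf (k + 1) hl s ⟨k + 1, hk⟩ = 1 := by rw [swConf_left]; exact l1
    have a2 : swConf (k + 1) hl s ⟨k + 1 + 1, hl⟩ = 0 := by rw [swConf_right]; exact l0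
    have ek := energy_swConf hk a0 a1
    have hI := ih _ (by omega) (swConf k hk (swConf (k + 1) hl s)) rfl (k + 1) hl (by
      rw [swConf_right, swConf_of_ne hk _ (by simp; omega) (by simp), a0, a2])
    have hb := LinearMap.congr_fun (Tpol_braid (N := N) hl hq)
      (psi q F (swConf k hk (swConf (k + 1) hl s)))
    simp only [Module.End.mul_apply] at hb
    rw [psi_descent hq _ s rfl (k + 1) hl l0 l1, psi_descent hq _ _ rfl k hk a0 a1, hb, hI,
      map_smul, map_smul]
  · obtain rfl : k = l + 1 := by omega
    have k1 : s ⟨l + 1 + 1, hk⟩ = 1 := hkk.symm.trans l1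
    have a0 : swConf l hl s ⟨l + 1, hl⟩ = 0 := by rw [swConf_right]; exact l0
    have a1 : swConf l hl s ⟨l + 1 + 1, hk⟩ = 1 := by
      rw [swConf_of_ne hl _ (by simp; omega) (by simp)]; exact k1
    have a2 : swConf l hl s ⟨l, by omega⟩ = 1 := by rw [swConf_left]; exact l1
    have ek := energy_swConf hk a0 a1
    have hI := ih _ (by omega) (swConf (l + 1) hk (swConf l hl s)) rfl l hl (by
      rw [swConf_left, swConf_of_ne hk _ (by simp) (by simp; omega), a1, a2])
    have hb := LinearMap.congr_fun (Tpol_braid (N := N) hk hq)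
      (psi q F (swConf (l + 1) hk (swConf l hl s)))
    simp only [Module.End.mul_apply] at hb
    rw [psi_descent hq _ s rfl l hl l0 l1, psi_descent hq _ _ rfl (l + 1) hk a0 a1, ← hb, hI,
      map_smul, map_smul]

theorem isPhysical_psi (hq : q ≠ 0)
    (hF : ∀ k M, k + 1 < N → k + 1 ≠ M → Tpol q k (F M) = q • F M) : IsPhysical q (psi q F) := by
  rw [isPhysical_iff]
  intro k hk
  funext s
  rw [LinearMap.compLeft_apply, Function.comp_apply, Pi.sub_apply, Pi.smul_apply,
    eAct_apply q hk]
  split_ifs with h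
  · rw [sub_zero]; exact psi_equal hq hF _ s rfl k hk h
  obtain h0 | h0 : s ⟨k, by omega⟩ = 0 ∨ s ⟨k, by omega⟩ = 1 := by omega
  · have h1 : s ⟨k + 1, hk⟩ = 1 := by
      by_contra h1; exact h (h0.trans (by omega))
    have hd := psi_descent (F := F) hq _ s rfl k hk h0 h1
    have h2 := LinearMap.congr_fun (Tpol_mul_self hk hq) (psi q F (swConf k hk s))
    simp only [Module.End.mul_apply, LinearMap.add_apply, LinearMap.smul_apply,
      Module.End.one_apply] at h2
    rw [← hd] at h2
    rw [h2, h0, eWt, if_pos rfl]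
    module
  · have h1 : s ⟨k + 1, hk⟩ = 0 := by
      by_contra h1; exact h (h0.trans (by omega))
    have hd := psi_descent (F := F) hq _ (swConf k hk s) rfl k hk
      (by rw [swConf_left]; exact h1) (by rw [swConf_right]; exact h0)
    rw [swConf_swConf] at hd
    rw [← hd, h0, eWt, if_neg (by decide)]
    module

/-- The configuration with the first `M` spins down. -/
def stdConf (N M : ℕ) : Conf N := fun i => if (i : ℕ) < M then 1 else 0

theorem psi_stdConf {M : ℕ} (hM : M ≤ N) : psi q F (stdConf N M) = F M := by
  rw [psi_of_not]
  · congr 1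
    rw [wt]
    have : ∀ i : Fin N, ((stdConf N M i : Fin 2) : ℕ) = if (i : ℕ) < M then 1 else 0 := by
      intro i; unfold stdConf; split_ifs <;> rfl
    rw [Finset.sum_congr rfl fun i _ => this i,
      Fin.sum_univ_eq_sum_range (fun i => if i < M then 1 else 0) N, Finset.sum_boole]
    simp only [Nat.cast_id]
    rw [show (Finset.range N).filter (· < M) = Finset.range M by ext; simp; omega,
      Finset.card_range]
  · rintro ⟨k, hk, h0, h1⟩
    simp only [stdConf] at h0 h1
    split_ifs at h0 h1 <;> omega

theorem wt_le (s : Conf N) : wt s ≤ N := by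
  have : ∑ i : Fin N, (s i : ℕ) ≤ (Finset.univ : Finset (Fin N)).card • 1 :=
    Finset.sum_le_card_nsmul _ _ _ fun i _ => by have := (s i).isLt; omega
  simpa [wt] using this

/-- The physical vectors. -/
def physSub (N : ℕ) (q : ℂ) : Submodule ℂ (SpinPol N) where
  carrier := {Ψ | IsPhysical q Ψ}
  add_mem' {Ψ Φ} h1 h2 := by
    rw [Set.mem_ofPred_eq, isPhysical_iff] at *
    intro k hk
    rw [map_add, map_add, h1 k hk, h2 k hk, smul_add]; abel
  zero_mem' := by
    rw [Set.mem_ofPred_eq, isPhysical_iff]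
    intro k hk; simp
  smul_mem' c Ψ h := by
    rw [Set.mem_ofPred_eq, isPhysical_iff] at *
    intro k hk
    rw [map_smul, map_smul, h k hk, smul_sub, smul_comm]

theorem mem_physSub {Ψ : SpinPol N} : Ψ ∈ physSub N q ↔ IsPhysical q Ψ := Iff.rfl

/-- A physical vector which vanishes at a point without poles vanishes on its orbit. -/
theorem evV_perm_eq_zero (hq : q ≠ 0) {Ψ : SpinPol N} (hΨ : IsPhysical q Ψ) {x : ℕ → ℂ}
    (hx : Dist N x) (hP : NoPole q N x) (h0 : evV x Ψ = 0) (σ : Equiv.Perm (Fin N)) :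
    ∀ y : ℕ → ℂ, (∀ i : Fin N, y i = x (σ i)) → evV y Ψ = 0 := by
  rcases N with _ | n
  · intro y _
    rw [← h0]; exact evV_congr (fun k hk => by omega) Ψ
  have hmem : σ ∈ Submonoid.closure
      (Set.range fun i : Fin n => Equiv.swap i.castSucc i.succ) := by
    rw [Equiv.Perm.mclosure_swap_castSucc_succ]; trivial
  induction hmem using Submonoid.closure_induction_right with
  | one => intro y hy; rw [← h0]; exact evV_congr (fun k hk => hy ⟨k, hk⟩) Ψ
  | mul_right τ _ g hg ih =>
    obtain ⟨i, rfl⟩ := hg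
    intro y hy
    have hi := i.isLt
    have hk : (i : ℕ) + 1 < n + 1 := by omega
    have hτ : ∀ j : Fin (n + 1), sw i y j = x (τ j) := by
      intro j
      by_cases h1 : j = i.castSucc
      · subst h1
        have := hy i.succ
        simpa using this
      by_cases h2 : j = i.succ
      · subst h2
        have := hy i.castSucc
        simpa using this
      · have := hy j
        rw [Equiv.Perm.mul_apply, Equiv.swap_apply_of_ne_of_ne h1 h2] at this
        rw [sw_of_ne, this]
        · intro h; exact h1 (Fin.ext h)
        · intro h; exact h2 (Fin.ext h)
    have hz := ih _ hτ
    have hnz : ∀ k < n + 1, sw i y k ≠ 0 := fun k hk => by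
      rw [hτ ⟨k, hk⟩]; exact hx.1 _ (τ _).isLt
    -- The exchange relation is used at the swapped point, where `Ψ` already vanishes. It leaves `Ψ
    -- y` times a factor that is nonzero because `x` has no poles.
    have hE := (isChart_id hq (n + 1)).exch hΨ (sw i y) hnz i hk
    simp only [id, sw_sw, hz, map_zero, smul_zero, sub_zero] at hE
    refine (smul_eq_zero.mp hE).resolve_left ?_
    have e1 := hτ i.castSucc
    have e2 := hτ i.succ
    rw [Fin.val_castSucc] at e1
    rw [Fin.val_succ] at e2
    rw [e1, e2]
    refine hP _ _ (τ _).isLt (τ _).isLt fun h => ?_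
    have := τ.injective (Fin.ext h)
    simp [Fin.ext_iff] at this

/-! ### Interpolation at a point without poles. -/

/-- The polynomial separating the configuration `s` on the orbit of `x`. -/
def sepPol (x : ℕ → ℂ) (s : Conf N) (M : ℕ) : Pol N :=
  if M = wt s then ∏ k : Fin N, if (k : ℕ) < M then
    ∏ i ∈ Finset.univ.filter (fun i => s i = 0), (X k - C (x i)) else 1
  else 0

theorem evN_sepPol (x y : ℕ → ℂ) (s : Conf N) : evN y (sepPol x s (wt s))
    = ∏ k ∈ Finset.range (wt s), ∏ i ∈ Finset.univ.filter (fun i => s i = 0), (y k - x i) := by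
  have h : ∀ k : Fin N, evN y (if (k : ℕ) < wt s then
      ∏ i ∈ Finset.univ.filter (fun i => s i = 0), (X k - C (x i)) else 1 : Pol N)
      = if (k : ℕ) < wt s then ∏ i ∈ Finset.univ.filter (fun i => s i = 0), (y k - x i) else 1 := by
    intro k
    split_ifs
    · simp [evN, map_prod]
    · exact map_one _
  rw [sepPol, if_pos rfl, evN, map_prod]
  refine (Finset.prod_congr rfl fun k _ => h k).trans ?_
  rw [Fin.prod_univ_eq_prod_range (fun k => if k < wt s then
    ∏ i ∈ Finset.univ.filter (fun i => s i = 0), (y k - x i) else 1) N, ← Finset.prod_filter]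
  refine Finset.prod_congr ?_ fun _ _ => rfl
  have := wt_le s
  ext; simp; omega

/-- The polynomial is symmetric in the first `wt s` coordinates and does not involve the others; the
only exchange that can change it is the one across this boundary. -/
theorem Tpol_sepPol (hq : q ≠ 0) (x : ℕ → ℂ) (s : Conf N) (k M : ℕ) (hk : k + 1 < N)
    (hM : k + 1 ≠ M) : Tpol q k (sepPol x s M) = q • sepPol x s M := by
  by_cases hMs : M = wt s
  swap
  · rw [sepPol, if_neg hMs, map_zero, smul_zero]
  subst hMs
  refine ext_of_evN fun z hz => ?_
  rw [evN_Tpol hk q hq (hz.ne (by omega) hk (by omega)), evN_smul]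
  have : evN (sw k z) (sepPol x s (wt s)) = evN z (sepPol x s (wt s)) := by
    rw [evN_sepPol, evN_sepPol]
    refine Finset.prod_equiv (Equiv.swap k (k + 1)) (fun m => ?_) fun m _ => rfl
    rw [Finset.mem_range, Finset.mem_range, Equiv.swap_apply_def]
    split_ifs <;> omega
  rw [this]; ring

/-- A linear relation gives a physical vector vanishing at `x`, hence on the whole orbit of `x`. At
the permuted point whose first `wt s` coordinates are the `x_i` with `s_i = 1`, the component at
`stdConf N (wt s)` isolates the coefficient `c s`. -/
theorem linearIndependent_evV (hq : q ≠ 0) {x : ℕ → ℂ} (hx : Dist N x) (hP : NoPole q N x) :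
    LinearIndependent ℂ fun s : Conf N => evV x (psi q (sepPol x s)) := by
  rw [Fintype.linearIndependent_iff]
  intro c hc s
  set Ψ : SpinPol N := ∑ t, c t • psi q (sepPol x t) with hΨ
  have hphys : IsPhysical q Ψ := by
    rw [← mem_physSub]
    exact Submodule.sum_mem _ fun t _ => Submodule.smul_mem _ _
      (isPhysical_psi hq (Tpol_sepPol hq x t))
  have h0 : evV x Ψ = 0 := by
    rw [hΨ, evV_sum, ← hc]
    exact Finset.sum_congr rfl fun t _ => evV_smul _ _ _
  have hcard : ∀ t : Conf N, Fintype.card {i : Fin N // t i = 1} = wt t := by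
    intro t
    rw [Fintype.card_subtype, Finset.card_filter, wt]
    refine Finset.sum_congr rfl fun i _ => ?_
    obtain h | h : t i = 0 ∨ t i = 1 := by omega
    all_goals simp [h]
  have hcard' : Fintype.card {i : Fin N // (i : ℕ) < wt s} = wt s := by
    rw [Fintype.card_subtype, Finset.card_filter,
      Fin.sum_univ_eq_sum_range (fun i => if i < wt s then 1 else 0) N, Finset.sum_boole]
    have := wt_le s
    rw [show (Finset.range N).filter (· < wt s) = Finset.range (wt s) by ext; simp; omega]
    simp
  set τ : {i : Fin N // (i : ℕ) < wt s} ≃ {i : Fin N // s i = 1} :=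
    Fintype.equivOfCardEq (hcard'.trans (hcard s).symm)
  set σ := τ.extendSubtype with hσ
  set y : ℕ → ℂ := fun k => if h : k < N then x (σ ⟨k, h⟩) else 0 with hy
  have hy' : ∀ i : Fin N, y i = x (σ i) := fun i => by simp [hy]
  have h1 := congrFun (evV_perm_eq_zero hq hphys hx hP h0 σ y hy') (stdConf N (wt s))
  have h2 : evN y (Ψ (stdConf N (wt s))) = ∑ t, c t * evN y (sepPol x t (wt s)) := by
    rw [hΨ, Finset.sum_apply, evN_sum]
    refine Finset.sum_congr rfl fun t _ => ?_
    rw [Pi.smul_apply, evN_smul, psi_stdConf (wt_le s)]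
  rw [evV, h2, Pi.zero_apply, Finset.sum_eq_single s] at h1
  · refine (mul_eq_zero.mp h1).resolve_right ?_
    rw [evN_sepPol]
    refine Finset.prod_ne_zero_iff.mpr fun k hk => Finset.prod_ne_zero_iff.mpr fun i hi => ?_
    have hkw := Finset.mem_range.mp hk
    have hkN : k < N := lt_of_lt_of_le hkw (wt_le s)
    have h3 := τ.extendSubtype_mem ⟨k, hkN⟩ hkw
    rw [hy' ⟨k, hkN⟩]
    refine hx.ne (σ _).isLt i.isLt fun h => ?_
    rw [Finset.mem_filter] at hi
    rw [← hσ, Fin.ext h, hi.2] at h3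
    exact absurd h3 (by decide)
  · intro t _ hts
    by_cases hw : wt s = wt t
    swap
    · rw [sepPol, if_neg hw, evN_zero, mul_zero]
    -- Distinct configurations with equally many down spins: some `i` is up in `t` and down in `s`,
    -- so `x_i` occurs among the first coordinates of `y` and kills a factor of the polynomial of
    -- `t`.
    have hex : ∃ i, t i = 0 ∧ s i = 1 := by
      by_contra hne
      push Not at hne
      apply hts
      have hsub : (Finset.univ.filter fun i => s i = 1) ⊆ Finset.univ.filter fun i => t i = 1 := by
        intro i hi
        rw [Finset.mem_filter] at hi ⊢
        refine ⟨hi.1, ?_⟩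
        by_contra h
        exact hne i (by omega) hi.2
      have heq := Finset.eq_of_subset_of_card_le hsub (by
        rw [← Fintype.card_subtype, ← Fintype.card_subtype, hcard, hcard, hw])
      funext i
      have := Finset.ext_iff.mp heq i
      simp only [Finset.mem_filter, Finset.mem_univ, true_and] at this
      omega
    obtain ⟨i, ht, hs⟩ := hex
    rw [hw, evN_sepPol, Finset.prod_eq_zero (i := ((σ.symm i : Fin N) : ℕ)), mul_zero]
    · rw [Finset.mem_range, ← hw]
      by_contra h
      have := τ.extendSubtype_not_mem (σ.symm i) h
      rw [← hσ, Equiv.apply_symm_apply] at this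
      exact this hs
    · refine Finset.prod_eq_zero (i := i) (by simp [ht]) ?_
      rw [hy', Equiv.apply_symm_apply, sub_self]
  · intro h; exact absurd (Finset.mem_univ s) h

/-- The values of the physical vectors at a point without poles exhaust the spin space. -/
theorem exists_isPhysical_evV_eq (hq : q ≠ 0) {x : ℕ → ℂ} (hx : Dist N x) (hP : NoPole q N x)
    (v : Spin N) : ∃ Ψ : SpinPol N, IsPhysical q Ψ ∧ evV x Ψ = v := by
  have hspan := (linearIndependent_evV hq hx hP).span_eq_top_of_card_eq_finrank (by simp)
  have hv : v ∈ Submodule.span ℂ (Set.range fun s : Conf N => evV x (psi q (sepPol x s))) := by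
    rw [hspan]; trivial
  obtain ⟨c, hc⟩ := (Submodule.mem_span_range_iff_exists_fun ℂ).mp hv
  refine ⟨∑ t, c t • psi q (sepPol x t), ?_, ?_⟩
  · rw [← mem_physSub]
    exact Submodule.sum_mem _ fun t _ => Submodule.smul_mem _ _
      (isPhysical_psi hq (Tpol_sepPol hq x t))
  · rw [evV_sum, ← hc]
    exact Finset.sum_congr rfl fun t _ => evV_smul _ _ _

end Surjectivity

/-! ### Evaluation at the roots of unity -/

section RootsOfUnity

variable {N : ℕ} {q : ℂ}

/-- The `N`-th roots of unity, as coordinates. -/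
def zev (N : ℕ) : ℕ → ℂ := fun k => Complex.exp (2 * Real.pi * Complex.I / N) ^ (k + 1)

theorem ev_eq_evV (Ψ : SpinPol N) : ev Ψ = evV (zev N) Ψ := rfl

theorem zev_pow (hN : N ≠ 0) (k : ℕ) : zev N k ^ N = 1 := by
  rw [zev, ← pow_mul, mul_comm (k + 1), pow_mul, (Complex.isPrimitiveRoot_exp N hN).pow_eq_one, one_pow]

theorem dist_zev (hN : N ≠ 0) : Dist N (zev N) := by
  have h := Complex.isPrimitiveRoot_exp N hN
  have h0 := h.ne_zero hN
  refine ⟨fun i _ => pow_ne_zero _ h0, fun i j hi hj hij => h.pow_inj hi hj ?_⟩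
  simp only [zev, pow_succ] at hij
  exact mul_right_cancel₀ h0 hij

/-- A pole means `q² z_i = z_j`, whose `N`-th power reads `q^{2N} = 1`. -/
theorem noPole_of_pow_eq_one (hq0 : q ≠ 0) (hq : q ^ (2 * N) ≠ 1) {z : ℕ → ℂ}
    (h1 : ∀ k < N, z k ^ N = 1) : NoPole q N z := by
  intro i j hi hj _ h
  have h2 : q ^ 2 * z i = z j := by
    have : q * q⁻¹ = 1 := mul_inv_cancel₀ hq0
    linear_combination q * h + z j * this
  apply hq
  have h3 := congrArg (· ^ N) h2
  simp only [mul_pow, h1 i hi, h1 j hj, mul_one] at h3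
  rw [pow_mul, h3]

theorem prod_X_sub_C_of_pow_eq_one {z : ℕ → ℂ} (hN : 0 < N) (hz : Dist N z)
    (h1 : ∀ k < N, z k ^ N = 1) :
    Lagrange.nodal (Finset.range N) z = (Polynomial.X ^ N - 1 : Polynomial ℂ) := by
  have h := Complex.isPrimitiveRoot_exp N hN.ne'
  have hinj : Set.InjOn z (Finset.range N) := fun i hi j hj hij =>
    hz.2 i j (Finset.mem_range.mp hi) (Finset.mem_range.mp hj) hij
  have himg : (Finset.range N).image z = Polynomial.nthRootsFinset N 1 := by
    refine Finset.eq_of_subset_of_card_le (fun x hx => ?_) ?_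
    · obtain ⟨k, hk, rfl⟩ := Finset.mem_image.mp hx
      rw [Polynomial.mem_nthRootsFinset hN]
      exact h1 k (Finset.mem_range.mp hk)
    · rw [h.card_nthRootsFinset, Finset.card_image_of_injOn hinj, Finset.card_range]
  rw [Polynomial.X_pow_sub_one_eq_prod hN h, ← himg, Finset.prod_image hinj, Lagrange.nodal]

theorem prod_sub_of_pow_eq_one {z : ℕ → ℂ} (hN : 0 < N) (hz : Dist N z)
    (h1 : ∀ k < N, z k ^ N = 1) (x : ℂ) : ∏ m ∈ Finset.range N, (x - z m) = x ^ N - 1 := by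
  have := congrArg (Polynomial.eval x) (prod_X_sub_C_of_pow_eq_one hN hz h1)
  simpa [Lagrange.nodal, Polynomial.eval_prod] using this

theorem q_sub_inv_ne_zero (hq0 : q ≠ 0) (hq : q ^ (2 * N) ≠ 1) : q - q⁻¹ ≠ 0 := by
  intro h
  apply hq
  have : q ^ 2 = 1 := by
    have := mul_inv_cancel₀ hq0
    linear_combination q * h + this
  rw [pow_mul, this, one_pow]

/-- Since the `z_m` are the roots of `X^N - 1`, the denominators multiply to its derivative at
`z_j`. The numerators, completed by the factor `m = j`, give up to powers of `q` its value at `q²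
z_j`. -/
theorem Acoef_of_pow_eq_one (hq0 : q ≠ 0) (hq : q ^ (2 * N) ≠ 1) {z : ℕ → ℂ} (hz : Dist N z)
    (h1 : ∀ k < N, z k ^ N = 1) {j : ℕ} (hj : j < N) : Acoef q N z j = qnum q N / N := by
  have hN : 0 < N := by omega
  have hjr := Finset.mem_range.mpr hj
  have hz0 := hz.1 j hj
  have hq2 := q_sub_inv_ne_zero hq0 hq
  have hden : ∏ m ∈ (Finset.range N).erase j, (z j - z m) = N * z j ^ (N - 1) := by
    have h2 := Lagrange.eval_nodal_derivative_eval_node_eq (v := z) hjr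
    rw [prod_X_sub_C_of_pow_eq_one hN hz h1] at h2
    rw [Polynomial.derivative_sub, Polynomial.derivative_X_pow, Polynomial.derivative_one] at h2
    simpa [Lagrange.nodal, Polynomial.eval_prod] using h2.symm
  have hnum : ((q - q⁻¹) * z j) * ∏ m ∈ (Finset.range N).erase j, (q * z j - q⁻¹ * z m)
      = q ^ N - (q ^ N)⁻¹ := by
    have h2 := Finset.mul_prod_erase (Finset.range N) (fun m => q * z j - q⁻¹ * z m) hjr
    rw [show (q - q⁻¹) * z j = q * z j - q⁻¹ * z j by ring, h2]
    have h3 : ∀ m ∈ Finset.range N, q * z j - q⁻¹ * z m = q⁻¹ * (q ^ 2 * z j - z m) := by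
      intro m _
      field_simp
    rw [Finset.prod_congr rfl h3, Finset.prod_mul_distrib, prod_sub_of_pow_eq_one hN hz h1,
      Finset.prod_const, Finset.card_range, mul_pow, h1 j hj, ← pow_mul, mul_comm 2 N, pow_mul, inv_pow]
    have := pow_ne_zero N hq0
    field_simp
  have hzN : z j ^ (N - 1) * z j = 1 := by
    rw [← pow_succ, Nat.sub_add_cancel hN, h1 j hj]
  have hN' : (N : ℂ) ≠ 0 := Nat.cast_ne_zero.mpr hN.ne'
  have h4 := left_ne_zero_of_mul (hzN.trans_ne one_ne_zero)
  simp only [Acoef, aR]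
  rw [Finset.prod_div_distrib, hden, qnum, ← hnum, div_div, div_eq_div_iff
    (mul_ne_zero hN' h4) (mul_ne_zero hq2 hN')]
  linear_combination -(q - q⁻¹) * N *
    (∏ m ∈ (Finset.range N).erase j, (q * z j - q⁻¹ * z m)) * hzN

end RootsOfUnity

/-! ### Derivatives of evaluations -/

section Euler

variable {N : ℕ} {q : ℂ}

theorem hasDerivAt_evN {w : ℂ → ℕ → ℂ} {w' : ℕ → ℂ} {t : ℂ}
    (h : ∀ k < N, HasDerivAt (fun p => w p k) (w' k) t) (F : Pol N) :
    HasDerivAt (fun p => evN (w p) F) (∑ i : Fin N, w' i * evN (w t) (pderiv i F)) t := by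
  induction F using MvPolynomial.induction_on with
  | C c => simpa using hasDerivAt_const t c
  | add F G hF hG =>
    simp only [evN_add, map_add, mul_add, Finset.sum_add_distrib]
    exact hF.add hG
  | mul_X F k hF =>
    have h1 := hF.mul (h k k.isLt)
    simp only [evN_mul, evN_X, pderiv_mul, evN_add, pderiv_X]
    refine h1.congr_deriv ?_
    simp only [mul_add, Finset.sum_add_distrib, Finset.sum_mul]
    congr 1
    · exact Finset.sum_congr rfl fun i _ => by ring
    · rw [Finset.sum_eq_single k]
      · simp [evN]; ring
      · intro i _ hi
        rw [Pi.single_eq_of_ne hi.symm]; simp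
      · simp

/-- The values of `z_j ∂_j Ψ` at `x`. -/
def eulerV (x : ℕ → ℂ) (Ψ : SpinPol N) (j : ℕ) : Spin N := fun s =>
  if h : j < N then x j * evN x (pderiv (⟨j, h⟩ : Fin N) (Ψ s)) else 0

theorem hasDerivAt_evV_single {w : ℂ → ℕ → ℂ} {x : ℕ → ℂ} {c : ℂ} {j : ℕ} (hj : j < N)
    (hw : ∀ k < N, w 1 k = x k)
    (h : ∀ k < N, HasDerivAt (fun p => w p k) (if k = j then c * x j else 0) 1) (Ψ : SpinPol N) :
    HasDerivAt (fun p => evV (w p) Ψ) (c • eulerV x Ψ j) 1 := by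
  rw [hasDerivAt_pi]
  intro s
  refine (hasDerivAt_evN h (Ψ s)).congr_deriv ?_
  rw [Finset.sum_eq_single (⟨j, hj⟩ : Fin N)]
  · rw [if_pos rfl, Pi.smul_apply, eulerV, dif_pos hj, evN_congr hw, smul_eq_mul, mul_assoc]
  · intro i _ hi
    rw [if_neg fun h => hi (Fin.ext h), zero_mul]
  · simp

theorem hasDerivAt_evV_insAt {z : ℕ → ℂ} {j : ℕ} (hj : j < N) (Ψ : SpinPol N) :
    HasDerivAt (fun p => evV (insAt p j j z) Ψ) (eulerV z Ψ j) 1 := by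
  have := hasDerivAt_evV_single (w := fun p => insAt p j j z) (x := z) (c := 1) hj
    (fun k _ => by simp only [insAt_one]) (fun k _ => ?_) Ψ
  · simpa using this
  · unfold insAt
    split_ifs with h1 h2 h3 <;> try omega
    · exact hasDerivAt_const _ _
    · exact (hasDerivAt_id (1 : ℂ)).mul_const _
    · exact hasDerivAt_const _ _

/-- In the reflected point coordinate `j` sits inverted at place `N - 1 - j`, so multiplying it by
`p` dilates that place by `p⁻¹`. The minus sign comes from here. -/
theorem hasDerivAt_evV_mir_insAt {z : ℕ → ℂ} (hz : Dist N z) {j : ℕ} (hj : j < N)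
    (Ψ : SpinPol N) : HasDerivAt (fun p => evV (mir N (insAt p j j z)) Ψ)
      (-eulerV (mir N z) Ψ (N - 1 - j)) 1 := by
  have := hasDerivAt_evV_single (w := fun p => mir N (insAt p j j z)) (x := mir N z) (c := -1)
    (j := N - 1 - j) (by omega) (fun k _ => by simp only [insAt_one]) (fun k hk => ?_) Ψ
  · simpa using this
  · simp only [mir, insAt]
    by_cases hkj : k = N - 1 - j
    · rw [if_pos hkj]
      have e : N - 1 - k = j := by omega
      simp only [e, lt_irrefl, if_false, if_true]
      rw [show N - 1 - (N - 1 - j) = j by omega]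
      have h0 := hz.1 j hj
      have h1 := ((hasDerivAt_id (1 : ℂ)).mul_const (z j)).inv (by simpa using h0)
      refine h1.congr_deriv ?_
      simp only [id]
      field_simp
    · rw [if_neg hkj]
      have e : N - 1 - k ≠ j := by omega
      simp only [e, if_false]
      exact hasDerivAt_const _ _

theorem evN_cyc_pow (p : ℂ) (m : ℕ) : ∀ (z : ℕ → ℂ) (F : Pol N),
    evN z ((cyc p ^ m) F) = evN ((rot N p)^[m] z) F := by
  induction m with
  | zero => intro z F; rfl
  | succ m ih =>
    intro z F
    rw [pow_succ', Module.End.mul_apply, evN_cyc, ih, Function.iterate_succ_apply]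

theorem rot_iterate (p : ℂ) (z : ℕ → ℂ) (m : ℕ) (hm : m ≤ N) : ∀ k < N,
    (rot N p)^[m] z k = if k < m then p * z (N + k - m) else z (k - m) := by
  induction m with
  | zero => intro k _; rfl
  | succ m ih =>
    intro k hk
    rw [Function.iterate_succ_apply', rot]
    split_ifs with h1 h2 h3
    · rw [ih (by omega) _ (by omega), if_neg (by omega)]
      congr 2; omega
    · omega
    · rw [ih (by omega) _ (by omega), if_pos (by omega)]
      congr 2; omega
    · rw [ih (by omega) _ (by omega), if_neg (by omega)]
      congr 1; omega

theorem evV_spinD_top (hq : q ≠ 0) {p : ℂ} (hp : p ≠ 0) (hN : 0 < N) (x : ℕ → ℂ)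
    (Ψ : SpinPol N) : evV x (spinD q p N Ψ) = evV (fun k => p * x k) Ψ := by
  funext s
  rw [evV, spinD, esymmY_top hq hp hN, LinearMap.compLeft_apply, Function.comp_apply, evN_cyc_pow]
  refine evN_congr (fun k hk => ?_) _
  rw [rot_iterate p x N le_rfl k hk, if_pos hk, Nat.add_sub_cancel_left]

theorem hasDerivAt_evV_spinD_top (hq : q ≠ 0) (hN : 0 < N) (x : ℕ → ℂ) (Ψ : SpinPol N) :
    HasDerivAt (fun p => evV x (spinD q p N Ψ)) (∑ j ∈ Finset.range N, eulerV x Ψ j) 1 := by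
  have hloc : ∀ᶠ p : ℂ in nhds 1, evV x (spinD q p N Ψ) = evV (fun k => p * x k) Ψ := by
    filter_upwards [isOpen_ne.mem_nhds (one_ne_zero (α := ℂ))] with p hp
    exact evV_spinD_top hq hp hN x Ψ
  refine HasDerivAt.congr_of_eventuallyEq ?_ hloc
  rw [hasDerivAt_pi]
  intro s
  refine (hasDerivAt_evN (w' := x) (fun k _ => ?_) (Ψ s)).congr_deriv ?_
  · simpa using (hasDerivAt_id (1 : ℂ)).mul_const (x k)
  · rw [Finset.sum_apply, ← Fin.sum_univ_eq_sum_range (fun j => eulerV x Ψ j s)]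
    refine Finset.sum_congr rfl fun i _ => ?_
    simp [eulerV]

theorem spinD_top_one (hq : q ≠ 0) (hN : 0 < N) (Ψ : SpinPol N) : spinD q 1 N Ψ = Ψ := by
  funext s
  refine ext_of_evN fun z _ => ?_
  have := congrFun (evV_spinD_top hq one_ne_zero hN z Ψ) s
  simpa [evV] using this

end Euler

/-! ### The Hamiltonians in terms of the Temperley–Lieb operators -/

section Hamiltonians

variable {N : ℕ} {q : ℂ}

theorem sum_Ioi_eq {M : Type*} [AddCommMonoid M] (f : ℕ → ℕ → M) :
    ∑ i : Fin N, ∑ j ∈ Finset.Ioi i, f i j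
      = ∑ j ∈ Finset.range N, ∑ i ∈ Finset.range j, f i j := by
  have h1 : ∀ i : Fin N, ∑ j ∈ Finset.Ioi i, f i j
      = ∑ j : Fin N, if (i : ℕ) < j then f i j else 0 := by
    intro i
    rw [← Finset.sum_filter]
    refine Finset.sum_congr ?_ fun _ _ => rfl
    ext j; simp
  rw [Finset.sum_congr rfl fun i _ => h1 i, Finset.sum_comm,
    ← Fin.sum_univ_eq_sum_range (fun j => ∑ i ∈ Finset.range j, f i j)]
  refine Finset.sum_congr rfl fun j _ => ?_
  rw [Fin.sum_univ_eq_sum_range (fun i => if i < (j : ℕ) then f i j else 0), ← Finset.sum_filter]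
  refine Finset.sum_congr ?_ fun _ _ => rfl
  have := j.isLt
  ext i; simp; omega

theorem sum_Ioi_rev {M : Type*} [AddCommMonoid M] (f : ℕ → ℕ → M) :
    ∑ i : Fin N, ∑ j ∈ Finset.Ioi i, f (N - 1 - j) (N - 1 - i)
      = ∑ i : Fin N, ∑ j ∈ Finset.Ioi i, f i j := by
  have h1 : ∀ (g : ℕ → ℕ → M) (i : Fin N), ∑ j ∈ Finset.Ioi i, g i j
      = ∑ j : Fin N, if i < j then g i j else 0 := by
    intro g i
    rw [← Finset.sum_filter]
    refine Finset.sum_congr ?_ fun _ _ => rfl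
    ext j; simp
  rw [Finset.sum_congr rfl fun i _ => h1 (fun i j => f (N - 1 - j) (N - 1 - i)) i,
    Finset.sum_congr rfl fun i _ => h1 f i, Finset.sum_comm, ← Equiv.sum_comp Fin.revPerm]
  refine Finset.sum_congr rfl fun i _ => ?_
  rw [← Equiv.sum_comp Fin.revPerm]
  refine Finset.sum_congr rfl fun j _ => ?_
  have hi := i.isLt
  have hj := j.isLt
  simp only [Fin.revPerm_apply, Fin.rev_lt_rev, Fin.val_rev]
  rw [show N - 1 - (N - ((i : ℕ) + 1)) = i by omega, show N - 1 - (N - ((j : ℕ) + 1)) = j by omega]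

theorem reverse_range'_map_sub {l a N : ℕ} (h : a + l ≤ N) :
    (List.range' (N - a - l) l).reverse.map (fun m => N - 1 - m) = List.range' a l := by
  rw [List.reverse_range', List.map_map, List.range'_eq_map_range]
  refine List.map_congr_left fun m hm => ?_
  rw [List.mem_range] at hm
  simp only [Function.comp_apply]
  omega

theorem range'_map_sub {l a N : ℕ} (h : a + l ≤ N) :
    (List.range' (N - a - l) l).map (fun m => N - 1 - m) = (List.range' a l).reverse := by
  rw [← reverse_range'_map_sub h, List.map_reverse, List.reverse_reverse]

/-- Reversing the sites sends the left-hand generator to the right-hand one, and inverting the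
coordinates restores the ratios `z_m / z_i` after the reversal. Results for `SLop` thereby apply to
`S^R`. -/
theorem toLin'_SR {x : ℕ → ℂ} (hx : Dist N x) (hP : NoPole q N x) {i j : Fin N} (hij : i < j) :
    Matrix.toLin' (SR q (fun m : Fin N => x m) i j)
      = SLop q (fun k => eAct ℂ q (N - 2 - k)) (mir N x) (N - 1 - j) (N - 1 - i) := by
  have hmem : ∀ m ∈ between i j, i < m ∧ m < j := by
    intro m hm; simpa [between] using hm
  have hi := i.isLt
  have hj := j.isLt
  rw [Fin.lt_def] at hij
  have hl : N - 1 - (i : ℕ) - (N - 1 - j) - 1 = j - i - 1 := by omega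
  have ha : N - 1 - (j : ℕ) + 1 = N - (i + 1) - (j - i - 1) := by omega
  have hB : Bc q (fun k => (eAct ℂ q (N - 2 - k) : Module.End ℂ (Spin N))) (mir N x (N - 1 - i)) (mir N x)
      (j - i - 1) (N - (i + 1) - (j - i - 1)) = ((List.range' (i + 1) (j - i - 1)).map fun m =>
        Rop q (eAct ℂ q) (x m / x i) (m - 1)).prod := by
    rw [Bc_eq_prod, ← reverse_range'_map_sub (N := N) (a := i + 1) (by omega), List.map_map]
    congr 1
    refine List.map_congr_left fun m hm => ?_
    rw [List.mem_reverse, List.mem_range'_1] at hm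
    simp only [Function.comp_apply, Rop, mir]
    rw [show N - 1 - (N - 1 - (i : ℕ)) = i by omega, show N - 1 - m - 1 = N - 2 - m by omega,
      inv_div_inv]
  have hC : Cc q (fun k => (eAct ℂ q (N - 2 - k) : Module.End ℂ (Spin N))) (mir N x (N - 1 - i)) (mir N x)
      (j - i - 1) (N - (i + 1) - (j - i - 1)) = ((List.range' (i + 1) (j - i - 1)).reverse.map
        fun m => Rop q (eAct ℂ q) (x i / x m) (m - 1)).prod := by
    rw [Cc_eq_prod, ← range'_map_sub (N := N) (a := i + 1) (by omega), List.map_map]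
    congr 1
    refine List.map_congr_left fun m hm => ?_
    rw [List.mem_range'_1] at hm
    simp only [Function.comp_apply, Rop, mir]
    rw [show N - 1 - (N - 1 - (i : ℕ)) = i by omega, show N - 1 - m - 1 = N - 2 - m by omega,
      inv_div_inv]
  rw [SR, SLop, hl, ha, hB, hC, show N - 2 - (N - 1 - (j : ℕ)) = j - 1 by omega,
    Matrix.toLin'_mul, Matrix.toLin'_mul, toLin'_list_prod, toLin'_list_prod,
    toLin'_nn_eTL, ← map_between, ← List.map_reverse, List.map_map, List.map_map]
  rw [List.map_congr_left (g := (fun m => Rop q (eAct ℂ q) (x m / x i) (m - 1)) ∘ Fin.val)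
      (l := between i j) fun m hm => ?_,
    List.map_congr_left (g := (fun m => Rop q (eAct ℂ q) (x i / x m) (m - 1)) ∘ Fin.val)
      (l := (between i j).reverse) fun m hm => ?_]
  · rfl
  · have := (hmem m (by simpa using hm)); simp only [Fin.lt_def] at this
    exact toLin'_nn_Rcheck (pole_div (hx.1 _ m.isLt) (hP _ _ hi m.isLt (by omega))) (by omega)
  · have := (hmem m hm); simp only [Fin.lt_def] at this
    exact toLin'_nn_Rcheck (pole_div (hx.1 _ hi) (hP _ _ m.isLt hi (by omega))) (by omega)

theorem V_inv (q : ℂ) {x y : ℂ} (hx : x ≠ 0) (hy : y ≠ 0) : V q y⁻¹ x⁻¹ = V q x y := by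
  have h1 : q * y⁻¹ - q⁻¹ * x⁻¹ = (q * x - q⁻¹ * y) / (x * y) := by field_simp
  have h2 : q * x⁻¹ - q⁻¹ * y⁻¹ = (q * y - q⁻¹ * x) / (x * y) := by field_simp
  rw [V, V, h1, h2, div_mul_div_comm, div_div_eq_mul_div]
  congr 1
  field_simp

theorem hamL_mulVec (hN : 0 < N) (hq0 : q ≠ 0) (hq : q ^ (2 * N) ≠ 1) (v : Spin N) :
    (hamL q N).mulVec v = (qnum q N / N) • ∑ j ∈ Finset.range N, ∑ i ∈ Finset.range j,
      V q (zev N i) (zev N j) • SLop q (eAct ℂ q) (zev N) i j v := by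
  have hz := dist_zev hN.ne'
  have hP := noPole_of_pow_eq_one hq0 hq fun k _ => zev_pow hN.ne' k
  rw [← sum_Ioi_eq (N := N) fun i j => V q (zev N i) (zev N j) • SLop q (eAct ℂ q) (zev N) i j v,
    ← Matrix.toLin'_apply, hamL, hamLTilde, map_smul, LinearMap.smul_apply, map_sum,
    LinearMap.sum_apply]
  congr 1
  refine Finset.sum_congr rfl fun i _ => ?_
  rw [map_sum, LinearMap.sum_apply]
  refine Finset.sum_congr rfl fun j _ => ?_
  rw [map_smul, LinearMap.smul_apply, ← toLin'_SL hz hP]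
  rfl

theorem hamR_mulVec (hN : 0 < N) (hq0 : q ≠ 0) (hq : q ^ (2 * N) ≠ 1) (v : Spin N) :
    (hamR q N).mulVec v = (qnum q N / N) • ∑ j ∈ Finset.range N, ∑ i ∈ Finset.range j,
      V q (mir N (zev N) i) (mir N (zev N) j) •
        SLop q (fun k => eAct ℂ q (N - 2 - k)) (mir N (zev N)) i j v := by
  have hz := dist_zev hN.ne'
  have hP := noPole_of_pow_eq_one hq0 hq fun k _ => zev_pow hN.ne' k
  rw [← sum_Ioi_eq (N := N) fun i j => V q (mir N (zev N) i) (mir N (zev N) j) •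
      SLop q (fun k => eAct ℂ q (N - 2 - k)) (mir N (zev N)) i j v,
    ← sum_Ioi_rev (N := N) fun i j => V q (mir N (zev N) i) (mir N (zev N) j) •
      SLop q (fun k => eAct ℂ q (N - 2 - k)) (mir N (zev N)) i j v,
    ← Matrix.toLin'_apply, hamR, hamRTilde, map_smul, LinearMap.smul_apply, map_sum,
    LinearMap.sum_apply]
  congr 1
  refine Finset.sum_congr rfl fun i _ => ?_
  rw [map_sum, LinearMap.sum_apply]
  refine Finset.sum_congr rfl fun j hj => ?_
  have hi' := i.isLt
  have hj' := j.isLt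
  rw [map_smul, LinearMap.smul_apply, ← toLin'_SR hz hP (Finset.mem_Ioi.mp hj), mir, mir,
    show N - 1 - (N - 1 - (i : ℕ)) = i by omega, show N - 1 - (N - 1 - (j : ℕ)) = j by omega,
    V_inv q (hz.1 _ hi') (hz.1 _ hj')]
  rfl

end Hamiltonians

/-! ### The freezing of the difference operators -/

section Freezing

variable {N : ℕ} {q : ℂ}

theorem IsChart.evV_Zf_one {μ : (ℕ → ℂ) → ℕ → ℂ} {κ : ℕ → ℕ} (h : IsChart q N μ κ) (hq : q ≠ 0)
    (hκ : ∀ k l, k + 1 < l → l + 1 < N → Commute (eAct ℂ q (κ k) : Module.End ℂ (Spin N))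
      (eAct ℂ q (κ l))) {Ψ : SpinPol N} (hΨ : IsPhysical q Ψ) {z : ℕ → ℂ} (hz : Dist N z) :
    Zf q (fun k => eAct ℂ q (κ k)) N 0 (fun y => evV (μ (rot N 1 y)) Ψ) z
      = (∑ j ∈ Finset.range N, Acoef q N z j) • evV (μ z) Ψ := by
  have hE := h.exch hΨ
  rw [Zf_eq_Wf q hq (fun k => eAct ℂ q (κ k)) N (fun k hk => eAct_sq hq (h.lt k hk)) hκ N 0
    (by simp) _ (fun k _ hk z hz => hE.Tf_rot one_ne_zero hk hz) z hz]
  exact hE.Wf_rot_one hz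

theorem eAct_rev_comm {k l : ℕ} (h : k + 1 < l) (hl : l + 1 < N) :
    Commute (eAct ℂ q (N - 2 - k) : Module.End ℂ (Spin N)) (eAct ℂ q (N - 2 - l)) :=
  Commute.symm (eAct_comm (by omega) (by omega))

theorem exists_spinD_one_eq_smul (hq : q ≠ 0) : ∃ κ : ℂ, ∀ Ψ : SpinPol N, IsPhysical q Ψ →
    spinD q 1 1 Ψ = κ • Ψ := by
  obtain ⟨κ, hκ⟩ := exists_sum_Acoef q hq N
  refine ⟨κ, fun Ψ hΨ => _root_.funext fun s => ext_of_evN fun z hz => ?_⟩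
  have h1 := evV_esymmY_one hq 1 hΨ hz
  have h2 := (isChart_id hq N).evV_Zf_one hq (fun k l h hl => eAct_comm h hl) hΨ hz
  simp only [id] at h2
  rw [h2, hκ z hz, ← evV_smul] at h1
  exact congrFun h1 s

theorem exists_sum_Yinv_one_eq_smul (hq : q ≠ 0) (h1 : (1 : ℂ) ≠ 0) : ∃ κ : ℂ,
    ∀ Ψ : SpinPol N, IsPhysical q Ψ →
      (∑ i : Fin N, Yinv hq h1 i).compLeft (Conf N) Ψ = κ • Ψ := by
  obtain ⟨κ, hκ⟩ := exists_sum_Acoef q hq N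
  refine ⟨κ, fun Ψ hΨ => _root_.funext fun s => ext_of_evN fun x hx => ?_⟩
  have hz := hx.mir
  have h2 := evV_sum_Yinv hq h1 hΨ hz
  rw [(isChart_mir hq N).evV_Zf_one hq (fun k l h hl => eAct_rev_comm h hl) hΨ hz, hκ _ hz,
    ← evV_smul, evV_congr (fun k hk => mir_mir hk), evV_congr (fun k hk => mir_mir hk)] at h2
  exact congrFun h2 s

/-- `H^L` is obtained by freezing `D̃₁`. -/
theorem isFreezing_hamL (hq0 : q ≠ 0) (hq : q ^ (2 * N) ≠ 1) (hN : 0 < N) :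
    IsFreezing q (fun p => (q - q⁻¹)⁻¹ • (spinD q p 1 - (qnum q N / N) • spinD q p N))
      (hamL q N) := by
  have hr : ∀ k < N, zev N k ^ N = 1 := fun k _ => zev_pow hN.ne' k
  have hz := dist_zev hN.ne'
  have hP := noPole_of_pow_eq_one hq0 hq hr
  have hqq := q_sub_inv_ne_zero hq0 hq
  constructor
  · obtain ⟨κ, hκ⟩ := exists_spinD_one_eq_smul (N := N) hq0
    refine ⟨(q - q⁻¹)⁻¹ * (κ - qnum q N / N), fun Ψ hΨ => ?_⟩
    rw [LinearMap.smul_apply, LinearMap.sub_apply, LinearMap.smul_apply, hκ Ψ hΨ,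
      spinD_top_one hq0 hN]
    module
  · intro Ψ hΨ
    have hE := (isChart_id hq0 N).exch hΨ
    have h1 := hE.hasDerivAt_Zf hq0 (fun k hk => eAct_sq hq0 hk) (fun k l h hl => eAct_comm h hl)
      hz hP (D := eulerV (zev N) Ψ) fun j hj => hasDerivAt_evV_insAt hj Ψ
    have h2 := hasDerivAt_evV_spinD_top hq0 hN (zev N) Ψ
    have h3 := (h1.sub (h2.const_smul (qnum q N / N))).const_smul (q - q⁻¹)⁻¹
    have h4 : (fun p : ℂ => ev (((q - q⁻¹)⁻¹ • (spinD q p 1 - (qnum q N / N) • spinD q p N) :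
          Module.End ℂ (SpinPol N)) Ψ))
        = fun p => (q - q⁻¹)⁻¹ • (Zf q (fun k => eAct ℂ q (id k)) N 0
          (fun y => evV (id (rot N p y)) Ψ) (zev N)
          - (qnum q N / N) • evV (zev N) (spinD q p N Ψ)) := by
      funext p
      rw [ev_eq_evV, LinearMap.smul_apply, LinearMap.sub_apply, LinearMap.smul_apply, evV_smul,
        evV_sub, evV_smul, spinD, evV_esymmY_one hq0 p hΨ hz]
      rfl
    rw [h4]
    refine h3.congr_deriv ?_
    -- All `A_j` equal `[N]/N`, so the Euler terms are exactly the derivative of `([N]/N) D̃_N` and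
    -- cancel.
    rw [hamL_mulVec hN hq0 hq, Finset.sum_congr rfl fun j hj => by
      rw [Acoef_of_pow_eq_one hq0 hq hz hr (Finset.mem_range.mp hj)],
      ← Finset.smul_sum, Finset.sum_add_distrib, ← Finset.smul_sum, ← smul_sub, add_sub_cancel_left,
      smul_smul, smul_smul, mul_right_comm, inv_mul_cancel₀ hqq, one_mul]
    rfl

/-- `H^R` is obtained by freezing `D̃_{-1}`. -/
theorem isFreezing_hamR (hq0 : q ≠ 0) (hq : q ^ (2 * N) ≠ 1) (hN : 0 < N) :
    IsFreezing q (fun p => (q - q⁻¹)⁻¹ • (spinDneg q p + (qnum q N / N) • spinD q p N))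
      (hamR q N) := by
  have hr : ∀ k < N, mir N (zev N) k ^ N = 1 := fun k _ => by
    rw [mir, inv_pow, zev_pow hN.ne', inv_one]
  have hz := (dist_zev hN.ne').mir
  have hP := noPole_of_pow_eq_one hq0 hq hr
  have hqq := q_sub_inv_ne_zero hq0 hq
  constructor
  · obtain ⟨κ, hκ⟩ := exists_sum_Yinv_one_eq_smul (N := N) hq0 one_ne_zero
    refine ⟨(q - q⁻¹)⁻¹ * (κ + qnum q N / N), fun Ψ hΨ => ?_⟩
    rw [LinearMap.smul_apply, LinearMap.add_apply, LinearMap.smul_apply,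
      spinDneg_eq hq0 one_ne_zero hN, hκ Ψ hΨ, spinD_top_one hq0 hN]
    module
  · intro Ψ hΨ
    have hmm : ∀ Φ : SpinPol N, evV (mir N (mir N (zev N))) Φ = ev Φ := fun Φ =>
      evV_congr (fun k hk => mir_mir hk) Φ
    have hE := (isChart_mir hq0 N).exch hΨ
    have h1 := hE.hasDerivAt_Zf hq0 (fun k hk => eAct_sq hq0 (by omega))
      (fun k l h hl => eAct_rev_comm h hl) hz hP
      (D := fun j => -eulerV (mir N (mir N (zev N))) Ψ (N - 1 - j))
      fun j hj => hasDerivAt_evV_mir_insAt hz hj Ψ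
    have h2 := hasDerivAt_evV_spinD_top hq0 hN (mir N (mir N (zev N))) Ψ
    have h3 := (h1.add (h2.const_smul (qnum q N / N))).const_smul (q - q⁻¹)⁻¹
    have h4 : ∀ᶠ p : ℂ in nhds 1,
        ev (((q - q⁻¹)⁻¹ • (spinDneg q p + (qnum q N / N) • spinD q p N) :
          Module.End ℂ (SpinPol N)) Ψ)
        = (q - q⁻¹)⁻¹ • (Zf q (fun k => eAct ℂ q (N - 2 - k)) N 0
          (fun y => evV (mir N (rot N p y)) Ψ) (mir N (zev N))
          + (qnum q N / N) • evV (mir N (mir N (zev N))) (spinD q p N Ψ)) := by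
      filter_upwards [isOpen_ne.mem_nhds (one_ne_zero (α := ℂ))] with p hp
      rw [← hmm, LinearMap.smul_apply, LinearMap.add_apply, LinearMap.smul_apply, evV_smul,
        evV_add, evV_smul, spinDneg_eq hq0 hp hN, evV_sum_Yinv hq0 hp hΨ hz]
    refine HasDerivAt.congr_of_eventuallyEq (h3.congr_deriv ?_) h4
    -- The Euler terms occur with a minus sign and in reversed order; adding `([N]/N) D̃_N` removes
    -- them.
    have hrefl : ∑ j ∈ Finset.range N, eulerV (mir N (mir N (zev N))) Ψ (N - 1 - j)
        = ∑ j ∈ Finset.range N, eulerV (mir N (mir N (zev N))) Ψ j :=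
      Finset.sum_range_reflect (fun j => eulerV (mir N (mir N (zev N))) Ψ j) N
    rw [hamR_mulVec hN hq0 hq, Finset.sum_congr rfl fun j hj => by
      rw [Acoef_of_pow_eq_one hq0 hq hz hr (Finset.mem_range.mp hj)],
      ← Finset.smul_sum, Finset.sum_add_distrib, ← Finset.smul_sum, ← smul_add,
      Finset.sum_neg_distrib, hrefl, add_comm, add_neg_cancel_left,
      smul_smul, smul_smul, mul_right_comm, inv_mul_cancel₀ hqq, one_mul, hmm]

theorem exists_isPhysical_ev_eq (hq0 : q ≠ 0) (hq : q ^ (2 * N) ≠ 1) (hN : 0 < N) (v : Spin N) :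
    ∃ Ψ : SpinPol N, IsPhysical q Ψ ∧ ev Ψ = v :=
  exists_isPhysical_evV_eq hq0 (dist_zev hN.ne')
    (noPole_of_pow_eq_one hq0 hq fun k _ => zev_pow hN.ne' k) v

theorem IsFreezing.unique (hq0 : q ≠ 0) (hq : q ^ (2 * N) ≠ 1) (hN : 0 < N)
    {O : ℂ → Module.End ℂ (SpinPol N)} {A B : SpinOp N} (hA : IsFreezing q O A)
    (hB : IsFreezing q O B) : A = B := by
  refine Matrix.toLin'.injective (LinearMap.ext fun v => ?_)
  obtain ⟨Ψ, hΨ, rfl⟩ := exists_isPhysical_ev_eq hq0 hq hN v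
  exact (hA.2 Ψ hΨ).unique (hB.2 Ψ hΨ)

end Freezing

open Filter Topology

/-! ### Finite families that depend differentiably on the shift parameter -/

section Families

variable {M M' : Type*} [AddCommGroup M] [Module ℂ M] [AddCommGroup M'] [Module ℂ M']

/-- The finite sums `∑ c_k(p) v_k` with `v_k ∈ S` and `c_k` differentiable at `1`. -/
def diffFam (S : Submodule ℂ M) : Submodule ℂ (ℂ → M) :=
  Submodule.span ℂ {f | ∃ c : ℂ → ℂ, DifferentiableAt ℂ c 1 ∧ ∃ v ∈ S, f = fun p => c p • v}

variable {S : Submodule ℂ M}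

theorem smul_const_mem_diffFam {c : ℂ → ℂ} (hc : DifferentiableAt ℂ c 1) {v : M} (hv : v ∈ S) :
    (fun p => c p • v) ∈ diffFam S :=
  Submodule.subset_span ⟨c, hc, v, hv, rfl⟩

theorem const_mem_diffFam {v : M} (hv : v ∈ S) : (fun _ => v) ∈ diffFam S := by
  simpa using smul_const_mem_diffFam (c := fun _ => 1) (differentiableAt_const _) hv

theorem zero_mem_diffFam : (fun _ => 0) ∈ diffFam S := (diffFam S).zero_mem

theorem add_mem_diffFam {f g : ℂ → M} (hf : f ∈ diffFam S) (hg : g ∈ diffFam S) :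
    (fun p => f p + g p) ∈ diffFam S :=
  (diffFam S).add_mem hf hg

theorem const_smul_mem_diffFam (a : ℂ) {f : ℂ → M} (hf : f ∈ diffFam S) :
    (fun p => a • f p) ∈ diffFam S :=
  (diffFam S).smul_mem a hf

theorem smul_mem_diffFam {c : ℂ → ℂ} (hc : DifferentiableAt ℂ c 1) {f : ℂ → M}
    (hf : f ∈ diffFam S) : (fun p => c p • f p) ∈ diffFam S := by
  induction hf using Submodule.span_induction with
  | mem f hf =>
    obtain ⟨d, hd, v, hv, rfl⟩ := hf
    simpa only [smul_smul] using smul_const_mem_diffFam (hc.fun_mul hd) hv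
  | zero => simpa using zero_mem_diffFam
  | add f g _ _ hf hg => simpa only [Pi.add_apply, smul_add] using add_mem_diffFam hf hg
  | smul a f _ hf => simpa only [Pi.smul_apply, smul_comm _ a] using const_smul_mem_diffFam a hf

theorem map_mem_diffFam {S' : Submodule ℂ M'} (T : M →ₗ[ℂ] M') (hT : ∀ v ∈ S, T v ∈ S')
    {f : ℂ → M} (hf : f ∈ diffFam S) : (fun p => T (f p)) ∈ diffFam S' := by
  induction hf using Submodule.span_induction with
  | mem f hf =>
    obtain ⟨d, hd, v, hv, rfl⟩ := hf
    simpa only [map_smul] using smul_const_mem_diffFam hd (hT v hv)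
  | zero => simpa using zero_mem_diffFam
  | add f g _ _ hf hg => simpa only [Pi.add_apply, map_add] using add_mem_diffFam hf hg
  | smul a f _ hf => simpa only [Pi.smul_apply, map_smul] using const_smul_mem_diffFam a hf

/-- A family of operators that depends differentiably on the parameter. -/
def DiffOp (L : ℂ → M →ₗ[ℂ] M') : Prop :=
  ∀ v, (fun p => L p v) ∈ diffFam (⊤ : Submodule ℂ M')

theorem DiffOp.apply {L : ℂ → M →ₗ[ℂ] M'} (hL : DiffOp L) {f : ℂ → M} (hf : f ∈ diffFam S) :
    (fun p => L p (f p)) ∈ diffFam (⊤ : Submodule ℂ M') := by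
  induction hf using Submodule.span_induction with
  | mem f hf =>
    obtain ⟨d, hd, v, hv, rfl⟩ := hf
    simpa only [map_smul] using smul_mem_diffFam hd (hL v)
  | zero => simpa using zero_mem_diffFam
  | add f g _ _ hf hg => simpa only [Pi.add_apply, map_add] using add_mem_diffFam hf hg
  | smul a f _ hf => simpa only [Pi.smul_apply, map_smul] using const_smul_mem_diffFam a hf

theorem DiffOp.const (L : M →ₗ[ℂ] M') : DiffOp fun _ => L :=
  fun _ => const_mem_diffFam Submodule.mem_top

theorem DiffOp.mul {L K : ℂ → Module.End ℂ M} (hL : DiffOp L) (hK : DiffOp K) :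
    DiffOp fun p => L p * K p :=
  fun v => hL.apply (hK v)

theorem DiffOp.pow {L : ℂ → Module.End ℂ M} (hL : DiffOp L) (n : ℕ) : DiffOp fun p => L p ^ n := by
  induction n with
  | zero => simpa using DiffOp.const (1 : Module.End ℂ M)
  | succ n ih => simpa only [pow_succ] using ih.mul hL

theorem DiffOp.add {L K : ℂ → M →ₗ[ℂ] M'} (hL : DiffOp L) (hK : DiffOp K) :
    DiffOp fun p => L p + K p :=
  fun v => Submodule.add_mem _ (hL v) (hK v)

theorem DiffOp.smul {L : ℂ → M →ₗ[ℂ] M'} (hL : DiffOp L) (c : ℂ) : DiffOp fun p => c • L p :=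
  fun v => Submodule.smul_mem _ c (hL v)

theorem DiffOp.sub {L K : ℂ → M →ₗ[ℂ] M'} (hL : DiffOp L) (hK : DiffOp K) :
    DiffOp fun p => L p - K p :=
  fun v => Submodule.sub_mem _ (hL v) (hK v)

theorem DiffOp.sum {ι : Type*} (t : Finset ι) {L : ι → ℂ → M →ₗ[ℂ] M'}
    (hL : ∀ i ∈ t, DiffOp (L i)) : DiffOp fun p => ∑ i ∈ t, L i p := fun v => by
  have h := Submodule.sum_mem (diffFam (⊤ : Submodule ℂ M')) (t := t)
    (f := fun i p => L i p v) fun i hi => hL i hi v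
  convert h using 1
  funext p
  rw [LinearMap.sum_apply, Finset.sum_apply]

theorem DiffOp.list_prod {ι : Type*} (l : List ι) {L : ι → ℂ → Module.End ℂ M}
    (hL : ∀ i, DiffOp (L i)) : DiffOp fun p => (l.map fun i => L i p).prod := by
  induction l with
  | nil => simpa using DiffOp.const (1 : Module.End ℂ M)
  | cons a l ih => simpa only [List.map_cons, List.prod_cons] using (hL a).mul ih

theorem DiffOp.compLeft {L : ℂ → Module.End ℂ M} (hL : DiffOp L) (ι : Type*) [Fintype ι]
    [DecidableEq ι] : DiffOp fun p => (L p).compLeft ι := fun v => by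
  have h := Submodule.sum_mem (diffFam (⊤ : Submodule ℂ (ι → M))) (t := Finset.univ)
    (f := fun i p => LinearMap.single ℂ (fun _ => M) i (L p (v i))) fun i _ =>
      map_mem_diffFam _ (fun _ _ => Submodule.mem_top) (hL (v i))
  convert h using 1
  funext p
  rw [Finset.sum_apply]
  funext i
  rw [Finset.sum_apply]
  simp [Pi.single_apply]

theorem mul_mem_diffFam {A : Type*} [CommRing A] [Algebra ℂ A] {f g : ℂ → A}
    (hf : f ∈ diffFam (⊤ : Submodule ℂ A)) (hg : g ∈ diffFam (⊤ : Submodule ℂ A)) :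
    (fun p => f p * g p) ∈ diffFam (⊤ : Submodule ℂ A) := by
  induction hf using Submodule.span_induction with
  | mem f hf =>
    obtain ⟨d, hd, v, hv, rfl⟩ := hf
    simpa only [smul_mul_assoc, LinearMap.mulLeft_apply] using smul_mem_diffFam hd
      (map_mem_diffFam (LinearMap.mulLeft ℂ v) (fun _ _ => Submodule.mem_top) hg)
  | zero => simpa using zero_mem_diffFam
  | add f f' _ _ hf hf' => simpa only [Pi.add_apply, add_mul] using add_mem_diffFam hf hf'
  | smul a f _ hf => simpa only [Pi.smul_apply, smul_mul_assoc] using const_smul_mem_diffFam a hf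

theorem diffOp_aeval {N : ℕ} {φ : ℂ → Fin N → Pol N}
    (h : ∀ i, (fun p => φ p i) ∈ diffFam (⊤ : Submodule ℂ (Pol N))) :
    DiffOp fun p => (aeval (φ p) : Pol N →ₐ[ℂ] Pol N).toLinearMap := by
  intro F
  induction F using MvPolynomial.induction_on with
  | C c => simpa using const_mem_diffFam (Submodule.mem_top (x := (C c : Pol N)))
  | add F G hF hG => simpa only [map_add] using add_mem_diffFam hF hG
  | mul_X F i hF => simpa using mul_mem_diffFam hF (h i)

/-- The difference quotients at `1` of a differentiable family converge. -/
theorem exists_tendsto_diffFam {E : Type*} [NormedAddCommGroup E] [NormedSpace ℂ E] {f : ℂ → M}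
    (hf : f ∈ diffFam S) : ∃ w ∈ S, ∀ (Q : ℂ → M →ₗ[ℂ] E) (L : M →ₗ[ℂ] E),
      (∀ v ∈ S, Tendsto (fun p => Q p v) (𝓝[≠] 1) (𝓝 (L v))) →
      Tendsto (fun p => Q p ((p - 1)⁻¹ • (f p - f 1))) (𝓝[≠] 1) (𝓝 (L w)) := by
  induction hf using Submodule.span_induction with
  | mem f hf =>
    obtain ⟨d, hd, v, hv, rfl⟩ := hf
    -- The vector `w` is the derivative of the family at `1`. Letting `Q` vary with `p` is harmless
    -- because a family involves only finitely many fixed vectors, so pointwise convergence of `Q`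
    -- suffices.
    refine ⟨deriv d 1 • v, S.smul_mem _ hv, fun Q L hQ => ?_⟩
    have h1 := hasDerivAt_iff_tendsto_slope.mp hd.hasDerivAt
    have h2 := h1.smul (hQ v hv)
    rw [← map_smul] at h2
    refine h2.congr fun p => ?_
    rw [← sub_smul, smul_smul, map_smul, slope_def_field, div_eq_inv_mul]
  | zero => exact ⟨0, S.zero_mem, fun Q L _ => by simp⟩
  | add f g _ _ hf hg =>
    obtain ⟨w, hw, hf⟩ := hf
    obtain ⟨w', hw', hg⟩ := hg
    refine ⟨w + w', S.add_mem hw hw', fun Q L hQ => ?_⟩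
    have h := (hf Q L hQ).add (hg Q L hQ)
    rw [← map_add] at h
    refine h.congr fun p => ?_
    rw [← map_add, Pi.add_apply, Pi.add_apply, ← smul_add]
    congr 2; abel
  | smul a f _ hf =>
    obtain ⟨w, hw, hf⟩ := hf
    refine ⟨a • w, S.smul_mem a hw, fun Q L hQ => ?_⟩
    have h := (hf Q L hQ).const_smul a
    rw [← map_smul] at h
    refine h.congr fun p => ?_
    rw [← map_smul, Pi.smul_apply, Pi.smul_apply, ← smul_sub, smul_comm]

end Families

/-! ### Commutation of frozen operators -/

section Commutation

variable {N : ℕ} {q : ℂ}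

/-- A family of operators near `p = 1` that depends differentiably on `p` and preserves the
physical vectors. -/
structure IsPhysFamily (q : ℂ) (O : ℂ → Module.End ℂ (SpinPol N)) : Prop where
  diff : ∃ L : ℂ → Module.End ℂ (SpinPol N), DiffOp L ∧ ∀ p ≠ 0, O p = L p
  phys : ∀ p ≠ 0, ∀ Ψ, IsPhysical q Ψ → IsPhysical q (O p Ψ)

/-- Evaluation as a linear map. -/
def evLin (N : ℕ) : SpinPol N →ₗ[ℂ] Spin N where
  toFun := ev
  map_add' Ψ Φ := evV_add (zev N) Ψ Φ
  map_smul' c Ψ := evV_smul (zev N) c Ψ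

theorem tendsto_quotient {O : ℂ → Module.End ℂ (SpinPol N)} {A : SpinOp N}
    (h : ∀ Ψ, IsPhysical q Ψ → HasDerivAt (fun p : ℂ => ev (O p Ψ)) (A.mulVec (ev Ψ)) 1) {κ : ℂ}
    (hκ : ∀ Ψ, IsPhysical q Ψ → O 1 Ψ = κ • Ψ) {Ψ : SpinPol N} (hΨ : IsPhysical q Ψ) :
    Tendsto (fun p => evLin N ((p - 1)⁻¹ • (O p Ψ - κ • Ψ))) (𝓝[≠] 1)
      (𝓝 (A.mulVec (ev Ψ))) := by
  refine (hasDerivAt_iff_tendsto_slope.mp (h Ψ hΨ)).congr fun p => ?_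
  rw [slope_def_module, map_smul, map_sub, hκ Ψ hΨ, ← hκ Ψ hΨ]
  rfl

/-- The outer quotient acts on a vector that itself varies with `p`, so its pointwise convergence is
not enough. The family `O₂ p Ψ` is a finite sum with differentiable coefficients, which reduces the
limit to fixed physical vectors. -/
theorem tendsto_quotient_quotient {O₁ O₂ : ℂ → Module.End ℂ (SpinPol N)} {A₁ A₂ : SpinOp N}
    (h₁ : ∀ Ψ, IsPhysical q Ψ → HasDerivAt (fun p : ℂ => ev (O₁ p Ψ)) (A₁.mulVec (ev Ψ)) 1)
    {κ₁ : ℂ} (hκ₁ : ∀ Ψ, IsPhysical q Ψ → O₁ 1 Ψ = κ₁ • Ψ)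
    (h₂ : ∀ Ψ, IsPhysical q Ψ → HasDerivAt (fun p : ℂ => ev (O₂ p Ψ)) (A₂.mulVec (ev Ψ)) 1)
    {κ₂ : ℂ} (hκ₂ : ∀ Ψ, IsPhysical q Ψ → O₂ 1 Ψ = κ₂ • Ψ)
    (hO : IsPhysFamily q O₂) {Ψ : SpinPol N} (hΨ : IsPhysical q Ψ) :
    Tendsto (fun p => evLin N ((((p - 1)⁻¹ • (O₁ p - κ₁ • 1)) * ((p - 1)⁻¹ • (O₂ p - κ₂ • 1)) :
      Module.End ℂ (SpinPol N)) Ψ)) (𝓝[≠] 1) (𝓝 (A₁.mulVec (A₂.mulVec (ev Ψ)))) := by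
  obtain ⟨L, hL, hOL⟩ := hO.diff
  -- The vectors in the finite sum need not be physical, although `O₂ p Ψ` is for `p ≠ 0`. A linear
  -- projection onto the physical space leaves these values unchanged and makes every vector of the
  -- sum physical.
  obtain ⟨P, hP⟩ := (physSub N q).subtype.exists_leftInverse_of_injective
    (physSub N q).ker_subtype
  have hf := map_mem_diffFam (S' := physSub N q) ((physSub N q).subtype ∘ₗ P)
    (fun v _ => (P v).2) (hL Ψ)
  have hfO : ∀ p ≠ 0, ((physSub N q).subtype ∘ₗ P) (L p Ψ) = O₂ p Ψ := by
    intro p hp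
    rw [← hOL p hp]
    have h := hO.phys p hp Ψ hΨ
    exact congrArg Subtype.val (LinearMap.congr_fun hP ⟨O₂ p Ψ, h⟩)
  obtain ⟨w, hw, hlim⟩ := exists_tendsto_diffFam (E := Spin N) hf
  have hne : ∀ᶠ p : ℂ in 𝓝[≠] 1, p ≠ 0 :=
    nhdsWithin_le_nhds (isOpen_ne.mem_nhds one_ne_zero)
  have e : ∀ p ≠ 0, (p - 1)⁻¹ • (((physSub N q).subtype ∘ₗ P) (L p Ψ)
      - ((physSub N q).subtype ∘ₗ P) (L 1 Ψ)) = (p - 1)⁻¹ • (O₂ p Ψ - κ₂ • Ψ) := by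
    intro p hp
    rw [hfO p hp, hfO 1 one_ne_zero, hκ₂ Ψ hΨ]
  have hw1 : ev w = A₂.mulVec (ev Ψ) := by
    refine tendsto_nhds_unique ?_ (tendsto_quotient h₂ hκ₂ hΨ)
    refine (hlim (fun _ => evLin N) (evLin N) fun v _ => tendsto_const_nhds).congr' ?_
    filter_upwards [hne] with p hp
    rw [e p hp]
  rw [← hw1]
  refine (hlim (fun p => evLin N ∘ₗ ((p - 1)⁻¹ • (O₁ p - κ₁ • 1)))
    (Matrix.toLin' A₁ ∘ₗ evLin N) fun v hv => tendsto_quotient h₁ hκ₁ hv).congr' ?_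
  filter_upwards [hne] with p hp
  rw [e p hp]
  rfl

/-- Operators obtained by freezing commuting families commute. -/
theorem IsFreezing.commute (hq0 : q ≠ 0) (hq : q ^ (2 * N) ≠ 1) (hN : 0 < N)
    {O₁ O₂ : ℂ → Module.End ℂ (SpinPol N)} {A₁ A₂ : SpinOp N} (h₁ : IsFreezing q O₁ A₁)
    (h₂ : IsFreezing q O₂ A₂) (hO₁ : IsPhysFamily q O₁) (hO₂ : IsPhysFamily q O₂)
    (hc : ∀ p ≠ 0, Commute (O₁ p) (O₂ p)) : Commute A₁ A₂ := by
  obtain ⟨⟨κ₁, hκ₁⟩, h₁⟩ := h₁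
  obtain ⟨⟨κ₂, hκ₂⟩, h₂⟩ := h₂
  refine Matrix.toLin'.injective (LinearMap.ext fun v => ?_)
  obtain ⟨Ψ, hΨ, rfl⟩ := exists_isPhysical_ev_eq hq0 hq hN v
  rw [Matrix.toLin'_apply, Matrix.toLin'_apply, ← Matrix.mulVec_mulVec, ← Matrix.mulVec_mulVec]
  refine tendsto_nhds_unique (tendsto_quotient_quotient h₁ hκ₁ h₂ hκ₂ hO₂ hΨ)
    ((tendsto_quotient_quotient h₂ hκ₂ h₁ hκ₁ hO₁ hΨ).congr' ?_)
  filter_upwards [nhdsWithin_le_nhds (isOpen_ne.mem_nhds one_ne_zero)] with p hp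
  have hcp : Commute ((p - 1)⁻¹ • (O₁ p - κ₁ • 1)) ((p - 1)⁻¹ • (O₂ p - κ₂ • 1)) := by
    refine Commute.smul_left (Commute.smul_right (Commute.sub_left (Commute.sub_right (hc p hp) ?_)
      (Commute.sub_right ?_ ?_)) _) _
    · exact (Commute.one_right _).smul_right _
    · exact (Commute.one_left _).smul_left _
    · exact (Commute.one_left _).smul_left _
  rw [hcp.eq]

theorem diffOp_cyc : DiffOp fun p => (cyc p : Module.End ℂ (Pol N)) := by
  refine diffOp_aeval fun i => ?_
  by_cases h : (i : ℕ) = 0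
  · simp only [if_pos h, ← smul_eq_C_mul]
    exact smul_const_mem_diffFam differentiableAt_id Submodule.mem_top
  · simp only [if_neg h]
    exact const_mem_diffFam Submodule.mem_top

theorem diffOp_cycInv : DiffOp fun p => (cycInv p : Module.End ℂ (Pol N)) := by
  refine diffOp_aeval fun i => ?_
  by_cases h : (i : ℕ) + 1 < N
  · simp only [dif_pos h]
    exact const_mem_diffFam Submodule.mem_top
  · simp only [dif_neg h, ← smul_eq_C_mul]
    exact smul_const_mem_diffFam (differentiableAt_inv one_ne_zero) Submodule.mem_top

theorem diffOp_esymmY (r : ℕ) : DiffOp fun p => (esymmY q p r : Module.End ℂ (Pol N)) :=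
  DiffOp.sum _ fun _ _ => DiffOp.list_prod _ fun _ =>
    ((DiffOp.const _).mul diffOp_cyc).mul (DiffOp.const _)

theorem cycInv_pow_mul_cyc_pow {p : ℂ} (hp : p ≠ 0) (n : ℕ) :
    (cycInv p ^ n * cyc p ^ n : Module.End ℂ (Pol N)) = 1 := by
  have h : Commute (cycInv p : Module.End ℂ (Pol N)) (cyc p) :=
    (cycInv_mul_cyc hp).trans (cyc_mul_cycInv hp).symm
  rw [← h.mul_pow, cycInv_mul_cyc hp, one_pow]

/-- A form whose dependence on `p` is explicit, as needed for differentiability of the family. -/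
theorem sum_Yinv_eq (hq : q ≠ 0) {p : ℂ} (hp : p ≠ 0) (hN : 0 < N) :
    ∑ i : Fin N, Yinv hq hp i = cycInv p ^ N * esymmY q p (N - 1) := by
  rw [esymmY_pred hq hp hN, esymmY_top hq hp hN, ← mul_assoc, cycInv_pow_mul_cyc_pow hp, one_mul]

theorem commute_sum_Yinv (hq : q ≠ 0) {p : ℂ} (hp : p ≠ 0) (hN : 0 < N)
    {A : Module.End ℂ (Pol N)} (hA : ∀ r, Commute A (esymmY q p r)) :
    Commute A (∑ i : Fin N, Yinv hq hp i) := by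
  have h1 := hA (N - 1)
  rw [esymmY_pred hq hp hN] at h1
  refine (isUnit_esymmY_top hq hp hN).mul_left_cancel ?_
  rw [← mul_assoc, ← (hA N).eq, mul_assoc, h1.eq, mul_assoc]

theorem isPhysical_compLeft {A : Module.End ℂ (Pol N)}
    (hA : ∀ k, k + 1 < N → Commute (Tpol q k) A) {Ψ : SpinPol N} (hΨ : IsPhysical q Ψ) :
    IsPhysical q (A.compLeft (Conf N) Ψ) := by
  rw [isPhysical_iff] at hΨ ⊢
  intro k hk
  have h1 : (Tpol q k).compLeft (Conf N) (A.compLeft (Conf N) Ψ)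
      = A.compLeft (Conf N) ((Tpol q k).compLeft (Conf N) Ψ) := by
    funext s
    exact LinearMap.congr_fun (hA k hk).eq (Ψ s)
  rw [h1, hΨ k hk, map_sub, map_smul, compLeft_eAct A q hk]

theorem isPhysFamily_spinD (hq : q ≠ 0) (r : ℕ) : IsPhysFamily (N := N) q fun p => spinD q p r where
  diff := ⟨_, (diffOp_esymmY r).compLeft _, fun _ _ => rfl⟩
  phys _ hp _ hΨ := isPhysical_compLeft (fun _ hk => Tpol_commute_esymmY hq hp hk r) hΨ

theorem isPhysFamily_spinDneg (hq : q ≠ 0) (hN : 0 < N) :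
    IsPhysFamily (N := N) q fun p => spinDneg q p where
  diff := ⟨_, ((diffOp_cycInv.pow N).mul (diffOp_esymmY (N - 1))).compLeft _, fun p hp => by
    rw [spinDneg_eq hq hp hN, sum_Yinv_eq hq hp hN]⟩
  phys p hp Ψ hΨ := by
    rw [spinDneg_eq hq hp hN]
    exact isPhysical_compLeft (fun k hk => commute_sum_Yinv hq hp hN fun r =>
      Tpol_commute_esymmY hq hp hk r) hΨ

theorem IsPhysFamily.add {O O' : ℂ → Module.End ℂ (SpinPol N)} (h : IsPhysFamily q O)
    (h' : IsPhysFamily q O') : IsPhysFamily q fun p => O p + O' p where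
  diff := by
    obtain ⟨L, hL, e⟩ := h.diff
    obtain ⟨L', hL', e'⟩ := h'.diff
    exact ⟨_, hL.add hL', fun p hp => by rw [e p hp, e' p hp]⟩
  phys p hp Ψ hΨ := (physSub N q).add_mem (h.phys p hp Ψ hΨ) (h'.phys p hp Ψ hΨ)

theorem IsPhysFamily.sub {O O' : ℂ → Module.End ℂ (SpinPol N)} (h : IsPhysFamily q O)
    (h' : IsPhysFamily q O') : IsPhysFamily q fun p => O p - O' p where
  diff := by
    obtain ⟨L, hL, e⟩ := h.diff
    obtain ⟨L', hL', e'⟩ := h'.diff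
    exact ⟨_, hL.sub hL', fun p hp => by rw [e p hp, e' p hp]⟩
  phys p hp Ψ hΨ := (physSub N q).sub_mem (h.phys p hp Ψ hΨ) (h'.phys p hp Ψ hΨ)

theorem IsPhysFamily.smul {O : ℂ → Module.End ℂ (SpinPol N)} (h : IsPhysFamily q O) (c : ℂ) :
    IsPhysFamily q fun p => c • O p where
  diff := by
    obtain ⟨L, hL, e⟩ := h.diff
    exact ⟨_, hL.smul c, fun p hp => by rw [e p hp]⟩
  phys p hp Ψ hΨ := (physSub N q).smul_mem c (h.phys p hp Ψ hΨ)

theorem commute_spinD (hq : q ≠ 0) {p : ℂ} (hp : p ≠ 0) (r s : ℕ) :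
    Commute (spinD q p r : Module.End ℂ (SpinPol N)) (spinD q p s) := by
  refine LinearMap.ext fun Ψ => _root_.funext fun t => ?_
  exact LinearMap.congr_fun (esymmY_commute hq hp r s).eq (Ψ t)

theorem commute_spinDneg (hq : q ≠ 0) {p : ℂ} (hp : p ≠ 0) (hN : 0 < N) (r : ℕ) :
    Commute (spinDneg q p : Module.End ℂ (SpinPol N)) (spinD q p r) := by
  rw [spinDneg_eq hq hp hN]
  refine LinearMap.ext fun Ψ => _root_.funext fun t => ?_
  exact LinearMap.congr_fun (commute_sum_Yinv hq hp hN fun s =>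
    esymmY_commute hq hp r s).eq.symm (Ψ t)

/-- `H^R` commutes with the operators obtained by freezing the `D̃_r`. -/
theorem commute_hamR (hq0 : q ≠ 0) (hq : q ^ (2 * N) ≠ 1) (hN : 0 < N) {r : ℕ} {c : ℂ}
    {A : SpinOp N} (hA : IsFreezing q (fun p => (q - q⁻¹)⁻¹ •
      (spinD q p r - c • spinD q p N)) A) : Commute (hamR q N) A := by
  refine (isFreezing_hamR hq0 hq hN).commute hq0 hq hN hA
    (((isPhysFamily_spinDneg hq0 hN).add ((isPhysFamily_spinD hq0 N).smul _)).smul _)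
    (((isPhysFamily_spinD hq0 r).sub ((isPhysFamily_spinD hq0 N).smul c)).smul _) fun p hp => ?_
  · refine Commute.smul_left (Commute.smul_right (Commute.add_left (Commute.sub_right ?_ ?_)
      (Commute.sub_right ?_ ?_)) _) _
    · exact commute_spinDneg hq0 hp hN r
    · exact (commute_spinDneg hq0 hp hN N).smul_right _
    · exact (commute_spinD hq0 hp N r).smul_left _
    · exact ((commute_spinD hq0 hp N N).smul_right _).smul_left _

end Commutation

end QHS

end

theorem theorem1p1 (N : ℕ) (q : ℂ) (hq0 : q ≠ 0) (hq : q ^ (2 * N) ≠ 1) :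
    -- `H^R` commutes with `H^L`
    Commute (QHS.hamR q N) (QHS.hamL q N) ∧
    -- `H^R` is the operator obtained by freezing `D̃_{-1}`
    (∀ A : QHS.SpinOp N,
      QHS.IsFreezing q (fun p => (q - q⁻¹)⁻¹ •
        (QHS.spinDneg q p + (QHS.qnum q N / N) • QHS.spinD q p N)) A ↔ A = QHS.hamR q N) ∧
    -- `H^R` commutes with every operator obtained by freezing one of the `D̃_r`
    (∀ (r : ℕ) (c : ℂ) (A : QHS.SpinOp N), r ≤ N →
      QHS.IsFreezing q (fun p => (q - q⁻¹)⁻¹ •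
        (QHS.spinD q p r - c • QHS.spinD q p N)) A → Commute (QHS.hamR q N) A) := by
  -- For `N = 0` the hypothesis would read `q ^ 0 ≠ 1`.
  have hN : 0 < N := Nat.pos_of_ne_zero fun h => hq (by simp [h])
  -- `H^L` is itself frozen from `D̃₁`, so its commutation with `H^R` is the case `r = 1`, `c =
  -- [N]/N` of the general statement.
  refine ⟨QHS.commute_hamR hq0 hq hN (QHS.isFreezing_hamL hq0 hq hN), fun A => ⟨fun hA => ?_, ?_⟩,
    fun r c A _ hA => QHS.commute_hamR hq0 hq hN hA⟩
  · exact hA.unique hq0 hq hN (QHS.isFreezing_hamR hq0 hq hN)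
  · rintro rfl
    exact QHS.isFreezing_hamR hq0 hq hN
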